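/- Let $n\ge 2$ and let $\bar M$ be a compact Hermitian manifold of complex dimension $n$ with (possibly empty) smooth boundary $\partial M$, with complex structure $J$, Hermitian metric $g$, Chern connection $\nabla$, torsion $T$ and curvature $R$. Let $\chi(\cdot,t)=\frac{\sqrt{-1}}{2}\chi_{j\bar k}(\cdot,t)\,dz_j\wedge d\bar z_k$ be real $(1,1)$-forms on $\bar M$ depending smoothly on the point of $\bar M$ and on $t\in\mathbb R$ (for instance independent of $t$), and let $\psi\in C^\infty(\bar M\times\mathbb R)$. Let $u\in C^4(\bar M)$ be an admissible solution of the complex Monge–Ampère equation $\big(\chi(\cdot,u)+\frac{\sqrt{-1}}{2}\partial\bar\partial u\big)^n=\psi(z,u)\,\omega^n$, that is, in local holomorphic coordinates, with $g_{j\bar k}=g(\partial_{z_j},\partial_{\bar z_k})$, $$\big\{\chi_{j\bar k}(z,u)+u_{j\bar k}\big\}>0,\qquad \det\big(\chi_{j\bar k}(z,u)+u_{j\bar k}\big)=\psi(z,u)\det(g_{j\bar k})\quad\text{on }\bar M .$$ Suppose that $|u|\le a$ and $|\nabla u|\le a$ on $\bar M$, that $\Delta u=g^{i\bar j}u_{i\bar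 j}\le b$, and that $\psi(z,u(z))\ge\delta>0$ for all $z\in\bar M$. Suppose also that $|T|,|\nabla T|,|R|,|\nabla R|\le\kappa$ on $\bar M$ and that $\chi$ and $\psi$, with their covariant derivatives in $z$ and derivatives in $t$ of total order at most $2$, are bounded by $\Lambda$ on $\bar M\times[-a,a]$. Write $u_{\tau\tau}=\nabla^2u(\tau,\tau)$, where $\nabla^2u(X,Y)=Y(Xu)-(\nabla_YX)u$ is the real Hessian. Then there is a constant $C>0$, depending only on $n,a,b,\delta,\kappa,\Lambda$, such that $$\sup_{\tau\in T\bar M,\ |\tau|=1}u_{\tau\tau}\ \le\ C+\max\Big\{0,\ \sup_{p\in\partial M,\ \tau\in T_p\bar M,\ |\tau|=1}u_{\tau\tau}\Big\}.$$ In particular $u_{\tau\tau}\le C$ for all unit $\tau$ if $\partial M=\emptyset$. -/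

import Mathlib

open Bundle Set
open scoped Manifold ContDiff Topology

namespace HermitianMA

noncomputable section

/- `M` is a smooth real manifold, possibly with boundary, with model `I`; a Riemannian metric on `M`
is Mathlib's Riemannian structure `⟪·,·⟫` on the tangent spaces. -/
variable {E : Type*} [NormedAddCommGroup E] [NormedSpace ℝ E] [FiniteDimensional ℝ E]
  {H : Type*} [TopologicalSpace H] {I : ModelWithCorners ℝ E H}
  {M : Type*} [TopologicalSpace M] [ChartedSpace H M] [IsManifold I ∞ M]

/-! ### Hermitian structures and the Chern connection -/

variable (I) in
/-- `(M, J, ⟪·,·⟫)` is a Hermitian manifold: `J` is a smooth integrable almost complex structure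
(its Nijenhuis tensor vanishes) which preserves the metric. -/
structure IsHermitian [RiemannianBundle (fun x : M ↦ TangentSpace I x)]
    (J : ∀ x : M, TangentSpace I x →L[ℝ] TangentSpace I x) : Prop where
  contMDiff : ContMDiff I (I.prod 𝓘(ℝ, E →L[ℝ] E)) ∞
    (fun x : M ↦ (TotalSpace.mk' (E →L[ℝ] E) x (J x) :
      TotalSpace (E →L[ℝ] E) (fun x : M ↦ TangentSpace I x →L[ℝ] TangentSpace I x)))
  sq : ∀ (x : M) (v : TangentSpace I x), J x (J x v) = -v
  compatible : ∀ (x : M) (v w : TangentSpace I x), inner ℝ (J x v) (J x w) = inner ℝ v w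
  integrable : ∀ (x : M) (X Y : ∀ y : M, TangentSpace I y),
    MDifferentiableAt I (I.prod 𝓘(ℝ, E)) (fun y ↦ (⟨y, X y⟩ : TangentBundle I M)) x →
    MDifferentiableAt I (I.prod 𝓘(ℝ, E)) (fun y ↦ (⟨y, Y y⟩ : TangentBundle I M)) x →
    VectorField.mlieBracket I (fun y ↦ J y (X y)) (fun y ↦ J y (Y y)) x
      - J x (VectorField.mlieBracket I (fun y ↦ J y (X y)) Y x)
      - J x (VectorField.mlieBracket I X (fun y ↦ J y (Y y)) x)
      - VectorField.mlieBracket I X Y x = 0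

/-- `cov` is the Chern connection of `(M, J, ⟪·,·⟫)`: the unique connection on `TM` with `∇g = 0`,
`∇J = 0` and torsion without `(1,1)`-part (that is, `∇_{∂/∂z_j} ∂/∂z̄_k = 0`). Recall that Mathlib
writes `cov Y x v` for `(∇_v Y)(x)`. -/
structure IsChern [RiemannianBundle (fun x : M ↦ TangentSpace I x)]
    (J : ∀ x : M, TangentSpace I x →L[ℝ] TangentSpace I x)
    (cov : CovariantDerivative I E (fun x : M ↦ TangentSpace I x)) : Prop where
  smooth : ContMDiffCovariantDerivativeOn E ∞ cov.toFun (univ : Set M)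
  metric : ∀ (x : M) (X Y : ∀ y : M, TangentSpace I y),
    MDifferentiableAt I (I.prod 𝓘(ℝ, E)) (fun y ↦ (⟨y, X y⟩ : TangentBundle I M)) x →
    MDifferentiableAt I (I.prod 𝓘(ℝ, E)) (fun y ↦ (⟨y, Y y⟩ : TangentBundle I M)) x →
    ∀ v : TangentSpace I x, mvfderiv I (fun y ↦ inner ℝ (X y) (Y y)) x v
      = inner ℝ (cov X x v) (Y x) + inner ℝ (X x) (cov Y x v)
  parallel : ∀ (x : M) (X : ∀ y : M, TangentSpace I y),
    MDifferentiableAt I (I.prod 𝓘(ℝ, E)) (fun y ↦ (⟨y, X y⟩ : TangentBundle I M)) x →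
    ∀ v : TangentSpace I x, cov (fun y ↦ J y (X y)) x v = J x (cov X x v)
  torsion : ∀ (x : M) (v w : TangentSpace I x),
    cov.torsion x (J x v) w = J x (cov.torsion x v w)

/-! ### Covariant derivatives of tensors -/

variable (I M) in
/-- Covariant `k`-tensor fields. All tensor fields below are multilinear at each point. -/
abbrev CovTensor (k : ℕ) : Type _ := ∀ x : M, (Fin k → TangentSpace I x) → ℝ

/-- The covariant derivative of a tensor field,
`(∇A)(v₀; v₁, …, v_k) = v₀ (A(V₁, …, V_k)) - ∑ᵢ A(v₁, …, ∇_{v₀} Vᵢ, …, v_k)`,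
where `Vᵢ` is a local smooth vector field with value `vᵢ` at `x`. The direction of differentiation
is the first argument. -/
def covDeriv (cov : CovariantDerivative I E (fun x : M ↦ TangentSpace I x)) {k : ℕ}
    (A : CovTensor I M k) : CovTensor I M (k + 1) := fun x v ↦
  mvfderiv I (fun y ↦ A y (fun i ↦ FiberBundle.extend E (v i.succ) y)) x (v 0)
    - ∑ i : Fin k, A x (Function.update (fun j : Fin k ↦ v j.succ) i
        (cov (FiberBundle.extend E (v i.succ)) x (v 0)))

/-- The iterated covariant derivative `∇ʲA`. -/
def covDerivIter (cov : CovariantDerivative I E (fun x : M ↦ TangentSpace I x)) {k : ℕ}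
    (A : CovTensor I M k) : ∀ j : ℕ, CovTensor I M (k + j)
  | 0 => A
  | j + 1 => covDeriv cov (covDerivIter cov A j)

/-- A function as a `0`-tensor. -/
def scalarTensor (f : M → ℝ) : CovTensor I M 0 := fun x _ ↦ f x

/-- The Hessian `∇²u(X, Y) = Y(Xu) - (∇_Y X)u`. -/
def hess (cov : CovariantDerivative I E (fun x : M ↦ TangentSpace I x)) (u : M → ℝ) (x : M)
    (v w : TangentSpace I x) : ℝ :=
  covDeriv cov (covDeriv cov (scalarTensor u)) x ![w, v]

/-- The curvature `R(a, b)c = ∇_X ∇_Y Z - ∇_Y ∇_X Z - ∇_{[X,Y]} Z`, for local smooth fields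
`X, Y, Z` with values `a, b, c` at `x`. -/
def curvature (cov : CovariantDerivative I E (fun x : M ↦ TangentSpace I x)) (x : M)
    (a b c : TangentSpace I x) : TangentSpace I x :=
  let X : ∀ y : M, TangentSpace I y := FiberBundle.extend E a
  let Y : ∀ y : M, TangentSpace I y := FiberBundle.extend E b
  let Z : ∀ y : M, TangentSpace I y := FiberBundle.extend E c
  cov (fun y ↦ cov Z y (Y y)) x a - cov (fun y ↦ cov Z y (X y)) x b
    - cov Z x (VectorField.mlieBracket I X Y x)

section Norms

variable [RiemannianBundle (fun x : M ↦ TangentSpace I x)]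

/-- The torsion as a covariant tensor `g(T(v₀, v₁), v₂)`. -/
def torsionTensor (cov : CovariantDerivative I E (fun x : M ↦ TangentSpace I x)) :
    CovTensor I M 3 :=
  fun x v ↦ inner ℝ (cov.torsion x (v 0) (v 1)) (v 2)

/-- The curvature as a covariant tensor `R(v₀, v₁, v₂, v₃) = g(R(v₀, v₁)v₂, v₃)`. -/
def curvatureTensor (cov : CovariantDerivative I E (fun x : M ↦ TangentSpace I x)) :
    CovTensor I M 4 :=
  fun x v ↦ inner ℝ (curvature cov x (v 0) (v 1) (v 2)) (v 3)

/-- `sup_M |A| ≤ K`, in the operator norm of multilinear forms with respect to the metric. -/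
def TensorBound {k : ℕ} (A : CovTensor I M k) (K : ℝ) : Prop :=
  ∀ (x : M) (v : Fin k → TangentSpace I x), |A x v| ≤ K * ∏ i, ‖v i‖

/-- `|u|_{C¹(M)} ≤ a`: `|u| ≤ a` and `|∇u| ≤ a`. -/
def C1Bound (cov : CovariantDerivative I E (fun x : M ↦ TangentSpace I x)) (u : M → ℝ)
    (a : ℝ) : Prop :=
  ∀ j ≤ 1, TensorBound (covDerivIter cov (scalarTensor (I := I) u) j) a

/-- `|A|_{C²(M × [-a, a])} ≤ Λ` for a family `A t` of tensor fields depending on a parameter `t`: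
all `∇ʲ ∂ₜˡ A` with `j + l ≤ 2` are bounded by `Λ` on `M × [-a, a]`. -/
def C2Bound (cov : CovariantDerivative I E (fun x : M ↦ TangentSpace I x)) {k : ℕ}
    (A : ℝ → CovTensor I M k) (a Λ : ℝ) : Prop :=
  ∀ j l : ℕ, j + l ≤ 2 → ∀ t : ℝ, |t| ≤ a →
    TensorBound (covDerivIter cov (fun x v ↦ iteratedDeriv l (fun s ↦ A s x v) t) j) Λ

/-- The torsion and the curvature of `cov` and their first covariant derivatives are bounded by `κ`. -/
def GeometryBound (cov : CovariantDerivative I E (fun x : M ↦ TangentSpace I x)) (κ : ℝ) : Prop :=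
  ∀ j ≤ 1, TensorBound (covDerivIter cov (torsionTensor cov) j) κ ∧
    TensorBound (covDerivIter cov (curvatureTensor cov) j) κ

end Norms

/-! ### Complex components and the Monge-Ampère equation -/

/-- For `h` real bilinear on `T_xM`, extended complex bilinearly, the number `h(∂_v, ∂̄_w)` where
`∂_v = (v - iJv)/2` and `∂̄_w = (w + iJw)/2`. For `v = ∂/∂x_j`, `w = ∂/∂x_k` in holomorphic
coordinates `z_j = x_j + iy_j` these are the components `h_{jk̄} = h(∂/∂z_j, ∂/∂z̄_k)`. -/
def component (J : ∀ x : M, TangentSpace I x →L[ℝ] TangentSpace I x) (x : M)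
    (h : TangentSpace I x → TangentSpace I x → ℝ) (v w : TangentSpace I x) : ℂ :=
  (((h v w + h (J x v) (J x w) : ℝ) : ℂ) +
    Complex.I * ((h v (J x w) - h (J x v) w : ℝ) : ℂ)) / 4

/-- The components `g_{jk̄}` of the metric. -/
def metricComp [RiemannianBundle (fun x : M ↦ TangentSpace I x)]
    (J : ∀ x : M, TangentSpace I x →L[ℝ] TangentSpace I x) (x : M)
    (v w : TangentSpace I x) : ℂ :=
  component J x (fun a b ↦ inner ℝ a b) v w

/-- The components `u_{jk̄} = ∂²u/∂z_j∂z̄_k`. -/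
def hessComp (J : ∀ x : M, TangentSpace I x →L[ℝ] TangentSpace I x)
    (cov : CovariantDerivative I E (fun x : M ↦ TangentSpace I x)) (u : M → ℝ) (x : M)
    (v w : TangentSpace I x) : ℂ :=
  component J x (hess cov u x) v w

/-- The components `χ_{jk̄}` of a real `(1,1)`-form `χ = (i/2) χ_{jk̄} dz_j ∧ dz̄_k`, normalized
so that the Kähler form `ω(v, w) = -g(v, Jw)` has the components `g_{jk̄}`. -/
def formComp (J : ∀ x : M, TangentSpace I x →L[ℝ] TangentSpace I x) (x : M)
    (χ : TangentSpace I x →L[ℝ] TangentSpace I x →L[ℝ] ℝ) (v w : TangentSpace I x) : ℂ :=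
  component J x (fun a b ↦ χ a (J x b)) v w

/-- A smooth family `χ(·, t)`, `t ∈ ℝ`, of real `(1,1)`-forms on `M`. -/
structure IsSmoothForm11 (J : ∀ x : M, TangentSpace I x →L[ℝ] TangentSpace I x)
    (χ : ∀ x : M, ℝ → TangentSpace I x →L[ℝ] TangentSpace I x →L[ℝ] ℝ) : Prop where
  contMDiff : ContMDiff (I.prod 𝓘(ℝ, ℝ)) (I.prod 𝓘(ℝ, E →L[ℝ] E →L[ℝ] ℝ)) ∞
    (fun q : M × ℝ ↦ (TotalSpace.mk' (E →L[ℝ] E →L[ℝ] ℝ) q.1 (χ q.1 q.2) :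
      TotalSpace (E →L[ℝ] E →L[ℝ] ℝ)
        (fun x : M ↦ TangentSpace I x →L[ℝ] TangentSpace I x →L[ℝ] ℝ)))
  alternating : ∀ (x : M) (t : ℝ) (v w : TangentSpace I x), χ x t v w = -χ x t w v
  invariant : ∀ (x : M) (t : ℝ) (v w : TangentSpace I x), χ x t (J x v) (J x w) = χ x t v w

/-- `χ` as a family of covariant `2`-tensors. -/
def formTensor (χ : ∀ x : M, ℝ → TangentSpace I x →L[ℝ] TangentSpace I x →L[ℝ] ℝ) :
    ℝ → CovTensor I M 2 := fun t x v ↦ χ x t (v 0) (v 1)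

/-- `u` is admissible: `χ_u = χ(·, u) + (i/2) ∂∂̄u > 0`. -/
def IsAdmissible (J : ∀ x : M, TangentSpace I x →L[ℝ] TangentSpace I x)
    (cov : CovariantDerivative I E (fun x : M ↦ TangentSpace I x))
    (χ : ∀ x : M, ℝ → TangentSpace I x →L[ℝ] TangentSpace I x →L[ℝ] ℝ) (u : M → ℝ) : Prop :=
  ∀ (x : M) (v : TangentSpace I x), v ≠ 0 →
    0 < (formComp J x (χ x (u x)) v v + hessComp J cov u x v v).re

/-- The complex Monge-Ampère equation `(χ_u)ⁿ = ψ(z, u) ωⁿ`, that is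
`det(χ_{jk̄} + u_{jk̄}) = ψ(z, u) det(g_{jk̄})`, with respect to arbitrary `n`-tuples of tangent
vectors; both sides scale in the same way under a change of complex frame. -/
def SolvesMA [RiemannianBundle (fun x : M ↦ TangentSpace I x)] (n : ℕ)
    (J : ∀ x : M, TangentSpace I x →L[ℝ] TangentSpace I x)
    (cov : CovariantDerivative I E (fun x : M ↦ TangentSpace I x))
    (χ : ∀ x : M, ℝ → TangentSpace I x →L[ℝ] TangentSpace I x →L[ℝ] ℝ)
    (ψ : M → ℝ → ℝ) (u : M → ℝ) : Prop :=
  ∀ (x : M) (e : Fin n → TangentSpace I x),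
    (Matrix.of fun j k ↦ formComp J x (χ x (u x)) (e j) (e k) + hessComp J cov u x (e j) (e k)).det
      = (ψ x (u x) : ℂ) * (Matrix.of fun j k ↦ metricComp J x (e j) (e k)).det

/-- `sup_M Δu ≤ b` for the Chern Laplacian `Δu = g^{ij̄} u_{ij̄}`, which is `∑_j u_{jj̄}` in any frame
with `g_{jk̄} = δ_{jk}`. -/
def LaplacianBound [RiemannianBundle (fun x : M ↦ TangentSpace I x)] (n : ℕ)
    (J : ∀ x : M, TangentSpace I x →L[ℝ] TangentSpace I x)
    (cov : CovariantDerivative I E (fun x : M ↦ TangentSpace I x)) (u : M → ℝ) (b : ℝ) : Prop :=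
  ∀ (x : M) (e : Fin n → TangentSpace I x),
    (∀ j k, metricComp J x (e j) (e k) = if j = k then 1 else 0) →
    ∑ j, (hessComp J cov u x (e j) (e j)).re ≤ b

end

end HermitianMA

/-! The test function is W(z, τ) = u_ττ + (τu)² on the unit sphere bundle, which is compact, so W
has a maximum. Over a boundary point, the boundary hypothesis bounds it by B + a². It remains to
bound X = u_ττ at a maximum over an interior point y, and for this it suffices to show X² ≤ C·X when
X > 1.

Carrying τ parallel along a geodesic with velocity v, the second derivative test gives ∇⁴u(v,v,τ,τ)
+ 2∇²u(v,τ)² + 2(τu)∇³u(v,v,τ) ≤ 0 (`Solves.maximum_le`). In a unitary frame e_j that diagonalizes χ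
+ u_{jk̄} with eigenvalues l_j, these inequalities for v = e_j and v = J e_j are added with weight
1/l_j. The bound on Δu gives l_j ≤ B, and det = ψ ≥ δ then bounds l_j from below, so the squares
∇²u(v,τ)² add up to at least a positive multiple of X². Producing them is the purpose of the term
(τu)². Everything else has to be linear in X or absorbed.

Second derivatives: admissibility bounds u_vv + u_{Jv,Jv} from below, so the whole Hessian is O(X)
(`abs_hess_le`).

Fourth and third derivatives: the traces over the line of e and Je are compared with τ-derivatives
of the components u_{jj̄}. The Chern torsion is complex bilinear, so in this trace the commutators
leave, besides terms of order at most two, only third derivatives of mixed type ∂_τ u_{kj̄}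
(`trace_nab2_hess`, `trace_hess_comm`).

The equation: its first derivative controls ∑ ∂_τ(χ+u)_{jj̄}/l_j. Its second derivative is the
logarithmic concavity of the determinant and yields ∑ |∂_τ(χ+u)_{jk̄}|²/(l_j l_k) on the favourable
side (`Solves.equation_jet`). Completing the square, this sum absorbs the mixed third derivatives
(`sum_estimate`). `Bounded.hess_le` puts the pieces together.

All of this is local and is done in one chart with Christoffel symbols Γ. Only 2-jets at y matter,
so geodesics and parallel fields are replaced by explicit quadratic polynomials and no differential
equation is solved. `solves_chartData` and `bounded_chartData` carry the hypotheses on the manifold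
to the chart, and `exists_isMax_hessAddSq` provides the maximum. -/

section

set_option maxSynthPendingDepth 6

namespace HermitianMA

open Filter

/-! ### Covariant calculus in a coordinate chart -/

namespace Chart

noncomputable section

variable {E : Type*} [NormedAddCommGroup E] [NormedSpace ℝ E]

open ContinuousLinearMap (compL flipₗᵢ)

/-- Exchanging the arguments of a bilinear map. -/
def swap (F : Type*) [NormedAddCommGroup F] [NormedSpace ℝ F] :
    (E →L[ℝ] E →L[ℝ] F) →L[ℝ] E →L[ℝ] E →L[ℝ] F :=
  (flipₗᵢ ℝ E E F).toContinuousLinearEquiv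

@[simp] lemma swap_apply {F : Type*} [NormedAddCommGroup F] [NormedSpace ℝ F]
    (B : E →L[ℝ] E →L[ℝ] F) (a b : E) : swap F B a b = B b a := rfl

/-- The covariant derivative of a `1`-form, direction first. -/
def nab1 (Γ : E → E →L[ℝ] E →L[ℝ] E) (θ : E → E →L[ℝ] ℝ) (y : E) : E →L[ℝ] E →L[ℝ] ℝ :=
  fderiv ℝ θ y - (compL ℝ E E ℝ (θ y)) ∘L Γ y

/-- The covariant derivative of a covariant `2`-tensor, direction first. -/
def nab2 (Γ : E → E →L[ℝ] E →L[ℝ] E) (B : E → E →L[ℝ] E →L[ℝ] ℝ) (y : E) :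
    E →L[ℝ] E →L[ℝ] E →L[ℝ] ℝ :=
  fderiv ℝ B y - (compL ℝ E E (E →L[ℝ] ℝ) (B y)) ∘L Γ y
    - swap ℝ ∘L
      ((compL ℝ E E (E →L[ℝ] ℝ) (swap ℝ (B y))) ∘L Γ y)

/-- The covariant derivative of a covariant `3`-tensor, direction first. -/
def nab3 (Γ : E → E →L[ℝ] E →L[ℝ] E) (B : E → E →L[ℝ] E →L[ℝ] E →L[ℝ] ℝ) (y a b c d : E) : ℝ :=
  fderiv ℝ B y a b c d - B y (Γ y a b) c d - B y b (Γ y a c) d - B y b c (Γ y a d)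

/-- The torsion of the connection with Christoffel symbols `Γ`. -/
def tor (Γ : E → E →L[ℝ] E →L[ℝ] E) (y : E) : E →L[ℝ] E →L[ℝ] E :=
  Γ y - swap E (Γ y)

/-- The covariant derivative of the torsion. -/
def nabTor (Γ : E → E →L[ℝ] E →L[ℝ] E) (y a b c : E) : E :=
  fderiv ℝ (tor Γ) y a b c + Γ y a (tor Γ y b c) - tor Γ y (Γ y a b) c - tor Γ y b (Γ y a c)

/-- The curvature of the connection with Christoffel symbols `Γ`. -/
def curv (Γ : E → E →L[ℝ] E →L[ℝ] E) (y : E) : E →L[ℝ] E →L[ℝ] E →L[ℝ] E :=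
  fderiv ℝ Γ y - swap (E →L[ℝ] E) (fderiv ℝ Γ y)
    + ((compL ℝ E (E →L[ℝ] E) (E →L[ℝ] E)).flip (Γ y)) ∘L ((compL ℝ E E E) ∘L Γ y)
    - swap (E →L[ℝ] E)
      (((compL ℝ E (E →L[ℝ] E) (E →L[ℝ] E)).flip (Γ y)) ∘L ((compL ℝ E E E) ∘L Γ y))

/-- The covariant derivative of the curvature. -/
def nabCurv (Γ : E → E →L[ℝ] E →L[ℝ] E) (y a b c d : E) : E :=
  fderiv ℝ (curv Γ) y a b c d + Γ y a (curv Γ y b c d) - curv Γ y (Γ y a b) c d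
    - curv Γ y b (Γ y a c) d - curv Γ y b c (Γ y a d)

variable {Γ : E → E →L[ℝ] E →L[ℝ] E} {y₀ : E}

lemma nab1_apply (θ : E → E →L[ℝ] ℝ) (y a b : E) :
    nab1 Γ θ y a b = fderiv ℝ θ y a b - θ y (Γ y a b) := rfl

lemma nab2_apply (B : E → E →L[ℝ] E →L[ℝ] ℝ) (y a b c : E) :
    nab2 Γ B y a b c = fderiv ℝ B y a b c - B y (Γ y a b) c - B y b (Γ y a c) := rfl

lemma tor_apply (y a b : E) : tor Γ y a b = Γ y a b - Γ y b a := rfl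

lemma curv_apply (y a b c : E) : curv Γ y a b c =
    fderiv ℝ Γ y a b c - fderiv ℝ Γ y b a c + Γ y a (Γ y b c) - Γ y b (Γ y a c) := rfl

/-! #### Smoothness -/

lemma contDiffAt_nab1 {m n : ℕ∞ω} (hmn : m + 1 ≤ n) {θ : E → E →L[ℝ] ℝ}
    (hΓ : ContDiffAt ℝ m Γ y₀) (hθ : ContDiffAt ℝ n θ y₀) : ContDiffAt ℝ m (nab1 Γ θ) y₀ := by
  have h1 : ContDiffAt ℝ m (fderiv ℝ θ) y₀ := hθ.fderiv_right hmn
  have h2 : ContDiffAt ℝ m θ y₀ := hθ.of_le (le_trans le_self_add hmn)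
  exact h1.sub (((compL ℝ E E ℝ).contDiff.contDiffAt.comp y₀ h2).clm_comp hΓ)

lemma contDiffAt_nab2 {m n : ℕ∞ω} (hmn : m + 1 ≤ n) {B : E → E →L[ℝ] E →L[ℝ] ℝ}
    (hΓ : ContDiffAt ℝ m Γ y₀) (hB : ContDiffAt ℝ n B y₀) : ContDiffAt ℝ m (nab2 Γ B) y₀ := by
  have h1 : ContDiffAt ℝ m (fderiv ℝ B) y₀ := hB.fderiv_right hmn
  have h2 : ContDiffAt ℝ m B y₀ := hB.of_le (le_trans le_self_add hmn)
  have h3 := ((compL ℝ E E (E →L[ℝ] ℝ)).contDiff.contDiffAt.comp y₀ h2).clm_comp hΓ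
  have h4 := ((compL ℝ E E (E →L[ℝ] ℝ)).contDiff.contDiffAt.comp y₀
    ((swap (E := E) ℝ).contDiff.contDiffAt.comp y₀ h2)).clm_comp hΓ
  have h5 := (contDiffAt_const (c := swap (E := E) ℝ)).clm_comp h4
  exact (h1.sub h3).sub h5

lemma contDiffAt_tor {m : ℕ∞ω} (hΓ : ContDiffAt ℝ m Γ y₀) : ContDiffAt ℝ m (tor Γ) y₀ :=
  hΓ.sub ((swap (E := E) E).contDiff.contDiffAt.comp y₀ hΓ)

lemma contDiffAt_curv {m n : ℕ∞ω} (hmn : m + 1 ≤ n) (hΓ : ContDiffAt ℝ n Γ y₀) :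
    ContDiffAt ℝ m (curv Γ) y₀ := by
  have h1 : ContDiffAt ℝ m (fderiv ℝ Γ) y₀ := hΓ.fderiv_right hmn
  have h2 : ContDiffAt ℝ m Γ y₀ := hΓ.of_le (le_trans le_self_add hmn)
  have h3 := (((compL ℝ E (E →L[ℝ] E) (E →L[ℝ] E)).flip.contDiff.contDiffAt.comp y₀ h2).clm_comp
    ((contDiffAt_const (c := compL ℝ E E E)).clm_comp h2))
  exact ((h1.sub ((swap (E := E) (E →L[ℝ] E)).contDiff.contDiffAt.comp y₀ h1)).add
    h3).sub ((swap (E := E) (E →L[ℝ] E)).contDiff.contDiffAt.comp y₀ h3)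

/-! #### The Leibniz rule along a curve -/

section Leibniz

variable {x : ℝ → E} {t : ℝ} {a : E} {W W₁ W₂ W₃ : ℝ → E} {w w₁ w₂ w₃ : E}

lemma hasDerivAt_form1 {θ : E → E →L[ℝ] ℝ} (hθ : DifferentiableAt ℝ θ (x t))
    (hx : HasDerivAt x a t) (hW : HasDerivAt W (w - Γ (x t) a (W t)) t) :
    HasDerivAt (fun s ↦ θ (x s) (W s)) (nab1 Γ θ (x t) a (W t) + θ (x t) w) t := by
  refine ((hθ.hasFDerivAt.comp_hasDerivAt t hx).clm_apply hW).congr_deriv ?_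
  simp [nab1_apply]; ring

lemma hasDerivAt_form2 {B : E → E →L[ℝ] E →L[ℝ] ℝ} (hB : DifferentiableAt ℝ B (x t))
    (hx : HasDerivAt x a t) (hW₁ : HasDerivAt W₁ (w₁ - Γ (x t) a (W₁ t)) t)
    (hW₂ : HasDerivAt W₂ (w₂ - Γ (x t) a (W₂ t)) t) :
    HasDerivAt (fun s ↦ B (x s) (W₁ s) (W₂ s))
      (nab2 Γ B (x t) a (W₁ t) (W₂ t) + B (x t) w₁ (W₂ t) + B (x t) (W₁ t) w₂) t := by
  refine (((hB.hasFDerivAt.comp_hasDerivAt t hx).clm_apply hW₁).clm_apply hW₂).congr_deriv ?_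
  simp [nab2_apply]; ring

lemma hasDerivAt_form3 {B : E → E →L[ℝ] E →L[ℝ] E →L[ℝ] ℝ} (hB : DifferentiableAt ℝ B (x t))
    (hx : HasDerivAt x a t) (hW₁ : HasDerivAt W₁ (w₁ - Γ (x t) a (W₁ t)) t)
    (hW₂ : HasDerivAt W₂ (w₂ - Γ (x t) a (W₂ t)) t)
    (hW₃ : HasDerivAt W₃ (w₃ - Γ (x t) a (W₃ t)) t) :
    HasDerivAt (fun s ↦ B (x s) (W₁ s) (W₂ s) (W₃ s))
      (nab3 Γ B (x t) a (W₁ t) (W₂ t) (W₃ t) + B (x t) w₁ (W₂ t) (W₃ t)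
        + B (x t) (W₁ t) w₂ (W₃ t) + B (x t) (W₁ t) (W₂ t) w₃) t := by
  refine ((((hB.hasFDerivAt.comp_hasDerivAt t hx).clm_apply hW₁).clm_apply hW₂).clm_apply hW₃).congr_deriv ?_
  simp [nab3]; ring

lemma hasDerivAt_tor (hΓ : DifferentiableAt ℝ (tor Γ) (x t))
    (hx : HasDerivAt x a t) (hW₁ : HasDerivAt W₁ (- Γ (x t) a (W₁ t)) t)
    (hW₂ : HasDerivAt W₂ (- Γ (x t) a (W₂ t)) t) :
    HasDerivAt (fun s ↦ tor Γ (x s) (W₁ s) (W₂ s))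
      (nabTor Γ (x t) a (W₁ t) (W₂ t) - Γ (x t) a (tor Γ (x t) (W₁ t) (W₂ t))) t := by
  refine (((hΓ.hasFDerivAt.comp_hasDerivAt t hx).clm_apply hW₁).clm_apply hW₂).congr_deriv ?_
  simp [nabTor]; abel

lemma hasDerivAt_curv (hΓ : DifferentiableAt ℝ (curv Γ) (x t))
    (hx : HasDerivAt x a t) (hW₁ : HasDerivAt W₁ (- Γ (x t) a (W₁ t)) t)
    (hW₂ : HasDerivAt W₂ (- Γ (x t) a (W₂ t)) t) (hW₃ : HasDerivAt W₃ (- Γ (x t) a (W₃ t)) t) :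
    HasDerivAt (fun s ↦ curv Γ (x s) (W₁ s) (W₂ s) (W₃ s))
      (nabCurv Γ (x t) a (W₁ t) (W₂ t) (W₃ t)
        - Γ (x t) a (curv Γ (x t) (W₁ t) (W₂ t) (W₃ t))) t := by
  refine ((((hΓ.hasFDerivAt.comp_hasDerivAt t hx).clm_apply hW₁).clm_apply hW₂).clm_apply hW₃).congr_deriv ?_
  simp [nabCurv]; abel

/-- `hpar` expresses ∇J = 0 in the direction `a`, so J commutes with the covariant derivative along
the curve. -/
lemma hasDerivAt_endo {J : E → E →L[ℝ] E} (hJ : DifferentiableAt ℝ J (x t))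
    (hpar : ∀ b, fderiv ℝ J (x t) a b = J (x t) (Γ (x t) a b) - Γ (x t) a (J (x t) b))
    (hx : HasDerivAt x a t) (hW : HasDerivAt W (w - Γ (x t) a (W t)) t) :
    HasDerivAt (fun s ↦ J (x s) (W s)) (J (x t) w - Γ (x t) a (J (x t) (W t))) t := by
  refine ((hJ.hasFDerivAt.comp_hasDerivAt t hx).clm_apply hW).congr_deriv ?_
  simp [hpar]

end Leibniz

/-! #### Ricci identities -/

/-- Second partial derivatives commute, so only the antisymmetric part of Γ survives. -/
lemma nab1_fderiv_comm {u : E → ℝ} {y : E} (hu : ContDiffAt ℝ 2 u y) (a b : E) :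
    nab1 Γ (fderiv ℝ u) y a b - nab1 Γ (fderiv ℝ u) y b a = - fderiv ℝ u y (tor Γ y a b) := by
  have := hu.isSymmSndFDerivAt (by simp) a b
  simp only [nab1_apply, tor_apply, map_sub, this]; ring

/-- Second partial derivatives of θ cancel; the antisymmetric part of Γ gives the torsion term,
while ∂Γ and the quadratic terms in Γ assemble into the curvature. -/
lemma nab2_nab1_comm {θ : E → E →L[ℝ] ℝ} {y : E} (hθ : ContDiffAt ℝ 2 θ y)
    (hΓ : DifferentiableAt ℝ Γ y) (a b c : E) :
    nab2 Γ (nab1 Γ θ) y a b c - nab2 Γ (nab1 Γ θ) y b a c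
      = - nab1 Γ θ y (tor Γ y a b) c - θ y (curv Γ y a b c) := by
  have hs : fderiv ℝ (fderiv ℝ θ) y a b = fderiv ℝ (fderiv ℝ θ) y b a :=
    hθ.isSymmSndFDerivAt (by simp) a b
  have hθ1 : DifferentiableAt ℝ θ y := hθ.differentiableAt (by simp)
  have hθ2 : DifferentiableAt ℝ (fderiv ℝ θ) y :=
    (hθ.fderiv_right (m := 1) (by norm_num)).differentiableAt (by simp)
  have key : ∀ a b c, fderiv ℝ (nab1 Γ θ) y a b c = fderiv ℝ (fderiv ℝ θ) y a b c
      - fderiv ℝ θ y a (Γ y b c) - θ y (fderiv ℝ Γ y a b c) := by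
    intro a b c
    have h1 : HasFDerivAt (nab1 Γ θ) _ y := hθ2.hasFDerivAt.sub
      (((compL ℝ E E ℝ).hasFDerivAt.comp y hθ1.hasFDerivAt).clm_comp hΓ.hasFDerivAt)
    rw [h1.fderiv]
    simp; ring
  simp only [nab2_apply, key, nab1_apply, curv_apply, tor_apply, map_sub, map_add, hs,
    sub_apply]
  ring

lemma nab3_nab2_comm {B : E → E →L[ℝ] E →L[ℝ] ℝ} {y : E} (hB : ContDiffAt ℝ 2 B y)
    (hΓ : DifferentiableAt ℝ Γ y) (a b c d : E) :
    nab3 Γ (nab2 Γ B) y a b c d - nab3 Γ (nab2 Γ B) y b a c d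
      = - nab2 Γ B y (tor Γ y a b) c d - B y (curv Γ y a b c) d - B y c (curv Γ y a b d) := by
  have hs : fderiv ℝ (fderiv ℝ B) y a b = fderiv ℝ (fderiv ℝ B) y b a :=
    hB.isSymmSndFDerivAt (by simp) a b
  have hB1 : DifferentiableAt ℝ B y := hB.differentiableAt (by simp)
  have hB2 : DifferentiableAt ℝ (fderiv ℝ B) y :=
    (hB.fderiv_right (m := 1) (by norm_num)).differentiableAt (by simp)
  have key : ∀ a b c d, fderiv ℝ (nab2 Γ B) y a b c d = fderiv ℝ (fderiv ℝ B) y a b c d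
      - fderiv ℝ B y a (Γ y b c) d - B y (fderiv ℝ Γ y a b c) d
      - fderiv ℝ B y a c (Γ y b d) - B y c (fderiv ℝ Γ y a b d) := by
    intro a b c d
    have h1 : HasFDerivAt (nab2 Γ B) _ y := (hB2.hasFDerivAt.sub
      (((compL ℝ E E (E →L[ℝ] ℝ)).hasFDerivAt.comp y hB1.hasFDerivAt).clm_comp
        hΓ.hasFDerivAt)).sub ((hasFDerivAt_const
          (swap (E := E) ℝ) y).clm_comp
        (((compL ℝ E E (E →L[ℝ] ℝ)).hasFDerivAt.comp y
          ((swap (E := E) ℝ).hasFDerivAt.comp y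
            hB1.hasFDerivAt)).clm_comp hΓ.hasFDerivAt))
    rw [h1.fderiv]
    simp; ring
  simp only [nab3, key, nab2_apply, curv_apply, tor_apply, map_sub, map_add, hs,
    sub_apply, add_apply]
  ring

end

end Chart

/-! ### Second order jets of functions of one variable -/

/-- Near `0` the function `f` is differentiable, and `f'(0) = f₁`, `f''(0) = f₂`. -/
def Jet2 {F : Type*} [NormedAddCommGroup F] [NormedSpace ℝ F] (f : ℝ → F) (f₁ f₂ : F) : Prop :=
  ∃ f' : ℝ → F, (∀ᶠ t in 𝓝 0, HasDerivAt f (f' t) t) ∧ f' 0 = f₁ ∧ HasDerivAt f' f₂ 0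

namespace Jet2

variable {F G : Type*} [NormedAddCommGroup F] [NormedSpace ℝ F] [NormedAddCommGroup G]
  [NormedSpace ℝ G] {f g : ℝ → F} {f₁ f₂ g₁ g₂ : F}

lemma hasDerivAt (h : Jet2 f f₁ f₂) : HasDerivAt f f₁ 0 := by
  obtain ⟨f', h, rfl, -⟩ := h
  exact h.self_of_nhds

lemma congr (h : Jet2 f f₁ f₂) (hfg : g =ᶠ[𝓝 0] f) : Jet2 g f₁ f₂ := by
  obtain ⟨f', h, h0, h'⟩ := h
  refine ⟨f', ?_, h0, h'⟩
  filter_upwards [h, hfg.eventuallyEq_nhds] with t ht ht'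
  exact ht.congr_of_eventuallyEq ht'

/-- Two computations of the same jet, for instance in coordinates and in covariant terms, may be
equated. -/
lemma unique (h : Jet2 f f₁ f₂) (h' : Jet2 f g₁ g₂) : f₁ = g₁ ∧ f₂ = g₂ := by
  refine ⟨h.hasDerivAt.unique h'.hasDerivAt, ?_⟩
  obtain ⟨f', h, -, h2⟩ := h
  obtain ⟨g', h', -, h2'⟩ := h'
  have : f' =ᶠ[𝓝 0] g' := by
    filter_upwards [h, h'] with t ht ht'
    exact ht.unique ht'
  exact (h2.congr_of_eventuallyEq this.symm).unique h2'

lemma congr_jet (h : Jet2 f f₁ f₂) (h₁ : f₁ = g₁) (h₂ : f₂ = g₂) : Jet2 f g₁ g₂ := h₁ ▸ h₂ ▸ h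

lemma const (c : F) : Jet2 (fun _ ↦ c) 0 0 :=
  ⟨fun _ ↦ 0, .of_forall fun t ↦ hasDerivAt_const t c, rfl, hasDerivAt_const _ _⟩

lemma add (hf : Jet2 f f₁ f₂) (hg : Jet2 g g₁ g₂) :
    Jet2 (fun t ↦ f t + g t) (f₁ + g₁) (f₂ + g₂) := by
  obtain ⟨f', h, rfl, h2⟩ := hf
  obtain ⟨g', h', rfl, h2'⟩ := hg
  exact ⟨_, (h.and h').mono fun t ht ↦ ht.1.add ht.2, rfl, h2.add h2'⟩

lemma clm (L : F →L[ℝ] G) (hf : Jet2 f f₁ f₂) : Jet2 (fun t ↦ L (f t)) (L f₁) (L f₂) := by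
  obtain ⟨f', h, rfl, h2⟩ := hf
  exact ⟨_, h.mono fun t ht ↦ L.hasFDerivAt.comp_hasDerivAt t ht, rfl,
    L.hasFDerivAt.comp_hasDerivAt 0 h2⟩

lemma neg (hf : Jet2 f f₁ f₂) : Jet2 (fun t ↦ - f t) (-f₁) (-f₂) := by
  simpa using hf.clm (-ContinuousLinearMap.id ℝ F)

lemma sub (hf : Jet2 f f₁ f₂) (hg : Jet2 g g₁ g₂) :
    Jet2 (fun t ↦ f t - g t) (f₁ - g₁) (f₂ - g₂) := by
  simpa [sub_eq_add_neg] using hf.add hg.neg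

lemma const_mul {𝕜 : Type*} [NormedRing 𝕜] [NormedAlgebra ℝ 𝕜] {f : ℝ → 𝕜} {f₁ f₂ : 𝕜}
    (c : 𝕜) (hf : Jet2 f f₁ f₂) : Jet2 (fun t ↦ c * f t) (c * f₁) (c * f₂) :=
  hf.clm (ContinuousLinearMap.mul ℝ 𝕜 c)

lemma mul {𝕜 : Type*} [NormedCommRing 𝕜] [NormedAlgebra ℝ 𝕜] {f g : ℝ → 𝕜} {f₁ f₂ g₁ g₂ : 𝕜}
    (hf : Jet2 f f₁ f₂) (hg : Jet2 g g₁ g₂) :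
    Jet2 (fun t ↦ f t * g t) (f₁ * g 0 + f 0 * g₁) (f₂ * g 0 + 2 * f₁ * g₁ + f 0 * g₂) := by
  have hf0 := hf.hasDerivAt
  have hg0 := hg.hasDerivAt
  obtain ⟨f', h, rfl, h2⟩ := hf
  obtain ⟨g', h', rfl, h2'⟩ := hg
  refine ⟨_, (h.and h').mono fun t ht ↦ ht.1.mul ht.2, rfl, ?_⟩
  exact ((h2.mul hg0).add (hf0.mul h2')).congr_deriv (by ring)

/-- At a local maximum the second derivative is nonpositive. -/
lemma nonpos_of_isLocalMax {f : ℝ → ℝ} {f₁ f₂ : ℝ} (h : Jet2 f f₁ f₂) (hm : IsLocalMax f 0) :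
    f₂ ≤ 0 := by
  have h1 : f₁ = 0 := hm.hasDerivAt_eq_zero h.hasDerivAt
  obtain ⟨f', h, h0, h2⟩ := h
  -- If f''(0) > 0, the second derivative test makes 0 a local minimum as well. Then f is locally
  -- constant and its jet vanishes.
  by_contra! hpos
  have hd : deriv f =ᶠ[𝓝 0] f' := h.mono fun t ht ↦ ht.deriv
  have hmin : IsLocalMin f 0 := by
    apply isLocalMin_of_deriv_deriv_pos
    · rw [hd.deriv_eq, h2.deriv]; exact hpos
    · rw [hd.self_of_nhds, h0, h1]
    · exact h.self_of_nhds.continuousAt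
  have hconst : f =ᶠ[𝓝 0] fun _ ↦ f 0 := by
    filter_upwards [hm, hmin] with t h1 h2
    exact le_antisymm h1 h2
  have hj : Jet2 f 0 0 := (const (f 0)).congr hconst
  have := (Jet2.unique ⟨f', h, h0, h2⟩ hj).2
  linarith

end Jet2

namespace Chart

noncomputable section

variable {E : Type*} [NormedAddCommGroup E] [NormedSpace ℝ E]
  (Γ : E → E →L[ℝ] E →L[ℝ] E) (y₀ a : E)

/-! ### Geodesics and parallel fields to second order -/

/-- A curve through `y₀` with velocity `a`, geodesic to second order. -/
def geod (t : ℝ) : E := y₀ + t • a - (t ^ 2 / 2) • Γ y₀ a a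

/-- The velocity of `geod`. -/
def geodVel (t : ℝ) : E := a - t • Γ y₀ a a

/-- A field along `geod` with value `b` at `0`, parallel to second order. -/
def parField (b : E) (t : ℝ) : E :=
  b - t • Γ y₀ a b
    -- The coefficient is W''(0), obtained by differentiating W' = -Γ(x', W) once, with x'' = -Γ(a,
    -- a).
    + (t ^ 2 / 2) • (Γ y₀ (Γ y₀ a a) b + Γ y₀ a (Γ y₀ a b) - fderiv ℝ Γ y₀ a a b)

/-- `W` is a field along `geod`, parallel to second order. -/
def Parallel2 (W : ℝ → E) : Prop :=
  -- Z is the covariant derivative of W along the curve; it vanishes at 0 together with its first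
  -- derivative.
  ∃ Z : ℝ → E, (∀ᶠ t in 𝓝 (0 : ℝ), HasDerivAt W
    (Z t - Γ (geod Γ y₀ a t) (geodVel Γ y₀ a t) (W t)) t) ∧ Z 0 = 0 ∧ HasDerivAt Z 0 0

variable {Γ y₀ a}

@[simp] lemma geod_zero : geod Γ y₀ a 0 = y₀ := by simp [geod]
@[simp] lemma geodVel_zero : geodVel Γ y₀ a 0 = a := by simp [geodVel]
@[simp] lemma parField_zero (b : E) : parField Γ y₀ a b 0 = b := by simp [parField]

lemma hasDerivAt_sq_half_smul (v : E) (t : ℝ) :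
    HasDerivAt (fun s : ℝ ↦ (s ^ 2 / 2) • v) (t • v) t := by
  have : HasDerivAt (fun s : ℝ ↦ s ^ 2 / 2) t t := by
    have := (hasDerivAt_pow 2 t).div_const 2
    simpa using this
  exact this.smul_const v

lemma hasDerivAt_geod (t : ℝ) : HasDerivAt (geod Γ y₀ a) (geodVel Γ y₀ a t) t := by
  have h1 : HasDerivAt (fun s : ℝ ↦ s • a) ((1 : ℝ) • a) t := (hasDerivAt_id t).smul_const a
  exact ((h1.const_add y₀).sub (hasDerivAt_sq_half_smul (Γ y₀ a a) t)).congr_deriv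
    (by simp [geodVel])

lemma hasDerivAt_geodVel (t : ℝ) : HasDerivAt (geodVel Γ y₀ a) (- Γ y₀ a a) t := by
  have h1 : HasDerivAt (fun s : ℝ ↦ s • Γ y₀ a a) ((1 : ℝ) • Γ y₀ a a) t :=
    (hasDerivAt_id t).smul_const _
  exact (h1.const_sub a).congr_deriv (by simp)

lemma continuousAt_geod : ContinuousAt (geod Γ y₀ a) 0 := (hasDerivAt_geod 0).continuousAt

lemma eventually_geod {p : E → Prop} (h : ∀ᶠ y in 𝓝 y₀, p y) :
    ∀ᶠ t in 𝓝 (0 : ℝ), p (geod Γ y₀ a t) :=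
  continuousAt_geod.tendsto.eventually (by simpa using h)

lemma parallel2_parField (hΓ : DifferentiableAt ℝ Γ y₀) (b : E) :
    Parallel2 Γ y₀ a (parField Γ y₀ a b) := by
  set q := Γ y₀ (Γ y₀ a a) b + Γ y₀ a (Γ y₀ a b) - fderiv ℝ Γ y₀ a a b with hq
  have hd : ∀ t, HasDerivAt (parField Γ y₀ a b) (- Γ y₀ a b + t • q) t := by
    intro t
    have h1 : HasDerivAt (fun s : ℝ ↦ s • Γ y₀ a b) ((1 : ℝ) • Γ y₀ a b) t :=
      (hasDerivAt_id t).smul_const _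
    exact ((h1.const_sub b).add (hasDerivAt_sq_half_smul q t)).congr_deriv (by simp)
  refine ⟨fun t ↦ - Γ y₀ a b + t • q
    + Γ (geod Γ y₀ a t) (geodVel Γ y₀ a t) (parField Γ y₀ a b t), ?_, by simp, ?_⟩
  · exact .of_forall fun t ↦ (hd t).congr_deriv (by simp)
  · have h1 : HasDerivAt (fun s : ℝ ↦ - Γ y₀ a b + s • q) q 0 := by
      have : HasDerivAt (fun s : ℝ ↦ s • q) ((1 : ℝ) • q) 0 := (hasDerivAt_id _).smul_const _
      exact (this.const_add _).congr_deriv (by simp)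
    have hΓ' : HasFDerivAt Γ (fderiv ℝ Γ y₀) (geod Γ y₀ a 0) := by simpa using hΓ.hasFDerivAt
    have h2 := ((hΓ'.comp_hasDerivAt 0 (hasDerivAt_geod 0)).clm_apply
      (hasDerivAt_geodVel (Γ := Γ) (y₀ := y₀) (a := a) 0)).clm_apply (hd 0)
    refine (h1.add h2).congr_deriv ?_
    simp [hq]
    abel

lemma Parallel2.hasDerivAt {W : ℝ → E} (hW : Parallel2 Γ y₀ a W) :
    HasDerivAt W (- Γ y₀ a (W 0)) 0 := by
  obtain ⟨Z, h, h0, -⟩ := hW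
  simpa [h0] using h.self_of_nhds

/-- Applying a parallel endomorphism preserves parallel fields. -/
lemma Parallel2.endo {J : E → E →L[ℝ] E} {W : ℝ → E} (hW : Parallel2 Γ y₀ a W)
    (hJ : ∀ᶠ y in 𝓝 y₀, DifferentiableAt ℝ J y)
    (hpar : ∀ᶠ y in 𝓝 y₀, ∀ a b, fderiv ℝ J y a b = J y (Γ y a b) - Γ y a (J y b)) :
    Parallel2 Γ y₀ a (fun t ↦ J (geod Γ y₀ a t) (W t)) := by
  obtain ⟨Z, h, h0, h1⟩ := hW
  refine ⟨fun t ↦ J (geod Γ y₀ a t) (Z t), ?_, by simp [h0], ?_⟩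
  · filter_upwards [h, eventually_geod (a := a) (Γ := Γ) hJ, eventually_geod (a := a) (Γ := Γ) hpar]
      with t ht hJt hpt
    exact hasDerivAt_endo hJt (hpt _) (hasDerivAt_geod t) ht
  · have hJ0 : HasFDerivAt J (fderiv ℝ J y₀) (geod Γ y₀ a 0) := by
      simpa using hJ.self_of_nhds.hasFDerivAt
    exact ((hJ0.comp_hasDerivAt 0 (hasDerivAt_geod 0)).clm_apply h1).congr_deriv (by simp [h0])

/-- The acceleration -Γ(a, a) of the curve is what turns the second derivative of f into the
Hessian. -/
lemma jet2_scalar {f : E → ℝ} (hf : ContDiffAt ℝ 2 f y₀) :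
    Jet2 (fun t ↦ f (geod Γ y₀ a t)) (fderiv ℝ f y₀ a) (nab1 Γ (fderiv ℝ f) y₀ a a) := by
  have hd : ∀ᶠ y in 𝓝 y₀, DifferentiableAt ℝ f y :=
    (hf.eventually (by simp)).mono fun y hy ↦ hy.differentiableAt (by simp)
  have hd2 : DifferentiableAt ℝ (fderiv ℝ f) y₀ :=
    (hf.fderiv_right (m := 1) (by norm_num)).differentiableAt (by simp)
  refine ⟨fun t ↦ fderiv ℝ f (geod Γ y₀ a t) (geodVel Γ y₀ a t), ?_, by simp, ?_⟩
  · filter_upwards [eventually_geod (a := a) (Γ := Γ) hd] with t ht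
    exact ht.hasFDerivAt.comp_hasDerivAt t (hasDerivAt_geod t)
  · have := hasDerivAt_form1 (Γ := Γ) (x := geod Γ y₀ a) (w := 0) (W := geodVel Γ y₀ a) (t := 0)
      (θ := fderiv ℝ f) (by simpa using hd2) (hasDerivAt_geod 0)
      (by simpa using hasDerivAt_geodVel (Γ := Γ) (y₀ := y₀) (a := a) 0)
    simpa using this

/-- The covariant derivative of W vanishes to first order at 0, so all differentiation falls on θ.
-/
lemma jet2_form1 {θ : E → E →L[ℝ] ℝ} (hθ : ContDiffAt ℝ 2 θ y₀) (hΓ : ContDiffAt ℝ 1 Γ y₀)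
    {W : ℝ → E} (hW : Parallel2 Γ y₀ a W) :
    Jet2 (fun t ↦ θ (geod Γ y₀ a t) (W t)) (nab1 Γ θ y₀ a (W 0))
      (nab2 Γ (nab1 Γ θ) y₀ a a (W 0)) := by
  have hd : ∀ᶠ y in 𝓝 y₀, DifferentiableAt ℝ θ y :=
    (hθ.eventually (by simp)).mono fun y hy ↦ hy.differentiableAt (by simp)
  have hd1 : DifferentiableAt ℝ θ y₀ := hd.self_of_nhds
  have hd2 : DifferentiableAt ℝ (nab1 Γ θ) y₀ :=
    (contDiffAt_nab1 (m := 1) (by norm_num) hΓ hθ).differentiableAt (by simp)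
  have hW0 := hW.hasDerivAt
  obtain ⟨Z, h, h0, h1⟩ := hW
  refine ⟨fun t ↦ nab1 Γ θ (geod Γ y₀ a t) (geodVel Γ y₀ a t) (W t) + θ (geod Γ y₀ a t) (Z t),
    ?_, by simp [h0], ?_⟩
  · filter_upwards [h, eventually_geod (a := a) (Γ := Γ) hd] with t ht hθt
    exact hasDerivAt_form1 hθt (hasDerivAt_geod t) ht
  · have A := hasDerivAt_form2 (Γ := Γ) (x := geod Γ y₀ a) (w₁ := 0) (W₁ := geodVel Γ y₀ a)
      (w₂ := 0) (W₂ := W) (t := 0) (B := nab1 Γ θ) (by simpa using hd2) (hasDerivAt_geod 0)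
      (by simpa using hasDerivAt_geodVel (Γ := Γ) (y₀ := y₀) (a := a) 0) (by simpa using hW0)
    have B := hasDerivAt_form1 (Γ := Γ) (x := geod Γ y₀ a) (w := 0) (W := Z) (t := 0)
      (θ := θ) (by simpa using hd1) (hasDerivAt_geod 0) (by simpa [h0] using h1)
    exact (A.add B).congr_deriv (by simp [h0])

lemma jet2_form2 {B : E → E →L[ℝ] E →L[ℝ] ℝ} (hB : ContDiffAt ℝ 2 B y₀)
    (hΓ : ContDiffAt ℝ 1 Γ y₀) {W₁ W₂ : ℝ → E} (hW₁ : Parallel2 Γ y₀ a W₁)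
    (hW₂ : Parallel2 Γ y₀ a W₂) :
    Jet2 (fun t ↦ B (geod Γ y₀ a t) (W₁ t) (W₂ t)) (nab2 Γ B y₀ a (W₁ 0) (W₂ 0))
      (nab3 Γ (nab2 Γ B) y₀ a a (W₁ 0) (W₂ 0)) := by
  have hd : ∀ᶠ y in 𝓝 y₀, DifferentiableAt ℝ B y :=
    (hB.eventually (by simp)).mono fun y hy ↦ hy.differentiableAt (by simp)
  have hd1 : DifferentiableAt ℝ B y₀ := hd.self_of_nhds
  have hd2 : DifferentiableAt ℝ (nab2 Γ B) y₀ :=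
    (contDiffAt_nab2 (m := 1) (by norm_num) hΓ hB).differentiableAt (by simp)
  have hW₁0 := hW₁.hasDerivAt
  have hW₂0 := hW₂.hasDerivAt
  obtain ⟨Z₁, h₁, h₁0, h₁1⟩ := hW₁
  obtain ⟨Z₂, h₂, h₂0, h₂1⟩ := hW₂
  refine ⟨fun t ↦ nab2 Γ B (geod Γ y₀ a t) (geodVel Γ y₀ a t) (W₁ t) (W₂ t)
    + B (geod Γ y₀ a t) (Z₁ t) (W₂ t) + B (geod Γ y₀ a t) (W₁ t) (Z₂ t),
    ?_, by simp [h₁0, h₂0], ?_⟩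
  · filter_upwards [h₁, h₂, eventually_geod (a := a) (Γ := Γ) hd] with t ht₁ ht₂ hBt
    exact hasDerivAt_form2 hBt (hasDerivAt_geod t) ht₁ ht₂
  · have A := hasDerivAt_form3 (Γ := Γ) (x := geod Γ y₀ a) (w₁ := 0) (W₁ := geodVel Γ y₀ a)
      (w₂ := 0) (W₂ := W₁) (w₃ := 0) (W₃ := W₂) (t := 0) (B := nab2 Γ B) (by simpa using hd2)
      (hasDerivAt_geod 0) (by simpa using hasDerivAt_geodVel (Γ := Γ) (y₀ := y₀) (a := a) 0)
      (by simpa using hW₁0) (by simpa using hW₂0)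
    have B₁ := hasDerivAt_form2 (Γ := Γ) (x := geod Γ y₀ a) (w₁ := 0) (W₁ := Z₁) (w₂ := 0)
      (W₂ := W₂) (t := 0) (B := B) (by simpa using hd1) (hasDerivAt_geod 0)
      (by simpa [h₁0] using h₁1) (by simpa using hW₂0)
    have B₂ := hasDerivAt_form2 (Γ := Γ) (x := geod Γ y₀ a) (w₁ := 0) (W₁ := W₁) (w₂ := 0)
      (W₂ := Z₂) (t := 0) (B := B) (by simpa using hd1) (hasDerivAt_geod 0)
      (by simpa using hW₁0) (by simpa [h₂0] using h₂1)
    exact ((A.add B₁).add B₂).congr_deriv (by simp [h₁0, h₂0])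

end

end Chart

namespace Chart

noncomputable section

variable {E : Type*} [NormedAddCommGroup E] [NormedSpace ℝ E]
  {Γ : E → E →L[ℝ] E →L[ℝ] E} {J : E → E →L[ℝ] E} {u : E → ℝ} {y : E}

/-! ### First covariant derivatives along a curve -/

/-- The field `W` along `geod Γ y a` has the covariant derivative `w` at `0`. -/
def CovDerivAt (Γ : E → E →L[ℝ] E →L[ℝ] E) (y a : E) (W : ℝ → E) (w : E) : Prop :=
  HasDerivAt W (w - Γ y a (W 0)) 0

lemma Parallel2.covDerivAt {a : E} {W : ℝ → E} (hW : Parallel2 Γ y a W) :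
    CovDerivAt Γ y a W 0 := by
  simpa [CovDerivAt] using hW.hasDerivAt

lemma covDerivAt_parField (hΓ : DifferentiableAt ℝ Γ y) (a b : E) :
    CovDerivAt Γ y a (parField Γ y a b) 0 := (parallel2_parField hΓ b).covDerivAt

namespace CovDerivAt

variable {a : E} {W W₁ W₂ W₃ : ℝ → E} {w w' w₁ w₂ w₃ : E}

lemma unique (h : CovDerivAt Γ y a W w) (h' : CovDerivAt Γ y a W w') : w = w' := by
  simpa using HasDerivAt.unique h h'

lemma congr (h : CovDerivAt Γ y a W w) (hW : W₁ =ᶠ[𝓝 0] W) : CovDerivAt Γ y a W₁ w := by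
  unfold CovDerivAt at *
  rw [hW.self_of_nhds]
  exact h.congr_of_eventuallyEq hW

lemma add (h₁ : CovDerivAt Γ y a W₁ w₁) (h₂ : CovDerivAt Γ y a W₂ w₂) :
    CovDerivAt Γ y a (fun t ↦ W₁ t + W₂ t) (w₁ + w₂) :=
  (HasDerivAt.add h₁ h₂).congr_deriv (by simp only [map_add]; abel)

lemma neg (h₁ : CovDerivAt Γ y a W₁ w₁) : CovDerivAt Γ y a (fun t ↦ - W₁ t) (-w₁) :=
  (HasDerivAt.neg h₁).congr_deriv (by simp only [map_neg]; abel)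

lemma sub (h₁ : CovDerivAt Γ y a W₁ w₁) (h₂ : CovDerivAt Γ y a W₂ w₂) :
    CovDerivAt Γ y a (fun t ↦ W₁ t - W₂ t) (w₁ - w₂) :=
  (HasDerivAt.sub h₁ h₂).congr_deriv (by simp only [map_sub]; abel)

lemma form1 (h : CovDerivAt Γ y a W w) {θ : E → E →L[ℝ] ℝ} (hθ : DifferentiableAt ℝ θ y) :
    HasDerivAt (fun t ↦ θ (geod Γ y a t) (W t)) (nab1 Γ θ y a (W 0) + θ y w) 0 := by
  have := hasDerivAt_form1 (Γ := Γ) (x := geod Γ y a) (w := w) (W := W) (t := 0)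
    (θ := θ) (by simpa using hθ) (hasDerivAt_geod 0) (by simpa [CovDerivAt] using h)
  simpa using this

lemma form2 (h₁ : CovDerivAt Γ y a W₁ w₁) (h₂ : CovDerivAt Γ y a W₂ w₂)
    {B : E → E →L[ℝ] E →L[ℝ] ℝ} (hB : DifferentiableAt ℝ B y) :
    HasDerivAt (fun t ↦ B (geod Γ y a t) (W₁ t) (W₂ t))
      (nab2 Γ B y a (W₁ 0) (W₂ 0) + B y w₁ (W₂ 0) + B y (W₁ 0) w₂) 0 := by
  have := hasDerivAt_form2 (Γ := Γ) (x := geod Γ y a) (w₁ := w₁) (W₁ := W₁) (w₂ := w₂) (W₂ := W₂)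
    (t := 0) (B := B) (by simpa using hB) (hasDerivAt_geod 0) (by simpa [CovDerivAt] using h₁)
    (by simpa [CovDerivAt] using h₂)
  simpa using this

lemma form3 (h₁ : CovDerivAt Γ y a W₁ w₁) (h₂ : CovDerivAt Γ y a W₂ w₂)
    (h₃ : CovDerivAt Γ y a W₃ w₃)
    {B : E → E →L[ℝ] E →L[ℝ] E →L[ℝ] ℝ} (hB : DifferentiableAt ℝ B y) :
    HasDerivAt (fun t ↦ B (geod Γ y a t) (W₁ t) (W₂ t) (W₃ t))
      (nab3 Γ B y a (W₁ 0) (W₂ 0) (W₃ 0) + B y w₁ (W₂ 0) (W₃ 0) + B y (W₁ 0) w₂ (W₃ 0)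
        + B y (W₁ 0) (W₂ 0) w₃) 0 := by
  have := hasDerivAt_form3 (Γ := Γ) (x := geod Γ y a) (w₁ := w₁) (W₁ := W₁) (w₂ := w₂) (W₂ := W₂)
    (w₃ := w₃) (W₃ := W₃) (t := 0) (B := B) (by simpa using hB) (hasDerivAt_geod 0)
    (by simpa [CovDerivAt] using h₁) (by simpa [CovDerivAt] using h₂) (by simpa [CovDerivAt] using h₃)
  simpa using this

lemma tor (h₁ : CovDerivAt Γ y a W₁ 0) (h₂ : CovDerivAt Γ y a W₂ 0) (hΓ : ContDiffAt ℝ 1 Γ y) :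
    CovDerivAt Γ y a (fun t ↦ tor Γ (geod Γ y a t) (W₁ t) (W₂ t))
      (nabTor Γ y a (W₁ 0) (W₂ 0)) := by
  have := hasDerivAt_tor (Γ := Γ) (x := geod Γ y a) (W₁ := W₁) (W₂ := W₂) (t := 0)
    (by simpa using (contDiffAt_tor hΓ).differentiableAt (by simp)) (hasDerivAt_geod 0)
    (by simpa [CovDerivAt] using h₁) (by simpa [CovDerivAt] using h₂)
  simpa [CovDerivAt] using this

lemma curv (h₁ : CovDerivAt Γ y a W₁ 0) (h₂ : CovDerivAt Γ y a W₂ 0) (h₃ : CovDerivAt Γ y a W₃ 0)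
    (hΓ : ContDiffAt ℝ 2 Γ y) :
    CovDerivAt Γ y a (fun t ↦ curv Γ (geod Γ y a t) (W₁ t) (W₂ t) (W₃ t))
      (nabCurv Γ y a (W₁ 0) (W₂ 0) (W₃ 0)) := by
  have := hasDerivAt_curv (Γ := Γ) (x := geod Γ y a) (W₁ := W₁) (W₂ := W₂) (W₃ := W₃) (t := 0)
    (by simpa using (contDiffAt_curv (m := 1) (by norm_num) hΓ).differentiableAt (by simp))
    (hasDerivAt_geod 0) (by simpa [CovDerivAt] using h₁) (by simpa [CovDerivAt] using h₂)
    (by simpa [CovDerivAt] using h₃)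
  simpa [CovDerivAt] using this

lemma endo (h : CovDerivAt Γ y a W w) (hJ : DifferentiableAt ℝ J y)
    (hpar : ∀ a b, fderiv ℝ J y a b = J y (Γ y a b) - Γ y a (J y b)) :
    CovDerivAt Γ y a (fun t ↦ J (geod Γ y a t) (W t)) (J y w) := by
  have := hasDerivAt_endo (Γ := Γ) (J := J) (x := geod Γ y a) (t := 0) (w := w)
    (by simpa using hJ) (by simpa using hpar a) (hasDerivAt_geod 0) (by simpa [CovDerivAt] using h)
  simpa [CovDerivAt] using this

end CovDerivAt

lemma tor_antisymm (y a b : E) : tor Γ y a b = - tor Γ y b a := by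
  simp [tor_apply]

/-- Pointwise identities for T pass to ∇T: the identity is differentiated along `geod` on parallel
fields, and covariant derivatives are unique. -/
lemma nabTor_antisymm (hΓ : ContDiffAt ℝ 1 Γ y) (a b c : E) :
    nabTor Γ y a b c = - nabTor Γ y a c b := by
  have hΓ' : DifferentiableAt ℝ Γ y := hΓ.differentiableAt (by simp)
  have hb := covDerivAt_parField hΓ' a b
  have hc := covDerivAt_parField hΓ' a c
  simpa using (hb.tor hc hΓ).unique
    ((hc.tor hb hΓ).neg.congr (.of_forall fun t ↦ tor_antisymm _ _ _))

lemma nabTor_endo (hΓ : ContDiffAt ℝ 1 Γ y) (hJ : DifferentiableAt ℝ J y)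
    (hpar : ∀ a b, fderiv ℝ J y a b = J y (Γ y a b) - Γ y a (J y b))
    (hT : ∀ᶠ y in 𝓝 y, ∀ a b, tor Γ y (J y a) b = J y (tor Γ y a b)) (a b c : E) :
    nabTor Γ y a (J y b) c = J y (nabTor Γ y a b c) := by
  have hΓ' : DifferentiableAt ℝ Γ y := hΓ.differentiableAt (by simp)
  have hb := covDerivAt_parField hΓ' a b
  have hc := covDerivAt_parField hΓ' a c
  have hJb : CovDerivAt Γ y a (fun t ↦ J (geod Γ y a t) (parField Γ y a b t)) 0 := by
    simpa using hb.endo hJ hpar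
  simpa using (hJb.tor hc hΓ).unique (((hb.tor hc hΓ).endo hJ hpar).congr
    ((eventually_geod (a := a) (Γ := Γ) hT).mono fun t ht ↦ ht _ _))

/-- Third covariant derivatives commute in the last two arguments up to torsion. -/
lemma nab2_hess_comm (hu : ContDiffAt ℝ 3 u y) (hΓ : ContDiffAt ℝ 1 Γ y) (a b c : E) :
    nab2 Γ (nab1 Γ (fderiv ℝ u)) y a b c - nab2 Γ (nab1 Γ (fderiv ℝ u)) y a c b
      = - nab1 Γ (fderiv ℝ u) y a (tor Γ y b c) - fderiv ℝ u y (nabTor Γ y a b c) := by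
  have hΓ' : DifferentiableAt ℝ Γ y := hΓ.differentiableAt (by simp)
  have hu1 : ContDiffAt ℝ 2 (fderiv ℝ u) y := hu.fderiv_right (by norm_num)
  have hu2 : ContDiffAt ℝ 1 (nab1 Γ (fderiv ℝ u)) y := contDiffAt_nab1 (by norm_num) hΓ hu1
  have hu1' := hu1.differentiableAt (by simp)
  have hu2' := hu2.differentiableAt (by simp)
  have hb := covDerivAt_parField hΓ' a b
  have hc := covDerivAt_parField hΓ' a c
  have h1 := (hb.form2 hc hu2').sub (hc.form2 hb hu2')
  have h2 := ((hb.tor hc hΓ).form1 hu1').neg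
  have h3 := h1.unique (h2.congr_of_eventuallyEq ?_)
  · simp only [parField_zero, geod_zero, map_zero, zero_apply] at h3
    linarith
  · have : ∀ᶠ y in 𝓝 y, ContDiffAt ℝ 2 u y :=
      (hu.of_le (by norm_num : (2 : ℕ∞ω) ≤ 3)).eventually (by simp)
    filter_upwards [eventually_geod (a := a) (Γ := Γ) this] with t ht
    exact nab1_fderiv_comm ht _ _

/-- This is the covariant derivative in the direction `a` of the Ricci identity `nab2_nab1_comm` for
θ = du, with b, c, d extended as parallel fields. -/
lemma nab3_hess_comm (hu : ContDiffAt ℝ 4 u y) (hΓ : ContDiffAt ℝ 2 Γ y) (a b c d : E) :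
    nab3 Γ (nab2 Γ (nab1 Γ (fderiv ℝ u))) y a b c d
      - nab3 Γ (nab2 Γ (nab1 Γ (fderiv ℝ u))) y a c b d
      = - nab2 Γ (nab1 Γ (fderiv ℝ u)) y a (tor Γ y b c) d
        - nab1 Γ (fderiv ℝ u) y (nabTor Γ y a b c) d
        - nab1 Γ (fderiv ℝ u) y a (curv Γ y b c d)
        - fderiv ℝ u y (nabCurv Γ y a b c d) := by
  have hΓ1 : ContDiffAt ℝ 1 Γ y := hΓ.of_le (by norm_num)
  have hΓ' : DifferentiableAt ℝ Γ y := hΓ.differentiableAt (by simp)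
  have hu1 : ContDiffAt ℝ 3 (fderiv ℝ u) y := hu.fderiv_right (by norm_num)
  have hu2 : ContDiffAt ℝ 2 (nab1 Γ (fderiv ℝ u)) y := contDiffAt_nab1 (by norm_num) hΓ hu1
  have hu3 : ContDiffAt ℝ 1 (nab2 Γ (nab1 Γ (fderiv ℝ u))) y :=
    contDiffAt_nab2 (by norm_num) hΓ1 hu2
  have hu1' := hu1.differentiableAt (by simp)
  have hu2' := hu2.differentiableAt (by simp)
  have hu3' := hu3.differentiableAt (by simp)
  have hb := covDerivAt_parField hΓ' a b
  have hc := covDerivAt_parField hΓ' a c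
  have hd := covDerivAt_parField hΓ' a d
  have h1 := (hb.form3 hc hd hu3').sub (hc.form3 hb hd hu3')
  have h2 := ((hb.tor hc hΓ1).form2 hd hu2').neg.sub ((hb.curv hc hd hΓ).form1 hu1')
  have h3 := h1.unique (h2.congr_of_eventuallyEq ?_)
  · simp only [parField_zero, geod_zero, map_zero, zero_apply] at h3
    linarith
  · have A : ∀ᶠ y in 𝓝 y, ContDiffAt ℝ 2 (fderiv ℝ u) y :=
      (hu1.of_le (by norm_num : (2 : ℕ∞ω) ≤ 3)).eventually (by simp)
    have B : ∀ᶠ y in 𝓝 y, DifferentiableAt ℝ Γ y :=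
      (hΓ.eventually (by simp)).mono fun y hy ↦ hy.differentiableAt (by simp)
    filter_upwards [eventually_geod (a := a) (Γ := Γ) A, eventually_geod (a := a) (Γ := Γ) B]
      with t ht ht'
    exact nab2_nab1_comm ht ht' _ _ _

end

end Chart

namespace Chart

noncomputable section

variable {E : Type*} [NormedAddCommGroup E] [NormedSpace ℝ E]
  {Γ : E → E →L[ℝ] E →L[ℝ] E} {J : E → E →L[ℝ] E} {u : E → ℝ} {y : E}

/-! ### Commuting derivatives with the Hermitian trace -/

/-- Near `y`, the connection `Γ` is smooth, `J` is a parallel almost complex structure, and the torsion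
of `Γ` is complex bilinear. -/
structure IsChernAt (Γ : E → E →L[ℝ] E →L[ℝ] E) (J : E → E →L[ℝ] E) (y : E) : Prop where
  smooth : ContDiffAt ℝ 3 Γ y
  diff : ∀ᶠ z in 𝓝 y, DifferentiableAt ℝ J z
  parallel : ∀ᶠ z in 𝓝 y, ∀ a b, fderiv ℝ J z a b = J z (Γ z a b) - Γ z a (J z b)
  sq : ∀ᶠ z in 𝓝 y, ∀ a, J z (J z a) = -a
  torsion : ∀ᶠ z in 𝓝 y, ∀ a b, tor Γ z (J z a) b = J z (tor Γ z a b)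

namespace IsChernAt

lemma eventually (h : IsChernAt Γ J y) : ∀ᶠ z in 𝓝 y, IsChernAt Γ J z := by
  filter_upwards [h.smooth.eventually (by simp), h.diff.eventually_nhds,
    h.parallel.eventually_nhds, h.sq.eventually_nhds, h.torsion.eventually_nhds]
    with z h1 h2 h3 h4 h5 using ⟨h1, h2, h3, h4, h5⟩

lemma tor_endo_left (h : IsChernAt Γ J y) (a b : E) : tor Γ y (J y a) b = J y (tor Γ y a b) :=
  h.torsion.self_of_nhds a b

lemma tor_endo_right (h : IsChernAt Γ J y) (a b : E) : tor Γ y a (J y b) = J y (tor Γ y a b) := by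
  rw [tor_antisymm, h.tor_endo_left, tor_antisymm y a b, map_neg]

lemma tor_self (a : E) : tor Γ y a a = 0 := by simp [tor_apply]

lemma nabTor_endo_left (h : IsChernAt Γ J y) (a b c : E) :
    nabTor Γ y a (J y b) c = J y (nabTor Γ y a b c) :=
  nabTor_endo (h.smooth.of_le (by norm_num)) h.diff.self_of_nhds h.parallel.self_of_nhds h.torsion
    a b c

lemma nabTor_swap (h : IsChernAt Γ J y) (a b c : E) :
    nabTor Γ y a b c = - nabTor Γ y a c b :=
  nabTor_antisymm (h.smooth.of_le (by norm_num)) a b c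

lemma nabTor_endo_right (h : IsChernAt Γ J y) (a b c : E) :
    nabTor Γ y a b (J y c) = J y (nabTor Γ y a b c) := by
  rw [h.nabTor_swap, h.nabTor_endo_left, h.nabTor_swap a b c, map_neg]

lemma nabTor_self (h : IsChernAt Γ J y) (a b : E) : nabTor Γ y a b b = 0 := by
  have h2 : (2 : ℝ) • nabTor Γ y a b b = 0 := by
    rw [two_smul]; exact add_eq_zero_iff_eq_neg.2 (h.nabTor_swap a b b)
  simpa using h2

end IsChernAt

/-- The curvature term in the commutation of the Hermitian trace with a derivative. -/
def curvTrace (Γ : E → E →L[ℝ] E →L[ℝ] E) (J : E → E →L[ℝ] E) (y e τ : E) : E :=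
  curv Γ y e τ e + curv Γ y e (J y τ) (J y e) + curv Γ y (J y e) τ (J y e)
    - curv Γ y (J y e) (J y τ) e - curv Γ y e (J y e) (J y τ)

/-- The covariant derivative of `curvTrace`. -/
def nabCurvTrace (Γ : E → E →L[ℝ] E →L[ℝ] E) (J : E → E →L[ℝ] E) (y a e τ : E) : E :=
  nabCurv Γ y a e τ e + nabCurv Γ y a e (J y τ) (J y e) + nabCurv Γ y a (J y e) τ (J y e)
    - nabCurv Γ y a (J y e) (J y τ) e - nabCurv Γ y a e (J y e) (J y τ)

/-- Complex bilinearity gives T(e, Je) = J T(e, e) = 0 and makes the torsion terms pair up as ∇²u(T,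
e) + ∇²u(JT, Je), which is of mixed type. The exchanges also pass through third derivatives in Jτ;
they are chosen so that all terms in ∇T cancel and only curvature remains. -/
lemma trace_nab2_hess (h : IsChernAt Γ J y) (hu : ContDiffAt ℝ 3 u y) (e τ : E) :
    nab2 Γ (nab1 Γ (fderiv ℝ u)) y e e τ + nab2 Γ (nab1 Γ (fderiv ℝ u)) y (J y e) (J y e) τ
      = nab2 Γ (nab1 Γ (fderiv ℝ u)) y τ e e + nab2 Γ (nab1 Γ (fderiv ℝ u)) y τ (J y e) (J y e)
        - 2 * (nab1 Γ (fderiv ℝ u) y (tor Γ y e τ) e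
          + nab1 Γ (fderiv ℝ u) y (J y (tor Γ y e τ)) (J y e))
        - fderiv ℝ u y (curvTrace Γ J y e τ) := by
  have hΓ1 : ContDiffAt ℝ 1 Γ y := h.smooth.of_le (by norm_num)
  have hΓ' : DifferentiableAt ℝ Γ y := hΓ1.differentiableAt (by simp)
  have hu1 : ContDiffAt ℝ 2 (fderiv ℝ u) y := hu.fderiv_right (by norm_num)
  have I3b := nab2_hess_comm (Γ := Γ) hu hΓ1
  have I3a := nab2_nab1_comm (Γ := Γ) hu1 hΓ'
  have J2 := h.sq.self_of_nhds
  have e1 := I3a e (J y e) (J y τ)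
  have e2 := I3b e e τ
  have e3 := I3b e (J y e) (J y τ)
  have e4 := I3b (J y e) (J y e) τ
  have e5 := I3b (J y e) e (J y τ)
  have e6 := I3a e τ e
  have e7 := I3a e (J y τ) (J y e)
  have e8 := I3a (J y e) τ (J y e)
  have e9 := I3a (J y e) (J y τ) e
  have e10 := I3b (J y τ) e (J y e)
  simp only [h.tor_endo_left, h.tor_endo_right, h.nabTor_endo_left, h.nabTor_endo_right, J2,
    IsChernAt.tor_self, h.nabTor_self, map_zero, zero_apply, map_neg, neg_apply]
    at e1 e2 e3 e4 e5 e6 e7 e8 e9 e10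
  simp only [curvTrace, map_add, map_sub]
  linear_combination -e1 + e2 + e3 + e4 - e5 + e6 + e7 + e8 - e9 + e10

/-- This is the covariant derivative of `trace_nab2_hess` in the direction `a`. With e and τ
extended as parallel fields and J parallel, only u, T and R are differentiated. -/
lemma trace_nab3_hess (h : IsChernAt Γ J y) (hu : ContDiffAt ℝ 4 u y) (a e τ : E) :
    nab3 Γ (nab2 Γ (nab1 Γ (fderiv ℝ u))) y a e e τ
      + nab3 Γ (nab2 Γ (nab1 Γ (fderiv ℝ u))) y a (J y e) (J y e) τ
      = nab3 Γ (nab2 Γ (nab1 Γ (fderiv ℝ u))) y a τ e e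
        + nab3 Γ (nab2 Γ (nab1 Γ (fderiv ℝ u))) y a τ (J y e) (J y e)
        - 2 * (nab2 Γ (nab1 Γ (fderiv ℝ u)) y a (tor Γ y e τ) e
          + nab2 Γ (nab1 Γ (fderiv ℝ u)) y a (J y (tor Γ y e τ)) (J y e)
          + nab1 Γ (fderiv ℝ u) y (nabTor Γ y a e τ) e
          + nab1 Γ (fderiv ℝ u) y (J y (nabTor Γ y a e τ)) (J y e))
        - nab1 Γ (fderiv ℝ u) y a (curvTrace Γ J y e τ)
        - fderiv ℝ u y (nabCurvTrace Γ J y a e τ) := by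
  have hΓ2 : ContDiffAt ℝ 2 Γ y := h.smooth.of_le (by norm_num)
  have hΓ1 : ContDiffAt ℝ 1 Γ y := hΓ2.of_le (by norm_num)
  have hΓ' : DifferentiableAt ℝ Γ y := hΓ1.differentiableAt (by simp)
  have hu1 : ContDiffAt ℝ 3 (fderiv ℝ u) y := hu.fderiv_right (by norm_num)
  have hu2 : ContDiffAt ℝ 2 (nab1 Γ (fderiv ℝ u)) y := contDiffAt_nab1 (by norm_num) hΓ2 hu1
  have hu3 : ContDiffAt ℝ 1 (nab2 Γ (nab1 Γ (fderiv ℝ u))) y :=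
    contDiffAt_nab2 (by norm_num) hΓ1 hu2
  have hu1' := hu1.differentiableAt (by simp)
  have hu2' := hu2.differentiableAt (by simp)
  have hu3' := hu3.differentiableAt (by simp)
  have hJ := h.diff.self_of_nhds
  have hp := h.parallel.self_of_nhds
  have he := covDerivAt_parField hΓ' a e
  have hτ := covDerivAt_parField hΓ' a τ
  have hJe : CovDerivAt Γ y a (fun t ↦ J (geod Γ y a t) (parField Γ y a e t)) 0 := by
    simpa using he.endo hJ hp
  have hJτ : CovDerivAt Γ y a (fun t ↦ J (geod Γ y a t) (parField Γ y a τ t)) 0 := by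
    simpa using hτ.endo hJ hp
  have hT := he.tor hτ hΓ1
  have hc := (((((he.curv hτ he hΓ2).add (he.curv hJτ hJe hΓ2)).add (hJe.curv hτ hJe hΓ2)).sub
    (hJe.curv hJτ he hΓ2)).sub (he.curv hJe hJτ hΓ2))
  have h1 := (he.form3 he hτ hu3').add (hJe.form3 hJe hτ hu3')
  have h2 := ((((hτ.form3 he he hu3').add (hτ.form3 hJe hJe hu3')).sub
    (((hT.form2 he hu2').add ((hT.endo hJ hp).form2 hJe hu2')).const_mul 2)).sub
      (hc.form1 hu1'))
  have h3 := h1.unique (h2.congr_of_eventuallyEq ?_)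
  · simp only [parField_zero, geod_zero, map_zero, zero_apply] at h3
    simp only [curvTrace, nabCurvTrace]
    linear_combination h3
  · have A : ∀ᶠ y in 𝓝 y, ContDiffAt ℝ 3 u y :=
      (hu.of_le (by norm_num : (3 : ℕ∞ω) ≤ 4)).eventually (by simp)
    filter_upwards [eventually_geod (a := a) (Γ := Γ) A,
      eventually_geod (a := a) (Γ := Γ) h.eventually] with t ht ht'
    exact trace_nab2_hess ht' ht _ _

/-- The lower order terms of `trace_hess_comm`. -/
def traceError (Γ : E → E →L[ℝ] E →L[ℝ] E) (u : E → ℝ) (y e τ : E) : ℝ :=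
  nab1 Γ (fderiv ℝ u) y (nabTor Γ y e e τ) τ
    + 2 * nab1 Γ (fderiv ℝ u) y e (curv Γ y e τ τ)
    + fderiv ℝ u y (nabCurv Γ y e e τ τ)
    + nab1 Γ (fderiv ℝ u) y (curv Γ y e τ e) τ
    - nab1 Γ (fderiv ℝ u) y e (tor Γ y (tor Γ y e τ) τ)
    - fderiv ℝ u y (nabTor Γ y e (tor Γ y e τ) τ)
    - nab1 Γ (fderiv ℝ u) y (tor Γ y e τ) (tor Γ y e τ)
    - fderiv ℝ u y (curv Γ y e τ (tor Γ y e τ))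
    - nab1 Γ (fderiv ℝ u) y (tor Γ y e τ) (tor Γ y e τ)
    - fderiv ℝ u y (nabTor Γ y (tor Γ y e τ) e τ)
    - nab1 Γ (fderiv ℝ u) y (tor Γ y (tor Γ y e τ) τ) e
    - fderiv ℝ u y (curv Γ y (tor Γ y e τ) τ e)

/-- Commuting fourth covariant derivatives, traced over the complex line of `e`: up to terms of
second order, only third derivatives of mixed type enter. -/
lemma trace_hess_comm (h : IsChernAt Γ J y) (hu : ContDiffAt ℝ 4 u y) (e τ : E) :
    nab3 Γ (nab2 Γ (nab1 Γ (fderiv ℝ u))) y e e τ τ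
      + nab3 Γ (nab2 Γ (nab1 Γ (fderiv ℝ u))) y (J y e) (J y e) τ τ
      = nab3 Γ (nab2 Γ (nab1 Γ (fderiv ℝ u))) y τ τ e e
        + nab3 Γ (nab2 Γ (nab1 Γ (fderiv ℝ u))) y τ τ (J y e) (J y e)
        - 4 * (nab2 Γ (nab1 Γ (fderiv ℝ u)) y τ e (tor Γ y e τ)
          + nab2 Γ (nab1 Γ (fderiv ℝ u)) y τ (J y e) (J y (tor Γ y e τ)))
        - 2 * (nab1 Γ (fderiv ℝ u) y (nabTor Γ y τ e τ) e
          + nab1 Γ (fderiv ℝ u) y (J y (nabTor Γ y τ e τ)) (J y e))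
        - nab1 Γ (fderiv ℝ u) y τ (curvTrace Γ J y e τ)
        - fderiv ℝ u y (nabCurvTrace Γ J y τ e τ)
        - traceError Γ u y e τ - traceError Γ u y (J y e) τ := by
  have hΓ2 : ContDiffAt ℝ 2 Γ y := h.smooth.of_le (by norm_num)
  have hΓ1 : ContDiffAt ℝ 1 Γ y := hΓ2.of_le (by norm_num)
  have hΓ' : DifferentiableAt ℝ Γ y := hΓ1.differentiableAt (by simp)
  have hu1 : ContDiffAt ℝ 3 (fderiv ℝ u) y := hu.fderiv_right (by norm_num)
  have hu2 : ContDiffAt ℝ 2 (nab1 Γ (fderiv ℝ u)) y := contDiffAt_nab1 (by norm_num) hΓ2 hu1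
  have J2 := h.sq.self_of_nhds
  have I3a := nab2_nab1_comm (Γ := Γ) (hu1.of_le (by norm_num)) hΓ'
  have I3b := nab2_hess_comm (Γ := Γ) (hu.of_le (by norm_num)) hΓ1
  have I4a := nab3_nab2_comm (Γ := Γ) hu2 hΓ'
  have I4b := nab3_hess_comm (Γ := Γ) hu hΓ2
  -- The second and third arguments are exchanged, then the first and second. Each exchange leaves a
  -- third derivative containing T(e, τ); further exchanges bring τ to its front at the cost of
  -- lower order terms, which `traceError` collects.
  have key : ∀ e, nab3 Γ (nab2 Γ (nab1 Γ (fderiv ℝ u))) y e e τ τ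
      = nab3 Γ (nab2 Γ (nab1 Γ (fderiv ℝ u))) y τ e e τ
        - nab2 Γ (nab1 Γ (fderiv ℝ u)) y τ e (tor Γ y e τ)
        - nab2 Γ (nab1 Γ (fderiv ℝ u)) y τ (tor Γ y e τ) e - traceError Γ u y e τ := by
    intro e
    have e1 := I4b e e τ τ
    have e2 := I4a e τ e τ
    have e3 := I3b e (tor Γ y e τ) τ
    have e4 := I3a e τ (tor Γ y e τ)
    have e5 := I3b (tor Γ y e τ) e τ
    have e6 := I3a (tor Γ y e τ) τ e
    simp only [traceError]
    linear_combination e1 + e2 - e3 - e4 - e5 - e6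
  have k1 := key e
  have k2 := key (J y e)
  have s1 := I3b τ (tor Γ y e τ) e
  have s2 := I3b τ (J y (tor Γ y e τ)) (J y e)
  have tr := trace_nab3_hess h hu τ e τ
  simp only [h.tor_endo_left, h.tor_endo_right, h.nabTor_endo_left, h.nabTor_endo_right, J2,
    map_neg] at k2 s2
  -- Three copies of ∇³u(τ, T, e) have to be reordered, one from `key` and two from `tr`. Together
  -- with the copy of ∇³u(τ, e, T) in `key` they give the factor 4. The corrections from reordering
  -- cancel between e and Je.
  linear_combination k1 + k2 + tr - 3 * s1 - 3 * s2

end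

end Chart

/-! ### The second order jet of a determinant -/

section Det

variable {ι : Type*} [Fintype ι] [DecidableEq ι]

open Matrix

/-- Jacobi's formula: the columns are differentiated one at a time, and by Cramer's rule the
determinant with column i replaced by that of M' is a diagonal entry of adj(M) M'. -/
lemma hasDerivAt_det {M : ℝ → Matrix ι ι ℂ} {M' : Matrix ι ι ℂ} {t : ℝ}
    (h : ∀ i j, HasDerivAt (fun s ↦ M s i j) (M' i j) t) :
    HasDerivAt (fun s ↦ (M s).det) ((adjugate (M t) * M').trace) t := by
  have h1 : HasDerivAt (fun s ↦ ∑ σ : Equiv.Perm ι, (Equiv.Perm.sign σ : ℂ) * ∏ i, M s (σ i) i)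
      (∑ σ : Equiv.Perm ι, (Equiv.Perm.sign σ : ℂ) *
        ∑ i, (∏ j ∈ Finset.univ.erase i, M t (σ j) j) • M' (σ i) i) t :=
    HasDerivAt.fun_sum fun σ _ ↦
      (HasDerivAt.fun_finsetProd fun i _ ↦ h (σ i) i).const_mul _
  have h2 : (fun s ↦ (M s).det)
      = fun s ↦ ∑ σ : Equiv.Perm ι, (Equiv.Perm.sign σ : ℂ) * ∏ i, M s (σ i) i := by
    funext s; exact det_apply' _
  rw [h2]
  refine h1.congr_deriv ?_
  have h3 : ∀ i, (∑ j, adjugate (M t) i j * M' j i)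
      = ((M t).updateCol i (fun j ↦ M' j i)).det := by
    intro i
    have := cramer_eq_adjugate_mulVec (M t) (fun j ↦ M' j i)
    have := congrFun this i
    rw [cramer_apply] at this
    rw [this]; rfl
  simp only [trace, diag_apply, mul_apply, h3]
  simp only [Finset.mul_sum]
  rw [Finset.sum_comm]
  refine Finset.sum_congr rfl fun i _ ↦ ?_
  rw [det_apply']
  refine Finset.sum_congr rfl fun σ _ ↦ ?_
  rw [← Finset.mul_prod_erase _ _ (Finset.mem_univ i)]
  have : ∏ j ∈ Finset.univ.erase i, (M t).updateCol i (fun j ↦ M' j i) (σ j) j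
      = ∏ j ∈ Finset.univ.erase i, M t (σ j) j :=
    Finset.prod_congr rfl fun j hj ↦ by rw [updateCol_ne (Finset.ne_of_mem_erase hj)]
  rw [this, updateCol_self, smul_eq_mul]
  ring

/-- The entries of the adjugate are determinants with one row replaced by constants.
Differentiability is enough here; the value of the derivative is recovered in `jet2_det`. -/
lemma exists_hasDerivAt_adjugate {M : ℝ → Matrix ι ι ℂ} {M' : Matrix ι ι ℂ} {t : ℝ}
    (h : ∀ i j, HasDerivAt (fun s ↦ M s i j) (M' i j) t) (i j : ι) :
    ∃ a, HasDerivAt (fun s ↦ adjugate (M s) i j) a t := by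
  simp only [adjugate_apply]
  refine ⟨_, hasDerivAt_det (M' := M'.updateRow j 0) fun k l ↦ ?_⟩
  by_cases hk : k = j
  · subst hk
    simp only [updateRow_self]
    exact hasDerivAt_const _ _
  · simp only [updateRow_ne hk]
    exact h k l

/-- The second order jet of a determinant at a diagonal matrix. -/
lemma jet2_det {M : ℝ → Matrix ι ι ℂ} {M₁ M₂ : Matrix ι ι ℂ} {d : ι → ℂ} (hd : ∀ i, d i ≠ 0)
    (h0 : M 0 = diagonal d) (h : ∀ i j, Jet2 (fun t ↦ M t i j) (M₁ i j) (M₂ i j)) :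
    Jet2 (fun t ↦ (M t).det) ((∏ i, d i) * ∑ i, M₁ i i / d i)
      ((∏ i, d i) * ((∑ i, M₁ i i / d i) ^ 2 - (∑ i, ∑ j, M₁ i j * M₁ j i / (d i * d j))
        + ∑ i, M₂ i i / d i)) := by
  choose M' hM' hM'0 hM'2 using h
  have hev : ∀ᶠ t in 𝓝 (0 : ℝ), ∀ i j, HasDerivAt (fun s ↦ M s i j) (M' i j t) t := by
    simp only [eventually_all]; exact hM'
  have hd0 : (M 0).det = ∏ i, d i := by rw [h0, det_diagonal]
  have hadj0 : ∀ i j, adjugate (M 0) i j = if i = j then (∏ k, d k) / d i else 0 := by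
    intro i j
    have := congrFun (congrFun (mul_adjugate (M 0)) i) j
    rw [hd0, h0, diagonal_mul, Matrix.smul_apply, one_apply, smul_eq_mul] at this
    rw [h0]
    split_ifs at this ⊢ with hij
    · rw [eq_div_iff (hd i), mul_comm, this, mul_one]
    · simpa [hd i] using this
  have hM₁ : ∀ i j, HasDerivAt (fun s ↦ M s i j) (M₁ i j) 0 := fun i j ↦ by
    simpa [hM'0] using hev.self_of_nhds i j
  have tr0 : (adjugate (M 0) * M₁).trace = (∏ i, d i) * ∑ i, M₁ i i / d i := by
    simp only [trace, diag_apply, mul_apply, hadj0, ite_mul, zero_mul, Finset.sum_ite_eq,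
      Finset.mem_univ, if_true, Finset.mul_sum]
    exact Finset.sum_congr rfl fun i _ ↦ by ring
  have hdet := hasDerivAt_det hM₁
  rw [tr0] at hdet
  choose A hA using exists_hasDerivAt_adjugate hM₁
  -- Differentiating M · adj(M) = det(M) · 1 at 0, where M is diagonal and invertible, determines
  -- the derivative of the adjugate.
  have hAval : ∀ i j, A i j = ((if i = j then (∏ i, d i) * ∑ i, M₁ i i / d i else 0)
      - M₁ i j * ((∏ k, d k) / d j)) / d i := by
    intro i j
    have e1 : HasDerivAt (fun s ↦ ∑ k, M s i k * adjugate (M s) k j)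
        (∑ k, (M₁ i k * adjugate (M 0) k j + M 0 i k * A k j)) 0 :=
      HasDerivAt.fun_sum fun k _ ↦ (hM₁ i k).mul (hA k j)
    have e2 : HasDerivAt (fun s ↦ (M s).det * (1 : Matrix ι ι ℂ) i j)
        ((∏ i, d i) * (∑ i, M₁ i i / d i) * (1 : Matrix ι ι ℂ) i j) 0 := hdet.mul_const _
    have e3 := e1.unique (e2.congr_of_eventuallyEq (.of_forall fun s ↦ by
      have := congrFun (congrFun (mul_adjugate (M s)) i) j
      rw [mul_apply, Matrix.smul_apply, smul_eq_mul] at this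
      exact this))
    have h0' : ∀ k, M 0 i k = if i = k then d i else 0 := fun k ↦ by rw [h0, diagonal_apply]
    simp only [Finset.sum_add_distrib, hadj0, mul_ite, mul_zero, Finset.sum_ite_eq', h0',
      Finset.mem_univ, if_true, ite_mul, zero_mul, Finset.sum_ite_eq, one_apply, mul_one] at e3
    rw [eq_div_iff (hd i)]
    linear_combination e3
  refine ⟨fun t ↦ (adjugate (M t) * of fun i j ↦ M' i j t).trace, ?_, ?_, ?_⟩
  · filter_upwards [hev] with t ht
    exact hasDerivAt_det ht
  · have : (of fun i j ↦ M' i j 0) = M₁ := by ext i j; exact hM'0 i j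
    simp only [this, tr0]
  · have e1 : HasDerivAt (fun s ↦ ∑ i, ∑ j, adjugate (M s) i j * M' j i s)
        (∑ i, ∑ j, (A i j * M' j i 0 + adjugate (M 0) i j * M₂ j i)) 0 :=
      HasDerivAt.fun_sum fun i _ ↦ HasDerivAt.fun_sum fun j _ ↦ (hA i j).mul (hM'2 j i)
    refine (e1.congr_deriv ?_).congr_of_eventuallyEq (.of_forall fun t ↦ ?_)
    · simp only [hM'0, hAval, hadj0, Finset.sum_add_distrib, ite_mul, zero_mul, Finset.sum_ite_eq,
        Finset.mem_univ, if_true, mul_add, mul_sub, sub_div, sub_mul, Finset.sum_sub_distrib]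
      congr 1
      · congr 1
        · have : ∀ i j, (if i = j then (∏ i, d i) * ∑ i, M₁ i i / d i else 0) / d i * M₁ j i
              = if i = j then ((∏ i, d i) * ∑ i, M₁ i i / d i) * (M₁ i i / d i) else 0 := by
            intro i j
            split_ifs with hij
            · subst hij; ring
            · simp
          simp only [this, Finset.sum_ite_eq, Finset.mem_univ, if_true, ← Finset.mul_sum]
          ring
        · simp only [Finset.mul_sum]
          refine Finset.sum_congr rfl fun i _ ↦ Finset.sum_congr rfl fun j _ ↦ ?_
          field_simp [hd i, hd j]
      · simp only [Finset.mul_sum]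
        exact Finset.sum_congr rfl fun i _ ↦ by ring
    · simp [trace, mul_apply]

end Det

/-! ### Unitary frames -/

/-- The sesquilinear form `h(∂_v, ∂̄_w)` attached to a real bilinear form `h`. -/
noncomputable def herm {E : Type*} (J : E → E) (h : E → E → ℝ) (v w : E) : ℂ :=
  (((h v w + h (J v) (J w) : ℝ) : ℂ) + Complex.I * ((h v (J w) - h (J v) w : ℝ) : ℂ)) / 4

section Frame

lemma herm_re {E : Type*} (J : E → E) (h : E → E → ℝ) (v w : E) :
    (herm J h v w).re = (h v w + h (J v) (J w)) / 4 := by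
  have : herm J h v w = ⟨(h v w + h (J v) (J w)) / 4, (h v (J w) - h (J v) w) / 4⟩ := by
    apply Complex.ext <;> simp [herm]
  rw [this]

lemma herm_im {E : Type*} (J : E → E) (h : E → E → ℝ) (v w : E) :
    (herm J h v w).im = (h v (J w) - h (J v) w) / 4 := by
  simp [herm]

variable {E : Type*} [AddCommGroup E] [Module ℝ E]
  (J : E →ₗ[ℝ] E) (h : E →ₗ[ℝ] E →ₗ[ℝ] ℝ)

lemma herm_add_left (v v' w : E) :
    herm J (fun a b ↦ h a b) (v + v') w
      = herm J (fun a b ↦ h a b) v w + herm J (fun a b ↦ h a b) v' w := by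
  apply Complex.ext <;> simp only [herm_re, herm_im, Complex.add_re, Complex.add_im, map_add,
    LinearMap.add_apply] <;> ring

lemma herm_combo_left (hJ : ∀ v, J (J v) = -v) (r s : ℝ) (v w : E) :
    herm J (fun a b ↦ h a b) (r • v + s • J v) w = (⟨r, s⟩ : ℂ) * herm J (fun a b ↦ h a b) v w := by
  apply Complex.ext <;> simp only [herm_re, herm_im, Complex.mul_re, Complex.mul_im, map_add, hJ,
    LinearMap.add_apply, map_smul, LinearMap.smul_apply, map_neg, LinearMap.neg_apply,
    smul_eq_mul] <;> ring

/-- With J as multiplication by i, E is a complex space of dimension n on which G induces a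
Hermitian inner product. The Hermitian form of h is represented by a self-adjoint operator, and the
frame is an orthonormal eigenbasis. Unit length here means G(e, e) = 2, hence the halves in the
expansion of v. -/
theorem exists_unitary_frame [FiniteDimensional ℝ E] {n : ℕ} (hdim : Module.finrank ℝ E = 2 * n)
    (hJ : ∀ v, J (J v) = -v) (G : E →ₗ[ℝ] E →ₗ[ℝ] ℝ) (hGs : ∀ v w, G v w = G w v)
    (hGp : ∀ v, v ≠ 0 → 0 < G v v) (hGJ : ∀ v w, G (J v) (J w) = G v w)
    (hh : ∀ v w, herm J (fun a b ↦ h a b) w v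
      = (starRingEnd ℂ) (herm J (fun a b ↦ h a b) v w)) :
    ∃ (e : Fin n → E) (l : Fin n → ℝ),
      (∀ j k, herm J (fun a b ↦ G a b) (e j) (e k) = if j = k then 1 else 0) ∧
      (∀ j k, herm J (fun a b ↦ h a b) (e j) (e k) = if j = k then (l j : ℂ) else 0) ∧
      ∀ v, v = ∑ k, ((G v (e k) / 2) • e k + (G v (J (e k)) / 2) • J (e k)) := by
  let φ : ℂ →ₐ[ℝ] Module.End ℝ E := Complex.lift ⟨J, by ext v; simp [hJ]⟩
  let : Module ℂ E := Module.compHom E φ.toRingHom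
  have hsmul : ∀ (c : ℂ) (v : E), c • v = c.re • v + c.im • J v := by
    intro c v
    change φ c v = _
    simp [φ, Complex.lift_apply, Complex.liftAux_apply]
  have : IsScalarTower ℝ ℂ E := ⟨fun r c v ↦ by
    simp [hsmul, smul_add, smul_smul]⟩
  have : FiniteDimensional ℂ E := FiniteDimensional.right ℝ ℂ E
  have hrank : Module.finrank ℂ E = n := by
    have h1 := Module.finrank_mul_finrank ℝ ℂ E
    rw [Complex.finrank_real_complex, hdim] at h1
    omega
  have hG' : ∀ v w, G (J v) w = -G v (J w) := fun v w ↦ by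
    rw [← hGJ v (J w), hJ, map_neg, neg_neg]
  have hGc : ∀ v w, herm J (fun a b ↦ G a b) v w = ⟨G v w / 2, G v (J w) / 2⟩ := by
    intro v w
    apply Complex.ext
    · rw [herm_re, hGJ]; ring
    · rw [herm_im, hG']; ring
  have hhs : ∀ (h : E →ₗ[ℝ] E →ₗ[ℝ] ℝ) (c : ℂ) (v w : E),
      herm J (fun a b ↦ h a b) (c • v) w = c * herm J (fun a b ↦ h a b) v w := by
    intro h c v w
    rw [hsmul, herm_combo_left J h hJ]
  let core : InnerProductSpace.Core ℂ E :=
    -- The arguments are exchanged: the inner product is antilinear in the first argument, `herm` is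
    -- complex linear in it.
    { inner := fun w v ↦ herm J (fun a b ↦ G a b) v w
      conj_inner_symm := by
        intro v w
        rw [hGc, hGc]
        apply Complex.ext
        · simp [hGs v w]
        · have : G w (J v) = - G v (J w) := by rw [hGs w (J v), hG']
          simp [this]; ring
      re_inner_nonneg := by
        intro v
        rw [hGc]
        by_cases hv : v = 0
        · simp [hv]
        · exact (half_pos (hGp v hv)).le
      add_left := by
        intro v v' w
        rw [hGc, hGc, hGc]
        apply Complex.ext <;> simp <;> ring
      smul_left := by
        intro v w c
        rw [hGc, hGc, hsmul]
        have : G w (J (J v)) = - G w v := by rw [hJ, map_neg]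
        apply Complex.ext <;> simp [this] <;> ring
      definite := by
        intro v hv
        by_contra hv0
        rw [hGc] at hv
        have := congrArg Complex.re hv
        have h2 := hGp v hv0
        simp at this
        linarith }
  let : NormedAddCommGroup E := core.toNormedAddCommGroup
  let : InnerProductSpace ℂ E := InnerProductSpace.ofCore core.toCore
  have hinner : ∀ v w : E, inner ℂ w v = herm J (fun a b ↦ G a b) v w := fun v w ↦ rfl
  let b := stdOrthonormalBasis ℂ E
  let T : E →ₗ[ℂ] E :=
    { toFun := fun v ↦ ∑ k, herm J (fun a b ↦ h a b) v (b k) • b k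
      map_add' := fun v w ↦ by
        simp only [herm_add_left, add_smul, Finset.sum_add_distrib]
      map_smul' := fun c v ↦ by
        simp only [hhs, mul_smul, Finset.smul_sum, RingHom.id_apply] }
  have hTin : ∀ x y, inner ℂ (T x) y = herm J (fun a b ↦ h a b) y x := by
    intro x y
    have hsum : ∀ s : Finset (Fin (Module.finrank ℂ E)), herm J (fun a b ↦ h a b)
        (∑ k ∈ s, inner ℂ (b k) y • b k) x
          = ∑ k ∈ s, inner ℂ (b k) y * herm J (fun a b ↦ h a b) (b k) x := by
      intro s
      induction s using Finset.induction_on with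
      | empty => apply Complex.ext <;> simp [herm_re, herm_im]
      | insert a s ha ih => rw [Finset.sum_insert ha, Finset.sum_insert ha, herm_add_left, hhs, ih]
    conv_rhs => rw [← b.sum_repr' y, hsum]
    change inner ℂ (∑ k, herm J (fun a b ↦ h a b) x (b k) • b k) y = _
    rw [sum_inner]
    refine Finset.sum_congr rfl fun k _ ↦ ?_
    rw [inner_smul_left, hh x (b k), mul_comm]
  have hT : T.IsSymmetric := by
    intro x y
    rw [hTin, ← inner_conj_symm, hTin, ← hh]
  let e := hT.eigenvectorBasis hrank
  refine ⟨e, hT.eigenvalues hrank, ?_, ?_, ?_⟩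
  · intro j k
    rw [← hinner, orthonormal_iff_ite.1 e.orthonormal]
    simp only [eq_comm]
  · intro j k
    rw [← hTin, hT.apply_eigenvectorBasis hrank k, inner_smul_left,
      orthonormal_iff_ite.1 e.orthonormal]
    by_cases hjk : j = k
    · subst hjk; simp
    · simp [hjk, Ne.symm hjk]
  · intro v
    conv_lhs => rw [← e.sum_repr' v]
    refine Finset.sum_congr rfl fun k _ ↦ ?_
    rw [hinner, hGc, hsmul]

end Frame

/-! ### Chain and product rules for second order jets -/

namespace Jet2

variable {V W : Type*} [NormedAddCommGroup V] [NormedSpace ℝ V]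
  [NormedAddCommGroup W] [NormedSpace ℝ W]

lemma continuousAt {γ : ℝ → V} {v₁ v₂ : V} (hγ : Jet2 γ v₁ v₂) : ContinuousAt γ 0 :=
  hγ.hasDerivAt.continuousAt

lemma comp_contDiffAt {F : V → W} {γ : ℝ → V} {v₁ v₂ : V} (hγ : Jet2 γ v₁ v₂)
    (hF : ContDiffAt ℝ 2 F (γ 0)) :
    Jet2 (fun t ↦ F (γ t)) (fderiv ℝ F (γ 0) v₁)
      (fderiv ℝ (fderiv ℝ F) (γ 0) v₁ v₁ + fderiv ℝ F (γ 0) v₂) := by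
  have hc := hγ.continuousAt
  obtain ⟨γ', h1, h2, h3⟩ := hγ
  have hd : ∀ᶠ t in 𝓝 (0 : ℝ), DifferentiableAt ℝ F (γ t) := by
    have := (hF.of_le (by norm_num : (1 : ℕ∞ω) ≤ 2)).eventually (by simp)
    exact (hc.eventually this).mono fun t ht ↦ ht.differentiableAt (by simp)
  have hF' : DifferentiableAt ℝ (fderiv ℝ F) (γ 0) :=
    (hF.fderiv_right (m := 1) (by norm_num)).differentiableAt (by simp)
  refine ⟨fun t ↦ fderiv ℝ F (γ t) (γ' t), ?_, by simp only [h2], ?_⟩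
  · filter_upwards [h1, hd] with t ht ht' using ht'.hasFDerivAt.comp_hasDerivAt t ht
  · have h4 := hF'.hasFDerivAt.comp_hasDerivAt (0 : ℝ) h1.self_of_nhds
    exact (h4.clm_apply h3).congr_deriv (by simp [h2])

lemma clm_apply {B : ℝ → V →L[ℝ] W} {B₁ B₂ : V →L[ℝ] W} {w : ℝ → V} {w₁ w₂ : V}
    (hB : Jet2 B B₁ B₂) (hw : Jet2 w w₁ w₂) :
    Jet2 (fun t ↦ B t (w t)) (B₁ (w 0) + B 0 w₁) (B₂ (w 0) + (2 : ℝ) • B₁ w₁ + B 0 w₂) := by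
  have hB0 := hB.hasDerivAt
  have hw0 := hw.hasDerivAt
  obtain ⟨B', h1, h2, h3⟩ := hB
  obtain ⟨w', k1, k2, k3⟩ := hw
  refine ⟨fun t ↦ B' t (w t) + B t (w' t), ?_, by simp only [h2, k2], ?_⟩
  · filter_upwards [h1, k1] with t ht kt using ht.clm_apply kt
  · exact ((h3.clm_apply hw0).add (hB0.clm_apply k3)).congr_deriv
      (by rw [h2, k2, two_smul]; abel)

lemma prodMk {γ : ℝ → V} {v₁ v₂ : V} {η : ℝ → W} {w₁ w₂ : W} (hγ : Jet2 γ v₁ v₂)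
    (hη : Jet2 η w₁ w₂) : Jet2 (fun t ↦ (γ t, η t)) (v₁, w₁) (v₂, w₂) := by
  obtain ⟨γ', h1, h2, h3⟩ := hγ
  obtain ⟨η', k1, k2, k3⟩ := hη
  refine ⟨fun t ↦ (γ' t, η' t), ?_, by simp only [h2, k2], h3.prodMk k3⟩
  filter_upwards [h1, k1] with t ht kt using ht.prodMk kt

/-- The chain rule for a family `c(x, s)` along a curve `(x(t), u(t))`, in terms of the jets at the
fixed parameter `u(0)`. -/
lemma param {c : V → ℝ → W} {x : ℝ → V} {x₁ x₂ : V} {u : ℝ → ℝ} {u₁ u₂ : ℝ} {A₁ A₂ D : W}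
    (hc : ContDiffAt ℝ 2 (fun p : V × ℝ ↦ c p.1 p.2) (x 0, u 0)) (hx : Jet2 x x₁ x₂)
    (hu : Jet2 u u₁ u₂) (hA : Jet2 (fun t ↦ c (x t) (u 0)) A₁ A₂)
    (hD : HasDerivAt (fun t ↦ deriv (c (x t)) (u 0)) D 0) :
    Jet2 (fun t ↦ c (x t) (u t)) (A₁ + u₁ • deriv (c (x 0)) (u 0))
      (A₂ + (2 * u₁) • D + u₁ ^ 2 • iteratedDeriv 2 (c (x 0)) (u 0)
        + u₂ • deriv (c (x 0)) (u 0)) := by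
  set F : V × ℝ → W := fun p ↦ c p.1 p.2 with hFdef
  have hF1 : ∀ᶠ p in 𝓝 (x 0, u 0), DifferentiableAt ℝ F p := by
    have := (hc.of_le (by norm_num : (1 : ℕ∞ω) ≤ 2)).eventually (by simp)
    exact this.mono fun t ht ↦ ht.differentiableAt (by simp)
  have hF' : DifferentiableAt ℝ (fderiv ℝ F) (x 0, u 0) :=
    (hc.fderiv_right (m := 1) (by norm_num)).differentiableAt (by simp)
  have hsymm : ∀ p q, fderiv ℝ (fderiv ℝ F) (x 0, u 0) p q
      = fderiv ℝ (fderiv ℝ F) (x 0, u 0) q p := fun p q ↦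
    (hc.isSymmSndFDerivAt (by simp)) p q
  have hs : ∀ z s, DifferentiableAt ℝ F (z, s) → deriv (c z) s = fderiv ℝ F (z, s) (0, 1) := by
    intro z s h
    exact (h.hasFDerivAt.comp_hasDerivAt s
      ((hasDerivAt_const s z).prodMk (hasDerivAt_id s))).deriv
  have j1 := (hx.prodMk hu).comp_contDiffAt (F := F) hc
  -- With the parameter frozen at u(0), the same chain rule must reproduce the given jet (A₁, A₂).
  -- This eliminates the pure x-derivatives of F.
  have j2 := (hx.prodMk (Jet2.const (u 0))).comp_contDiffAt (F := F) hc
  obtain ⟨e1, e2⟩ := hA.unique j2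
  have hcx : ContinuousAt (fun t ↦ (x t, u 0)) 0 :=
    (hx.prodMk (Jet2.const (u 0))).continuousAt
  have e3 : D = fderiv ℝ (fderiv ℝ F) (x 0, u 0) (x₁, 0) (0, 1) := by
    refine hD.unique ?_
    have h4 : HasDerivAt (fun t ↦ fderiv ℝ F (x t, u 0) (0, 1))
        (fderiv ℝ (fderiv ℝ F) (x 0, u 0) (x₁, 0) (0, 1)) 0 := by
      have h5 := hF'.hasFDerivAt.comp_hasDerivAt (0 : ℝ)
        (hx.prodMk (Jet2.const (u 0))).hasDerivAt
      exact (h5.clm_apply (hasDerivAt_const _ _)).congr_deriv (by simp)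
    refine h4.congr_of_eventuallyEq ?_
    filter_upwards [hcx.eventually hF1] with t ht using hs _ _ ht
  have hcs : ContinuousAt (fun s ↦ (x 0, s)) (u 0) := by fun_prop
  have e4 : iteratedDeriv 2 (c (x 0)) (u 0)
      = fderiv ℝ (fderiv ℝ F) (x 0, u 0) (0, 1) (0, 1) := by
    rw [iteratedDeriv_succ, iteratedDeriv_one]
    refine HasDerivAt.deriv ?_
    have h4 : HasDerivAt (fun s ↦ fderiv ℝ F (x 0, s) (0, 1))
        (fderiv ℝ (fderiv ℝ F) (x 0, u 0) (0, 1) (0, 1)) (u 0) := by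
      have h5 := hF'.hasFDerivAt.comp_hasDerivAt (u 0)
        ((hasDerivAt_const (u 0) (x 0)).prodMk (hasDerivAt_id (u 0)))
      exact (h5.clm_apply (hasDerivAt_const _ _)).congr_deriv (by simp)
    refine h4.congr_of_eventuallyEq ?_
    filter_upwards [hcs.eventually hF1] with s hs' using hs _ _ hs'
  have e5 : deriv (c (x 0)) (u 0) = fderiv ℝ F (x 0, u 0) (0, 1) := hs _ _ hF1.self_of_nhds
  have split : ∀ (p : V) (r : ℝ), ((p, r) : V × ℝ) = (p, 0) + r • (0, 1) := by
    intro p r; ext <;> simp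
  refine j1.congr_jet ?_ ?_
  · rw [e1, e5, split x₁ u₁, map_add, map_smul]
  · rw [e2, e3, e4, e5, split x₁ u₁, split x₂ u₂]
    simp only [map_add, map_smul, _root_.add_apply, _root_.smul_apply,
      hsymm (0, 1) (x₁, 0)]
    module

end Jet2

/-! ### The summation estimate -/

/-- The maximum principle inequality, summed over a unitary frame. -/
lemma sum_estimate {n : ℕ} {l A P F Bq : Fin n → ℝ} {M₁ M₂ : Fin n → Fin n → ℂ}
    {X u₁ p₁ a κ Λ' Z₁ Z₂ Z₃ Z₄ B₁ μ : ℝ} (ha : |u₁| ≤ a) (hκ : 0 ≤ κ) (hΛ' : 0 ≤ Λ')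
    (hl : ∀ j, 0 < l j) (hlB : ∀ j, l j ≤ B₁) (hlμ : ∀ j, (l j)⁻¹ ≤ μ) (hB₁ : 0 < B₁)
    (hZ₁ : 0 ≤ Z₁) (hZ₂ : 0 ≤ Z₂)
    (hE : ∀ j, A j + 2 * P j + 2 * u₁ * F j ≤ 0)
    (hA : ∀ j, |A j - 4 * (M₂ j j).re| ≤ 4 * |Bq j| + Z₁)
    (hF : ∀ j, |F j - 4 * (M₁ j j).re| ≤ Z₂)
    (hB : ∀ j, |Bq j| ≤ ∑ k, κ * (8 * ‖M₁ k j‖ + 8 * Λ'))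
    (h₁ : ∑ j, (M₁ j j).re / l j = p₁) (hp₁ : |p₁| ≤ Z₄)
    (h₂ : (∑ j, ∑ k, ‖M₁ j k‖ ^ 2 / (l j * l k)) - Z₃ ≤ ∑ j, (M₂ j j).re / l j)
    (hP0 : ∀ j, 0 ≤ P j) (hX : X ^ 2 ≤ (∑ j, P j) / 2) :
    X ^ 2 ≤ B₁ / 4 * (4 * Z₃ + n * μ * Z₁ + 8 * a * Z₄ + 2 * a * n * μ * Z₂
      + 32 * κ * Λ' * n ^ 2 * μ + 64 * κ ^ 2 * n ^ 2 * B₁ * μ) := by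
  have ha0 : 0 ≤ a := (abs_nonneg _).trans ha
  have hinv : ∀ j, 0 < (l j)⁻¹ := fun j ↦ inv_pos.2 (hl j)
  -- This is `hE` for the index j, multiplied by 1/l_j, with every error replaced by its bound.
  have e : ∀ j, (l j)⁻¹ * (2 * P j) ≤ (l j)⁻¹ * (-4 * (M₂ j j).re + -8 * u₁ * (M₁ j j).re)
      + (∑ k, 4 * (‖M₁ k j‖ ^ 2 / (l k * l j)))
      + (n * (64 * κ ^ 2 * B₁ * μ) + n * (32 * κ * Λ' * μ) + μ * Z₁ + 2 * a * μ * Z₂) := by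
    intro j
    have hFj : -(2 * u₁ * F j) ≤ -8 * u₁ * (M₁ j j).re + 2 * a * Z₂ := by
      have : |2 * u₁ * (F j - 4 * (M₁ j j).re)| ≤ 2 * a * Z₂ := by
        rw [abs_mul, abs_mul, abs_two]
        have := hF j
        gcongr
      have := (abs_le.1 this).1
      linarith
    have hAj := (abs_le.1 (hA j)).1
    have s1 : 2 * P j ≤ -4 * (M₂ j j).re + -8 * u₁ * (M₁ j j).re + 4 * |Bq j| + Z₁
        + 2 * a * Z₂ := by linarith [hE j]
    have s2 : (l j)⁻¹ * (4 * |Bq j|) ≤ (∑ k, 4 * (‖M₁ k j‖ ^ 2 / (l k * l j)))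
        + (n * (64 * κ ^ 2 * B₁ * μ) + n * (32 * κ * Λ' * μ)) := by
      calc (l j)⁻¹ * (4 * |Bq j|)
          ≤ (l j)⁻¹ * (4 * ∑ k, κ * (8 * ‖M₁ k j‖ + 8 * Λ')) := by
            have := hB j
            have := (hinv j).le
            gcongr
        _ = ∑ k, (l j)⁻¹ * (4 * (κ * (8 * ‖M₁ k j‖ + 8 * Λ'))) := by
            rw [Finset.mul_sum, Finset.mul_sum]
        _ ≤ ∑ k : Fin n, (4 * (‖M₁ k j‖ ^ 2 / (l k * l j))
              + (64 * κ ^ 2 * B₁ * μ + 32 * κ * Λ' * μ)) := by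
            refine Finset.sum_le_sum fun k _ ↦ ?_
            set m := ‖M₁ k j‖
            have q1 : (l j)⁻¹ * (32 * κ * Λ') ≤ 32 * κ * Λ' * μ := by
              rw [mul_comm]
              have := hlμ j
              gcongr
            -- Expand (2m - 8κ l_k)² ≥ 0 and divide by l_k l_j. The coefficient 4 of m²/(l_k l_j) is
            -- exactly what `h₂` compensates after summation, so the third derivatives disappear.
            have q2 : 32 * κ * m * (l j)⁻¹ ≤ 4 * (m ^ 2 / (l k * l j))
                + 64 * κ ^ 2 * l k * (l j)⁻¹ := by
              have : 0 ≤ (l j)⁻¹ * (l k)⁻¹ * (2 * m - 8 * κ * l k) ^ 2 := by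
                have := hinv j
                have := hinv k
                positivity
              have hk := (hl k).ne'
              have hj := (hl j).ne'
              have : (l j)⁻¹ * (l k)⁻¹ * (2 * m - 8 * κ * l k) ^ 2
                  = 4 * (m ^ 2 / (l k * l j)) + 64 * κ ^ 2 * l k * (l j)⁻¹
                    - 32 * κ * m * (l j)⁻¹ := by
                field_simp
                ring
              linarith
            have q3 : 64 * κ ^ 2 * l k * (l j)⁻¹ ≤ 64 * κ ^ 2 * B₁ * μ := by
              have := hlμ j
              have := hlB k
              have := (hinv j).le
              gcongr
            linarith
        _ = _ := by
            rw [Finset.sum_add_distrib]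
            simp only [Finset.sum_const, Finset.card_univ, Fintype.card_fin, nsmul_eq_mul]
            ring
    have s3 : (l j)⁻¹ * Z₁ ≤ μ * Z₁ := mul_le_mul_of_nonneg_right (hlμ j) hZ₁
    have s4 : (l j)⁻¹ * (2 * a * Z₂) ≤ μ * (2 * a * Z₂) :=
      mul_le_mul_of_nonneg_right (hlμ j) (by positivity)
    have s5 := mul_le_mul_of_nonneg_left s1 (hinv j).le
    linarith
  have S := Finset.sum_le_sum fun j (_ : j ∈ Finset.univ) ↦ e j
  have t1 : ∑ j, (l j)⁻¹ * (-4 * (M₂ j j).re + -8 * u₁ * (M₁ j j).re)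
      = -4 * (∑ j, (M₂ j j).re / l j) - 8 * u₁ * p₁ := by
    rw [← h₁, Finset.mul_sum, Finset.mul_sum, ← Finset.sum_sub_distrib]
    exact Finset.sum_congr rfl fun j _ ↦ by ring
  have t2 : ∑ j, ∑ k, 4 * (‖M₁ k j‖ ^ 2 / (l k * l j))
      = 4 * ∑ j, ∑ k, ‖M₁ j k‖ ^ 2 / (l j * l k) := by
    rw [Finset.sum_comm]
    simp only [Finset.mul_sum]
  simp only [Finset.sum_add_distrib] at S
  rw [t2] at S
  simp only [← Finset.sum_add_distrib] at S
  rw [t1] at S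
  simp only [Finset.sum_const, Finset.card_univ, Fintype.card_fin, nsmul_eq_mul] at S
  have t3 : -(8 * u₁ * p₁) ≤ 8 * a * Z₄ := by
    have : |8 * u₁ * p₁| ≤ 8 * a * Z₄ := by
      rw [abs_mul, abs_mul, abs_of_pos (by norm_num : (0 : ℝ) < 8)]
      gcongr
    linarith [(abs_le.1 this).1]
  -- The upper bound l_j ≤ B₁ turns the weighted sum of the P_j into a multiple of the unweighted
  -- one, which dominates X².
  have t4 : (∑ j, P j) * (2 / B₁) ≤ ∑ j, (l j)⁻¹ * (2 * P j) := by
    rw [Finset.sum_mul]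
    refine Finset.sum_le_sum fun j _ ↦ ?_
    have : B₁⁻¹ ≤ (l j)⁻¹ := inv_anti₀ (hl j) (hlB j)
    have h0 := hP0 j
    calc P j * (2 / B₁) = B₁⁻¹ * (2 * P j) := by ring
      _ ≤ _ := by gcongr
  have t5 : X ^ 2 ≤ B₁ / 4 * ((∑ j, P j) * (2 / B₁)) := by
    have : B₁ / 4 * ((∑ j, P j) * (2 / B₁)) = (∑ j, P j) / 2 := by field_simp; ring
    rw [this]; exact hX
  refine t5.trans (mul_le_mul_of_nonneg_left ?_ (by positivity))
  refine t4.trans (S.trans ?_)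
  linarith

lemma Jet2.ofReal {f : ℝ → ℝ} {f₁ f₂ : ℝ} (hf : Jet2 f f₁ f₂) :
    Jet2 (fun t ↦ (f t : ℂ)) (f₁ : ℂ) (f₂ : ℂ) := hf.clm Complex.ofRealCLM

namespace Chart

noncomputable section

variable {E : Type*} [NormedAddCommGroup E] [NormedSpace ℝ E]

/-! ### Tensors and functions depending on a real parameter -/

section Param

variable {F : Type*} [NormedAddCommGroup F] [NormedSpace ℝ F]

lemma contDiffAt_slice {c : E → ℝ → F} {y : E} {s : ℝ} {m : ℕ∞ω}
    (hc : ContDiffAt ℝ m (fun p : E × ℝ ↦ c p.1 p.2) (y, s)) :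
    ContDiffAt ℝ m (fun z ↦ c z s) y :=
  ContDiffAt.comp (f := fun z ↦ (z, s)) y hc (contDiffAt_id.prodMk contDiffAt_const)

lemma contDiffAt_deriv_param {c : E → ℝ → F} {y : E} {s : ℝ} {m n : ℕ∞ω} (hmn : m + 1 ≤ n)
    (hc : ContDiffAt ℝ n (fun p : E × ℝ ↦ c p.1 p.2) (y, s)) :
    ContDiffAt ℝ m (fun p : E × ℝ ↦ deriv (c p.1) p.2) (y, s) := by
  have h1 : ContDiffAt ℝ m (fun p ↦ fderiv ℝ (fun p : E × ℝ ↦ c p.1 p.2) p (0, 1)) (y, s) :=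
    (hc.fderiv_right hmn).clm_apply contDiffAt_const
  refine h1.congr_of_eventuallyEq ?_
  have h2 := (hc.of_le (le_trans le_add_self hmn)).eventually (by simp)
  filter_upwards [h2] with p hp
  have := (hp.differentiableAt (by simp)).hasFDerivAt.comp_hasDerivAt p.2
    ((hasDerivAt_const p.2 p.1).prodMk (hasDerivAt_id p.2))
  exact this.deriv

end Param

variable {Γ : E → E →L[ℝ] E →L[ℝ] E} {y a : E}

lemma jet2_geod : Jet2 (geod Γ y a) a (-Γ y a a) :=
  ⟨geodVel Γ y a, .of_forall hasDerivAt_geod, geodVel_zero, hasDerivAt_geodVel 0⟩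

lemma Parallel2.exists_jet2 (hΓ : DifferentiableAt ℝ Γ y) {W : ℝ → E} (hW : Parallel2 Γ y a W) :
    ∃ w₂, Jet2 W (- Γ y a (W 0)) w₂ := by
  have hW0 := hW.hasDerivAt
  obtain ⟨Z, h, h0, h1⟩ := hW
  have hΓ' : HasFDerivAt Γ (fderiv ℝ Γ y) (geod Γ y a 0) := by simpa using hΓ.hasFDerivAt
  exact ⟨_, _, h, by simp [h0], h1.sub (((hΓ'.comp_hasDerivAt 0 (hasDerivAt_geod 0)).clm_apply
    (hasDerivAt_geodVel (Γ := Γ) (y₀ := y) (a := a) 0)).clm_apply hW0)⟩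

/-- The first derivative in the direction `a` of a family `χ(y, f(y))` of covariant `2`-tensors. -/
def famDeriv (Γ : E → E →L[ℝ] E →L[ℝ] E) (χ : E → ℝ → E →L[ℝ] E →L[ℝ] ℝ) (f : E → ℝ)
    (y a v w : E) : ℝ :=
  nab2 Γ (fun z ↦ χ z (f y)) y a v w + fderiv ℝ f y a * deriv (χ y) (f y) v w

/-- The second covariant derivative in the direction `a` of a family `χ(y, f(y))` of covariant
`2`-tensors. -/
def famDeriv₂ (Γ : E → E →L[ℝ] E →L[ℝ] E) (χ : E → ℝ → E →L[ℝ] E →L[ℝ] ℝ) (f : E → ℝ)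
    (y a v w : E) : ℝ :=
  nab3 Γ (nab2 Γ fun z ↦ χ z (f y)) y a a v w
    + 2 * fderiv ℝ f y a * nab2 Γ (fun z ↦ deriv (χ z) (f y)) y a v w
    + fderiv ℝ f y a ^ 2 * iteratedDeriv 2 (χ y) (f y) v w
    + nab1 Γ (fderiv ℝ f) y a a * deriv (χ y) (f y) v w

/-- `Jet2.param` separates the derivatives in the parameter from those of the family frozen at f(y).
Comparison with the covariant jets of the frozen family and of its t-derivative turns coordinate
derivatives into covariant ones. -/
lemma jet2_fam {χ : E → ℝ → E →L[ℝ] E →L[ℝ] ℝ} {f : E → ℝ}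
    (hχ : ContDiffAt ℝ 3 (fun p : E × ℝ ↦ χ p.1 p.2) (y, f y)) (hΓ : ContDiffAt ℝ 1 Γ y)
    (hf : ContDiffAt ℝ 2 f y) {W₁ W₂ : ℝ → E} (hW₁ : Parallel2 Γ y a W₁)
    (hW₂ : Parallel2 Γ y a W₂) :
    Jet2 (fun t ↦ χ (geod Γ y a t) (f (geod Γ y a t)) (W₁ t) (W₂ t))
      (famDeriv Γ χ f y a (W₁ 0) (W₂ 0)) (famDeriv₂ Γ χ f y a (W₁ 0) (W₂ 0)) := by
  have hΓ' : DifferentiableAt ℝ Γ y := hΓ.differentiableAt (by simp)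
  obtain ⟨w₁, hw₁⟩ := hW₁.exists_jet2 hΓ'
  obtain ⟨w₂, hw₂⟩ := hW₂.exists_jet2 hΓ'
  have hχ0 : ContDiffAt ℝ 2 (fun z ↦ χ z (f y)) y :=
    (contDiffAt_slice hχ).of_le (by norm_num)
  have hχ1 : ContDiffAt ℝ 2 (fun z ↦ deriv (χ z) (f y)) y :=
    contDiffAt_slice (contDiffAt_deriv_param (c := χ) (by norm_num) hχ)
  have hχ1' : HasFDerivAt (fun z ↦ deriv (χ z) (f y)) (fderiv ℝ (fun z ↦ deriv (χ z) (f y)) y)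
      (geod Γ y a 0) := by
    simpa using (hχ1.differentiableAt (by simp)).hasFDerivAt
  have hD := hχ1'.comp_hasDerivAt 0 (hasDerivAt_geod (Γ := Γ) (y₀ := y) (a := a) 0)
  have hA := (jet2_geod (Γ := Γ) (y := y) (a := a)).comp_contDiffAt (F := fun z ↦ χ z (f y))
    (by simpa using hχ0)
  have hB := Jet2.param (c := χ) (x := geod Γ y a) (u := fun t ↦ f (geod Γ y a t))
    (by simpa using hχ.of_le (by norm_num)) jet2_geod (jet2_scalar hf)
    (by simpa using hA) (by simpa [Function.comp_def] using hD)
  have j0 := (hA.clm_apply hw₁).clm_apply hw₂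
  have j0' := j0.unique (jet2_form2 hχ0 hΓ hW₁ hW₂)
  have j1 := (hD.clm_apply hw₁.hasDerivAt).clm_apply hw₂.hasDerivAt
  have j1' := j1.unique (hasDerivAt_form2 (Γ := Γ) (x := geod Γ y a) (w₁ := 0) (W₁ := W₁)
    (w₂ := 0) (W₂ := W₂) (t := 0) (B := fun z ↦ deriv (χ z) (f y))
    (by simpa using hχ1.differentiableAt (by simp)) (hasDerivAt_geod 0)
    (by simpa using hW₁.hasDerivAt) (by simpa using hW₂.hasDerivAt))
  refine ((hB.clm_apply hw₁).clm_apply hw₂).congr_jet ?_ ?_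
  · have e := j0'.1
    simp only [geod_zero, _root_.add_apply, _root_.smul_apply, smul_eq_mul, famDeriv] at e ⊢
    linear_combination e
  · have e := j0'.2
    simp only [geod_zero, _root_.add_apply, _root_.smul_apply, smul_eq_mul, famDeriv₂,
      geodVel_zero, Function.comp_apply, map_zero, _root_.zero_apply, add_zero, map_neg,
      _root_.neg_apply] at e j1' ⊢
    linear_combination e + 2 * fderiv ℝ f y a * j1'

/-- The first derivative in the direction `a` of a family `ψ(y, f(y))` of functions. -/
def famScalarDeriv (ψ : E → ℝ → ℝ) (f : E → ℝ) (y a : E) : ℝ :=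
  fderiv ℝ (fun z ↦ ψ z (f y)) y a + fderiv ℝ f y a * deriv (ψ y) (f y)

/-- The second covariant derivative in the direction `a` of a family `ψ(y, f(y))` of functions. -/
def famScalarDeriv₂ (Γ : E → E →L[ℝ] E →L[ℝ] E) (ψ : E → ℝ → ℝ) (f : E → ℝ) (y a : E) : ℝ :=
  nab1 Γ (fderiv ℝ fun z ↦ ψ z (f y)) y a a
    + 2 * fderiv ℝ f y a * fderiv ℝ (fun z ↦ deriv (ψ z) (f y)) y a
    + fderiv ℝ f y a ^ 2 * iteratedDeriv 2 (ψ y) (f y)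
    + nab1 Γ (fderiv ℝ f) y a a * deriv (ψ y) (f y)

lemma jet2_famScalar {ψ : E → ℝ → ℝ} {f : E → ℝ}
    (hψ : ContDiffAt ℝ 3 (fun p : E × ℝ ↦ ψ p.1 p.2) (y, f y)) (hf : ContDiffAt ℝ 2 f y) :
    Jet2 (fun t ↦ ψ (geod Γ y a t) (f (geod Γ y a t)))
      (famScalarDeriv ψ f y a) (famScalarDeriv₂ Γ ψ f y a) := by
  have hψ0 : ContDiffAt ℝ 2 (fun z ↦ ψ z (f y)) y :=
    (contDiffAt_slice hψ).of_le (by norm_num)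
  have hψ1 : ContDiffAt ℝ 2 (fun z ↦ deriv (ψ z) (f y)) y :=
    contDiffAt_slice (contDiffAt_deriv_param (c := ψ) (by norm_num) hψ)
  have hψ1' : HasFDerivAt (fun z ↦ deriv (ψ z) (f y)) (fderiv ℝ (fun z ↦ deriv (ψ z) (f y)) y)
      (geod Γ y a 0) := by
    simpa using (hψ1.differentiableAt (by simp)).hasFDerivAt
  have hD := hψ1'.comp_hasDerivAt 0 (hasDerivAt_geod (Γ := Γ) (y₀ := y) (a := a) 0)
  have hB := Jet2.param (c := ψ) (x := geod Γ y a) (u := fun t ↦ f (geod Γ y a t))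
    (by simpa using hψ.of_le (by norm_num)) jet2_geod (jet2_scalar hf)
    (by simpa using jet2_scalar (Γ := Γ) (a := a) hψ0) (by simpa [Function.comp_def] using hD)
  refine hB.congr_jet ?_ ?_
  · simp [famScalarDeriv]
  · simp [famScalarDeriv₂]

/-! ### The Monge-Ampère equation in a chart -/

/-- A Hermitian structure `(Γ, J, G)`, the data `χ`, `ψ` and a function `f` in a chart. -/
structure MAData (E : Type*) [NormedAddCommGroup E] [NormedSpace ℝ E] where
  Γ : E → E →L[ℝ] E →L[ℝ] E
  J : E → E →L[ℝ] E
  G : E → E →L[ℝ] E →L[ℝ] ℝ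
  χ : E → ℝ → E →L[ℝ] E →L[ℝ] ℝ
  ψ : E → ℝ → ℝ
  f : E → ℝ

namespace MAData

/-- The real bilinear form with the components `χ_{jk̄} + f_{jk̄}`. -/
def form (D : MAData E) (y v w : E) : ℝ :=
  -- The Hessian has its arguments exchanged because `nab1` takes the direction of differentiation
  -- first.
  D.χ y (D.f y) v (D.J y w) + nab1 D.Γ (fderiv ℝ D.f) y w v

/-- `f` solves the Monge-Ampère equation near `y`. -/
structure Solves (D : MAData E) (n : ℕ) (y : E) : Prop where
  chern : IsChernAt D.Γ D.J y
  contDiff_f : ContDiffAt ℝ 4 D.f y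
  contDiff_χ : ContDiffAt ℝ 3 (fun p : E × ℝ ↦ D.χ p.1 p.2) (y, D.f y)
  contDiff_ψ : ContDiffAt ℝ 3 (fun p : E × ℝ ↦ D.ψ p.1 p.2) (y, D.f y)
  contDiff_G : ContDiffAt ℝ 2 D.G y
  metric : ∀ᶠ z in 𝓝 y, nab2 D.Γ D.G z = 0
  alternating : ∀ᶠ z in 𝓝 y, ∀ v w, D.χ z (D.f z) v w = - D.χ z (D.f z) w v
  equation : ∀ᶠ z in 𝓝 y, ∀ e : Fin n → E,
    (Matrix.of fun j k ↦ herm (D.J z) (D.form z) (e j) (e k)).det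
      = (D.ψ z (D.f z) : ℂ)
        * (Matrix.of fun j k ↦ herm (D.J z) (fun v w ↦ D.G z v w) (e j) (e k)).det

end MAData

/-- The components `χ_{jk̄} + f_{jk̄}` in terms of `χ`, the Hessian `U` and `J v`, `J w`. -/
def hermComb (χ U : E → E → ℝ) (v v' w w' : E) : ℂ :=
  (((χ v w' - χ v' w + U w v + U w' v' : ℝ) : ℂ)
    + Complex.I * ((- χ v w - χ v' w' + U w' v - U w v' : ℝ) : ℂ)) / 4

namespace MAData

variable {D : MAData E} {n : ℕ}

/-- J² = -1 removes J from inside the form. What remains is a combination of χ and ∇²f on v, Jv, w,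
Jw, and all four are parallel as soon as v and w are. -/
lemma herm_form_eq (hJ : ∀ v, D.J y (D.J y v) = -v) (v w : E) :
    herm (D.J y) (D.form y) v w = hermComb (fun v w ↦ D.χ y (D.f y) v w)
      (fun v w ↦ nab1 D.Γ (fderiv ℝ D.f) y v w) v (D.J y v) w (D.J y w) := by
  simp only [herm, form, hermComb, hJ, map_neg]
  push_cast
  ring

/-- The Hessian is symmetric only up to torsion, but the torsion terms cancel in the mixed
components since T(Jv, Jw) = -T(v, w). -/
lemma herm_form_conj (hJ : ∀ v, D.J y (D.J y v) = -v)
    (hT : ∀ a b, tor D.Γ y (D.J y a) b = D.J y (tor D.Γ y a b))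
    (hf : ContDiffAt ℝ 2 D.f y)
    (halt : ∀ v w, D.χ y (D.f y) v w = - D.χ y (D.f y) w v) (v w : E) :
    herm (D.J y) (D.form y) w v = (starRingEnd ℂ) (herm (D.J y) (D.form y) v w) := by
  have hT' : ∀ a b, tor D.Γ y a (D.J y b) = D.J y (tor D.Γ y a b) := fun a b ↦ by
    rw [tor_antisymm, hT, tor_antisymm y a b, map_neg]
  have c := nab1_fderiv_comm (Γ := D.Γ) hf
  have c1 := c v w
  have c2 := c (D.J y v) (D.J y w)
  have c3 := c (D.J y v) w
  have c4 := c v (D.J y w)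
  simp only [hT, hT', hJ, map_neg] at c1 c2 c3 c4
  apply Complex.ext
  · simp only [herm_re, Complex.conj_re, form, hJ, map_neg]
    linear_combination (c1 + c2 + halt w (D.J y v) - halt (D.J y w) v) / 4
  · simp only [herm_im, Complex.conj_im, form, hJ, map_neg]
    linear_combination (-halt w v - halt (D.J y w) (D.J y v) + c3 - c4) / 4

/-- The first derivatives of the components `χ_{jk̄} + f_{jk̄}`. -/
def comp₁ (D : MAData E) (y τ v w : E) : ℂ :=
  hermComb (famDeriv D.Γ D.χ D.f y τ) (fun v w ↦ nab2 D.Γ (nab1 D.Γ (fderiv ℝ D.f)) y τ v w)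
    v (D.J y v) w (D.J y w)

/-- The second derivatives of the components `χ_{jk̄} + f_{jk̄}`. -/
def comp₂ (D : MAData E) (y τ v w : E) : ℂ :=
  hermComb (famDeriv₂ D.Γ D.χ D.f y τ)
    (fun v w ↦ nab3 D.Γ (nab2 D.Γ (nab1 D.Γ (fderiv ℝ D.f))) y τ τ v w) v (D.J y v) w (D.J y w)

variable (h : D.Solves n y) (τ : E)
include h

lemma Solves.jet2_comp {V W : ℝ → E} (hV : Parallel2 D.Γ y τ V) (hW : Parallel2 D.Γ y τ W) :
    Jet2 (fun t ↦ herm (D.J (geod D.Γ y τ t)) (D.form (geod D.Γ y τ t)) (V t) (W t))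
      (D.comp₁ y τ (V 0) (W 0)) (D.comp₂ y τ (V 0) (W 0)) := by
  have hΓ2 : ContDiffAt ℝ 2 D.Γ y := h.chern.smooth.of_le (by norm_num)
  have hΓ1 : ContDiffAt ℝ 1 D.Γ y := hΓ2.of_le (by norm_num)
  have hU : ContDiffAt ℝ 2 (nab1 D.Γ (fderiv ℝ D.f)) y :=
    contDiffAt_nab1 (n := 3) (by norm_num) hΓ2 (h.contDiff_f.fderiv_right (by norm_num))
  have hf : ContDiffAt ℝ 2 D.f y := h.contDiff_f.of_le (by norm_num)
  have hV' := hV.endo h.chern.diff h.chern.parallel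
  have hW' := hW.endo h.chern.diff h.chern.parallel
  have X : ∀ {V W : ℝ → E}, Parallel2 D.Γ y τ V → Parallel2 D.Γ y τ W → _ :=
    fun hV hW ↦ jet2_fam h.contDiff_χ hΓ1 hf hV hW
  have U : ∀ {V W : ℝ → E}, Parallel2 D.Γ y τ V → Parallel2 D.Γ y τ W → _ :=
    fun hV hW ↦ jet2_form2 hU hΓ1 hV hW
  have R := ((((X hV hW').sub (X hV' hW)).add (U hW hV)).add (U hW' hV')).ofReal
  have S := ((((X hV hW).neg.sub (X hV' hW')).add (U hW' hV)).sub (U hW hV')).ofReal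
  have T := (R.add (S.const_mul Complex.I)).const_mul (1 / 4)
  refine (T.congr ?_).congr_jet ?_ ?_
  · filter_upwards [eventually_geod (a := τ) (Γ := D.Γ) h.chern.sq] with t ht
    rw [herm_form_eq ht, hermComb]
    ring
  · simp only [comp₁, hermComb, geod_zero]; ring
  · simp only [comp₂, hermComb, geod_zero]; ring

/-- The conjugate symmetry `herm_form_conj` holds at all points near y and is differentiated along
parallel fields. -/
lemma comp₁_conj (v w : E) :
    D.comp₁ y τ w v = (starRingEnd ℂ) (D.comp₁ y τ v w) := by
  have hΓ : DifferentiableAt ℝ D.Γ y := h.chern.smooth.differentiableAt (by simp)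
  have hv := parallel2_parField (a := τ) hΓ v
  have hw := parallel2_parField (a := τ) hΓ w
  have j1 := (h.jet2_comp τ hw hv).hasDerivAt
  have j2 := (h.jet2_comp τ hv hw).hasDerivAt
  simp only [parField_zero] at j1 j2
  have j3 : HasDerivAt (fun t ↦ (starRingEnd ℂ)
      (herm (D.J (geod D.Γ y τ t)) (D.form (geod D.Γ y τ t)) (parField D.Γ y τ v t)
        (parField D.Γ y τ w t))) ((starRingEnd ℂ) (D.comp₁ y τ v w)) 0 :=
    Complex.conjCLE.toContinuousLinearMap.hasFDerivAt.comp_hasDerivAt 0 j2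
  refine j1.unique (j3.congr_of_eventuallyEq ?_)
  have hf2 : ∀ᶠ z in 𝓝 y, ContDiffAt ℝ 4 D.f z := h.contDiff_f.eventually (by simp)
  filter_upwards [eventually_geod (a := τ) (Γ := D.Γ) h.chern.sq,
    eventually_geod (a := τ) (Γ := D.Γ) h.chern.torsion,
    eventually_geod (a := τ) (Γ := D.Γ) hf2,
    eventually_geod (a := τ) (Γ := D.Γ) h.alternating] with t h1 h2 h3 h4
  exact herm_form_conj h1 h2 (h3.of_le (by norm_num)) h4 _ _

/-- Since ∇G = 0 near y and J is parallel, the metric components of parallel fields are constant to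
second order. The determinant of the metric then drops out when the equation is differentiated. -/
lemma Solves.jet2_metric {V W : ℝ → E} (hV : Parallel2 D.Γ y τ V) (hW : Parallel2 D.Γ y τ W) :
    Jet2 (fun t ↦ herm (D.J (geod D.Γ y τ t)) (fun v w ↦ D.G (geod D.Γ y τ t) v w) (V t) (W t))
      0 0 := by
  have hΓ1 : ContDiffAt ℝ 1 D.Γ y := h.chern.smooth.of_le (by norm_num)
  have hV' := hV.endo h.chern.diff h.chern.parallel
  have hW' := hW.endo h.chern.diff h.chern.parallel
  have n2 : nab2 D.Γ D.G y = 0 := h.metric.self_of_nhds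
  have n3 : ∀ v w, nab3 D.Γ (nab2 D.Γ D.G) y τ τ v w = 0 := by
    intro v w
    have : fderiv ℝ (nab2 D.Γ D.G) y = 0 := by
      rw [Filter.EventuallyEq.fderiv_eq (f := fun _ ↦ 0) h.metric]; simp
    simp [nab3, this, n2]
  have X : ∀ {V W : ℝ → E}, Parallel2 D.Γ y τ V → Parallel2 D.Γ y τ W →
      Jet2 (fun t ↦ D.G (geod D.Γ y τ t) (V t) (W t)) 0 0 := fun hV hW ↦
    (jet2_form2 h.contDiff_G hΓ1 hV hW).congr_jet (by simp [n2]) (n3 _ _)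
  have R := ((X hV hW).add (X hV' hW')).ofReal
  have S := ((X hV hW').sub (X hV' hW)).ofReal
  have T := (R.add (S.const_mul Complex.I)).const_mul (1 / 4)
  refine (T.congr (.of_forall fun t ↦ ?_)).congr_jet ?_ ?_
  · simp only [herm]; ring
  · simp
  · simp

/-- The Monge-Ampère equation and its first two derivatives in the direction `τ`. -/
lemma Solves.equation_jet {e : Fin n → E} {l : Fin n → ℝ} (hl : ∀ j, l j ≠ 0)
    (hG : ∀ j k, herm (D.J y) (fun v w ↦ D.G y v w) (e j) (e k) = if j = k then 1 else 0)
    (hF : ∀ j k, herm (D.J y) (D.form y) (e j) (e k) = if j = k then (l j : ℂ) else 0) :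
    ∏ j, l j = D.ψ y (D.f y) ∧
    ∑ j, (D.comp₁ y τ (e j) (e j)).re / l j
      = famScalarDeriv D.ψ D.f y τ / D.ψ y (D.f y) ∧
    ∑ j, (D.comp₂ y τ (e j) (e j)).re / l j
      = famScalarDeriv₂ D.Γ D.ψ D.f y τ / D.ψ y (D.f y)
        - (famScalarDeriv D.ψ D.f y τ / D.ψ y (D.f y)) ^ 2
        + ∑ j, ∑ k, ‖D.comp₁ y τ (e j) (e k)‖ ^ 2 / (l j * l k) := by
  have hΓ : DifferentiableAt ℝ D.Γ y := h.chern.smooth.differentiableAt (by simp)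
  have hlc : ∀ j, (l j : ℂ) ≠ 0 := fun j ↦ by exact_mod_cast hl j
  have hpf := fun j ↦ parallel2_parField (a := τ) hΓ (e j)
  have dF := jet2_det (M := fun t ↦ Matrix.of fun j k ↦ herm (D.J (geod D.Γ y τ t))
    (D.form (geod D.Γ y τ t)) (parField D.Γ y τ (e j) t) (parField D.Γ y τ (e k) t))
    (d := fun j ↦ (l j : ℂ)) (M₁ := Matrix.of fun j k ↦ D.comp₁ y τ (e j) (e k))
    (M₂ := Matrix.of fun j k ↦ D.comp₂ y τ (e j) (e k)) hlc
    (by ext j k; simp [hF, Matrix.diagonal_apply])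
    (fun j k ↦ by simpa using h.jet2_comp τ (hpf j) (hpf k))
  have dG := jet2_det (M := fun t ↦ Matrix.of fun j k ↦ herm (D.J (geod D.Γ y τ t))
    (fun v w ↦ D.G (geod D.Γ y τ t) v w) (parField D.Γ y τ (e j) t) (parField D.Γ y τ (e k) t))
    (d := fun j ↦ 1) (M₁ := 0) (M₂ := 0) (by simp)
    (by ext j k; simp [hG, Matrix.one_apply])
    (fun j k ↦ by simpa using h.jet2_metric τ (hpf j) (hpf k))
  have dψ := (jet2_famScalar (Γ := D.Γ) (a := τ) h.contDiff_ψ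
    (h.contDiff_f.of_le (by norm_num))).ofReal
  have h0 : ∏ j, l j = D.ψ y (D.f y) := by
    have := h.equation.self_of_nhds e
    have e1 : (Matrix.of fun j k ↦ herm (D.J y) (D.form y) (e j) (e k))
        = Matrix.diagonal fun j ↦ (l j : ℂ) := by
      ext j k; simp [hF, Matrix.diagonal_apply]
    have e2 : (Matrix.of fun j k ↦ herm (D.J y) (fun v w ↦ D.G y v w) (e j) (e k)) = 1 := by
      ext j k; simp [hG, Matrix.one_apply]
    rw [e1, e2, Matrix.det_diagonal, Matrix.det_one, mul_one] at this
    exact_mod_cast this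
  have hψ : D.ψ y (D.f y) ≠ 0 := by
    rw [← h0]; exact Finset.prod_ne_zero_iff.2 fun j _ ↦ hl j
  have hψc : (D.ψ y (D.f y) : ℂ) ≠ 0 := by exact_mod_cast hψ
  have hP : ∏ j, (l j : ℂ) = (D.ψ y (D.f y) : ℂ) := by rw [← h0]; push_cast; rfl
  have hev := eventually_geod (a := τ) (Γ := D.Γ) h.equation
  -- Both sides of the equation are evaluated on the frame carried parallel along `geod`, and their
  -- 2-jets are equated.
  have key := (dF.congr (hev.mono fun t ht ↦ (ht _).symm)).unique (dψ.mul dG)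
  simp only [Matrix.of_apply, hP, Finset.prod_const_one, Matrix.zero_apply, zero_div, mul_zero,
    Finset.sum_const_zero, geod_zero, one_mul] at key
  obtain ⟨k1, k2⟩ := key
  have hdG : (Matrix.of fun j k ↦ herm (D.J y) (fun v w ↦ D.G y v w) (e j) (e k)).det = 1 := by
    have e2 : (Matrix.of fun j k ↦ herm (D.J y) (fun v w ↦ D.G y v w) (e j) (e k)) = 1 := by
      ext j k; simp [hG, Matrix.one_apply]
    rw [e2, Matrix.det_one]
  simp only [parField_zero, hdG, mul_one, mul_zero, add_zero, ne_eq, OfNat.ofNat_ne_zero,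
    not_false_eq_true, zero_pow, sub_zero] at k1 k2
  have s1 : ∑ j, D.comp₁ y τ (e j) (e j) / (l j : ℂ)
      = ((famScalarDeriv D.ψ D.f y τ / D.ψ y (D.f y) : ℝ) : ℂ) := by
    push_cast
    rw [eq_div_iff hψc, mul_comm, k1]
  have s2 : ∑ j, D.comp₂ y τ (e j) (e j) / (l j : ℂ)
      = ((famScalarDeriv₂ D.Γ D.ψ D.f y τ / D.ψ y (D.f y)
        - (famScalarDeriv D.ψ D.f y τ / D.ψ y (D.f y)) ^ 2
        + ∑ j, ∑ k, ‖D.comp₁ y τ (e j) (e k)‖ ^ 2 / (l j * l k) : ℝ) : ℂ) := by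
    -- Conjugate symmetry turns the products in the second derivative of the determinant into
    -- squared absolute values: this is the concavity of log det.
    have s3 : ∀ j k, D.comp₁ y τ (e j) (e k) * D.comp₁ y τ (e k) (e j) / ((l j : ℂ) * l k)
        = ((‖D.comp₁ y τ (e j) (e k)‖ ^ 2 / (l j * l k) : ℝ) : ℂ) := by
      intro j k
      rw [comp₁_conj h τ (e j) (e k), Complex.mul_conj, Complex.normSq_eq_norm_sq]
      push_cast; ring
    simp only [s1, s3] at k2
    have : (famScalarDeriv₂ D.Γ D.ψ D.f y τ : ℂ) / D.ψ y (D.f y) = (((famScalarDeriv D.ψ D.f y τ / D.ψ y (D.f y) : ℝ) : ℂ)) ^ 2 -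
        (∑ j, ∑ k, ((‖D.comp₁ y τ (e j) (e k)‖ ^ 2 / (l j * l k) : ℝ) : ℂ))
        + ∑ j, D.comp₂ y τ (e j) (e j) / (l j : ℂ) := by
      rw [div_eq_iff hψc, mul_comm, k2]
    push_cast at this ⊢
    linear_combination -this
  refine ⟨h0, ?_, ?_⟩
  · have := congrArg Complex.re s1
    simpa [Complex.div_ofReal_re] using this
  · have := congrArg Complex.re s2
    rw [Complex.ofReal_re] at this
    simpa [Complex.div_ofReal_re] using this

end MAData

end

end Chart

/-! ### Pointwise bounds on the geometry, the data and the Hessian -/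

namespace Chart

noncomputable section

variable {E : Type*} [NormedAddCommGroup E] [NormedSpace ℝ E]

namespace MAData

/-- The length of `v` at `y` with respect to the metric `G`. -/
def len (D : MAData E) (y v : E) : ℝ := √(D.G y v v)

/-- The bounds on the geometry, on the data and on `f` at the point `y`. -/
structure Bounded (D : MAData E) (n : ℕ) (a b δ κ Λ : ℝ) (y : E) : Prop where
  symm : ∀ v w, D.G y v w = D.G y w v
  pos : ∀ v, v ≠ 0 → 0 < D.G y v v
  isometry : ∀ v w, D.G y (D.J y v) (D.J y w) = D.G y v w
  df : ∀ v, |fderiv ℝ D.f y v| ≤ a * D.len y v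
  tor : ∀ v w z, |D.G y (tor D.Γ y v w) z| ≤ κ * (D.len y v * D.len y w * D.len y z)
  nabTor : ∀ u v w z, |D.G y (nabTor D.Γ y u v w) z|
    ≤ κ * (D.len y u * D.len y v * D.len y w * D.len y z)
  curv : ∀ u v w z, |D.G y (curv D.Γ y u v w) z|
    ≤ κ * (D.len y u * D.len y v * D.len y w * D.len y z)
  nabCurv : ∀ p u v w z, |D.G y (nabCurv D.Γ y p u v w) z|
    ≤ κ * (D.len y p * D.len y u * D.len y v * D.len y w * D.len y z)
  χ₀₀ : ∀ v w, |D.χ y (D.f y) v w| ≤ Λ * (D.len y v * D.len y w)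
  χ₁₀ : ∀ u v w, |nab2 D.Γ (fun z ↦ D.χ z (D.f y)) y u v w|
    ≤ Λ * (D.len y u * D.len y v * D.len y w)
  χ₂₀ : ∀ p u v w, |nab3 D.Γ (nab2 D.Γ fun z ↦ D.χ z (D.f y)) y p u v w|
    ≤ Λ * (D.len y p * D.len y u * D.len y v * D.len y w)
  χ₀₁ : ∀ v w, |deriv (D.χ y) (D.f y) v w| ≤ Λ * (D.len y v * D.len y w)
  χ₁₁ : ∀ u v w, |nab2 D.Γ (fun z ↦ deriv (D.χ z) (D.f y)) y u v w|
    ≤ Λ * (D.len y u * D.len y v * D.len y w)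
  χ₀₂ : ∀ v w, |iteratedDeriv 2 (D.χ y) (D.f y) v w| ≤ Λ * (D.len y v * D.len y w)
  ψ₁₀ : ∀ u, |fderiv ℝ (fun z ↦ D.ψ z (D.f y)) y u| ≤ Λ * D.len y u
  ψ₂₀ : ∀ p u, |nab1 D.Γ (fderiv ℝ fun z ↦ D.ψ z (D.f y)) y p u| ≤ Λ * (D.len y p * D.len y u)
  ψ₀₁ : |deriv (D.ψ y) (D.f y)| ≤ Λ
  ψ₁₁ : ∀ u, |fderiv ℝ (fun z ↦ deriv (D.ψ z) (D.f y)) y u| ≤ Λ * D.len y u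
  ψ₀₂ : |iteratedDeriv 2 (D.ψ y) (D.f y)| ≤ Λ
  le_ψ : δ ≤ D.ψ y (D.f y)
  admissible : ∀ v, v ≠ 0 → 0 < (herm (D.J y) (D.form y) v v).re
  laplacian : ∀ e : Fin n → E,
    (∀ j k, herm (D.J y) (fun v w ↦ D.G y v w) (e j) (e k) = if j = k then 1 else 0) →
    ∑ j, (herm (D.J y) (fun v w ↦ nab1 D.Γ (fderiv ℝ D.f) y w v) (e j) (e j)).re ≤ b

namespace Bounded

variable {D : MAData E} {n : ℕ} {a b δ κ Λ : ℝ} {y : E}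

lemma len_nonneg (v : E) : 0 ≤ D.len y v := Real.sqrt_nonneg _

section

variable (hb : D.Bounded n a b δ κ Λ y)
include hb

lemma G_nonneg (v : E) : 0 ≤ D.G y v v := by
  by_cases hv : v = 0
  · simp [hv]
  · exact (hb.pos v hv).le

lemma len_sq (v : E) : D.len y v ^ 2 = D.G y v v := Real.sq_sqrt (hb.G_nonneg v)

lemma len_J (v : E) : D.len y (D.J y v) = D.len y v := by
  rw [len, hb.isometry, len]

/-- Take z = t and divide by the length of t. Bounds on the covariant tensors g(T(·,·),·) and
g(R(·,·)·,·) thus become bounds on lengths of vectors. -/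
lemma len_le_of_forall {t : E} {c : ℝ} (hc : 0 ≤ c) (h : ∀ z, |D.G y t z| ≤ c * D.len y z) :
    D.len y t ≤ c := by
  rcases (len_nonneg (D := D) (y := y) t).eq_or_lt with h0 | h0
  · rw [← h0]; exact hc
  · have h1 := (le_abs_self _).trans (h t)
    rw [← hb.len_sq, sq] at h1
    exact le_of_mul_le_mul_right h1 h0

lemma df_le (ha : 0 ≤ a) {v : E} {r : ℝ} (hv : D.len y v ≤ r) : |fderiv ℝ D.f y v| ≤ a * r :=
  (hb.df v).trans (by gcongr)

lemma len_tor_le (hκ : 0 ≤ κ) {v w : E} {r s : ℝ} (hv : D.len y v ≤ r) (hw : D.len y w ≤ s) :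
    D.len y (Chart.tor D.Γ y v w) ≤ κ * (r * s) := by
  have := len_nonneg (D := D) (y := y)
  have hr := (this v).trans hv
  have hs := (this w).trans hw
  refine hb.len_le_of_forall (by positivity) fun z ↦ (hb.tor v w z).trans ?_
  have hz := this z
  have hw0 := this w
  rw [mul_assoc κ]
  gcongr

lemma len_nabTor_le (hκ : 0 ≤ κ) {u v w : E} {q r s : ℝ} (hu : D.len y u ≤ q)
    (hv : D.len y v ≤ r) (hw : D.len y w ≤ s) :
    D.len y (Chart.nabTor D.Γ y u v w) ≤ κ * (q * r * s) := by
  have := len_nonneg (D := D) (y := y)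
  have hq := (this u).trans hu
  have hr := (this v).trans hv
  have hs := (this w).trans hw
  refine hb.len_le_of_forall (by positivity) fun z ↦ (hb.nabTor u v w z).trans ?_
  have hz := this z
  have hw0 := this w
  have hv0 := this v
  rw [mul_assoc κ]
  gcongr

lemma len_curv_le (hκ : 0 ≤ κ) {u v w : E} {q r s : ℝ} (hu : D.len y u ≤ q)
    (hv : D.len y v ≤ r) (hw : D.len y w ≤ s) :
    D.len y (Chart.curv D.Γ y u v w) ≤ κ * (q * r * s) := by
  have := len_nonneg (D := D) (y := y)
  have hq := (this u).trans hu
  have hr := (this v).trans hv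
  have hs := (this w).trans hw
  refine hb.len_le_of_forall (by positivity) fun z ↦ (hb.curv u v w z).trans ?_
  have hz := this z
  have hw0 := this w
  have hv0 := this v
  rw [mul_assoc κ]
  gcongr

lemma len_nabCurv_le (hκ : 0 ≤ κ) {p u v w : E} {o q r s : ℝ} (hp : D.len y p ≤ o)
    (hu : D.len y u ≤ q) (hv : D.len y v ≤ r) (hw : D.len y w ≤ s) :
    D.len y (Chart.nabCurv D.Γ y p u v w) ≤ κ * (o * q * r * s) := by
  have := len_nonneg (D := D) (y := y)
  have ho := (this p).trans hp
  have hq := (this u).trans hu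
  have hr := (this v).trans hv
  have hs := (this w).trans hw
  refine hb.len_le_of_forall (by positivity) fun z ↦ (hb.nabCurv p u v w z).trans ?_
  have hz := this z
  have hw0 := this w
  have hv0 := this v
  have hu0 := this u
  rw [mul_assoc κ]
  gcongr

/-- A bound on the diagonal of a bilinear form bounds its symmetric part. -/
lemma polarize {B : E → E → ℝ} (hadd : ∀ u v w, B (u + v) w = B u w + B v w)
    (hadd' : ∀ u v w, B u (v + w) = B u v + B u w) (hsm : ∀ (r : ℝ) v w, B (r • v) w = r * B v w)
    (hsm' : ∀ (r : ℝ) v w, B v (r • w) = r * B v w) {K : ℝ}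
    (hB : ∀ v, |B v v| ≤ K * D.G y v v) (v w : E) :
    |B v w + B w v| ≤ 2 * K * (D.len y v * D.len y w) := by
  have z0 : ∀ v, B 0 v = 0 := fun v ↦ by simpa using hsm 0 0 v
  have z0' : ∀ v, B v 0 = 0 := fun v ↦ by simpa using hsm' 0 v 0
  by_cases hv : v = 0
  · simp [hv, z0, z0', len]
  by_cases hw : w = 0
  · simp [hw, z0, z0', len]
  have pv : 0 < D.len y v := Real.sqrt_pos.2 (hb.pos v hv)
  have pw : 0 < D.len y w := Real.sqrt_pos.2 (hb.pos w hw)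
  have sv := hb.len_sq v
  have sw := hb.len_sq w
  set r := D.len y v
  set s := D.len y w
  -- The vectors s·v and r·w have the same length rs. The diagonal values at their sum and
  -- difference differ by 2rs (B v w + B w v), and the parallelogram law bounds this by 4K(rs)².
  have h1 := hB (s • v + r • w)
  have h2 := hB (s • v + (-r) • w)
  simp only [hadd, hadd', hsm, hsm', map_add, map_smul, _root_.add_apply, _root_.smul_apply,
    smul_eq_mul, hb.symm w v, ← sv, ← sw] at h1 h2
  rw [abs_le] at h1 h2 ⊢
  have hrs : 0 < 2 * (r * s) := by positivity
  constructor
  · refine le_of_mul_le_mul_left ?_ hrs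
    linarith [h1.1, h2.2]
  · refine le_of_mul_le_mul_left ?_ hrs
    linarith [h1.2, h2.1]

/-- The whole Hessian is bounded by its largest eigenvalue. -/
lemma abs_hess_le (h : D.Solves n y) (ha : 0 ≤ a) (hκ : 0 ≤ κ) {m : ℝ}
    (hm : ∀ v, nab1 D.Γ (fderiv ℝ D.f) y v v ≤ m * D.G y v v) (hΛ : 0 ≤ Λ) (v w : E) :
    |nab1 D.Γ (fderiv ℝ D.f) y v w| ≤ (m + 2 * Λ + a * κ) * (D.len y v * D.len y w) := by
  have hJ := h.chern.sq.self_of_nhds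
  have low : ∀ v, |nab1 D.Γ (fderiv ℝ D.f) y v v| ≤ (m + 2 * Λ) * D.G y v v := by
    intro v
    have hG := hb.G_nonneg v
    rw [abs_le]
    refine ⟨?_, (hm v).trans (by gcongr; linarith)⟩
    by_cases hv : v = 0
    · simp [hv]
    -- Admissibility bounds ∇²f(v,v) + ∇²f(Jv,Jv) from below by -2Λ|v|², and the second summand is
    -- at most m|v|².
    have h1 := hb.admissible v hv
    simp only [herm_re, form, hJ, map_neg] at h1
    have h2 := hm (D.J y v)
    rw [hb.isometry] at h2
    have h3 := (abs_le.1 (hb.χ₀₀ v (D.J y v))).2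
    have h4 := (abs_le.1 (hb.χ₀₀ (D.J y v) v)).1
    rw [hb.len_J, ← sq, hb.len_sq] at h3 h4
    nlinarith
  have h1 := hb.polarize (B := fun v w ↦ nab1 D.Γ (fderiv ℝ D.f) y v w) (by simp) (by simp)
    (by simp) (by simp) low v w
  -- The antisymmetric part of the Hessian is a torsion term, which accounts for aκ.
  have h2 := nab1_fderiv_comm (Γ := D.Γ) (h.contDiff_f.of_le (by norm_num) : ContDiffAt ℝ 2 D.f y)
    v w
  have h3 := hb.df_le ha (hb.len_tor_le hκ le_rfl le_rfl : D.len y (Chart.tor D.Γ y v w) ≤ _)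
  have h4 : 0 ≤ D.len y v * D.len y w := mul_nonneg (len_nonneg v) (len_nonneg w)
  have h5 : 0 ≤ a * κ * (D.len y v * D.len y w) := by positivity
  rw [abs_le] at h1 h3 ⊢
  constructor <;> nlinarith [h1.1, h1.2, h3.1, h3.2]

end

end Bounded

end MAData

end

end Chart

/-! ### Bounds on the derivatives of the data and on the commutators -/

namespace Chart

noncomputable section

lemma hermComb_re {E : Type*} (χ U : E → E → ℝ) (v v' w w' : E) :
    (hermComb χ U v v' w w').re = (χ v w' - χ v' w + U w v + U w' v') / 4 := by
  have : hermComb χ U v v' w w' = ⟨(χ v w' - χ v' w + U w v + U w' v') / 4,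
      (- χ v w - χ v' w' + U w' v - U w v') / 4⟩ := by
    apply Complex.ext <;> simp [hermComb]
  rw [this]

lemma hermComb_im {E : Type*} (χ U : E → E → ℝ) (v v' w w' : E) :
    (hermComb χ U v v' w w').im = (- χ v w - χ v' w' + U w' v - U w v') / 4 := by
  simp [hermComb]

variable {E : Type*} [NormedAddCommGroup E] [NormedSpace ℝ E]

namespace MAData

namespace Bounded

variable {D : MAData E} {n : ℕ} {a b δ κ Λ K : ℝ} {y e τ : E}
  (hb : D.Bounded n a b δ κ Λ y)
include hb

lemma abs_famDeriv_le (hτ : D.len y τ = 1) (v w : E) :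
    |famDeriv D.Γ D.χ D.f y τ v w| ≤ Λ * (1 + a) * (D.len y v * D.len y w) := by
  have h1 := hb.χ₁₀ τ v w
  have h2 := hb.χ₀₁ v w
  have h3 := hb.df τ
  rw [hτ] at h1 h3
  calc |famDeriv D.Γ D.χ D.f y τ v w|
      ≤ Λ * (1 * D.len y v * D.len y w) + a * 1 * (Λ * (D.len y v * D.len y w)) := by
        refine (abs_add_le _ _).trans (add_le_add h1 ?_)
        rw [abs_mul]
        exact mul_le_mul h3 h2 (abs_nonneg _) ((abs_nonneg _).trans h3)
    _ = _ := by ring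

lemma abs_famDeriv₂_le (hτ : D.len y τ = 1) (v w : E) :
    |famDeriv₂ D.Γ D.χ D.f y τ v w|
      ≤ Λ * (1 + 2 * a + a ^ 2 + |nab1 D.Γ (fderiv ℝ D.f) y τ τ|) * (D.len y v * D.len y w) := by
  have h1 := hb.χ₂₀ τ τ v w
  have h2 := hb.χ₁₁ τ v w
  have h3 := hb.χ₀₂ v w
  have h4 := hb.χ₀₁ v w
  have h5 := hb.df τ
  rw [hτ] at h1 h2 h5
  have ha : 0 ≤ a := by simpa using (abs_nonneg _).trans h5
  have h6 : |fderiv ℝ D.f y τ ^ 2| ≤ (a * 1) ^ 2 := by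
    rw [abs_pow]; gcongr
  calc |famDeriv₂ D.Γ D.χ D.f y τ v w|
      ≤ Λ * (1 * 1 * D.len y v * D.len y w) + 2 * (a * 1) * (Λ * (1 * D.len y v * D.len y w))
        + (a * 1) ^ 2 * (Λ * (D.len y v * D.len y w))
        + |nab1 D.Γ (fderiv ℝ D.f) y τ τ| * (Λ * (D.len y v * D.len y w)) := by
        refine (abs_add_le _ _).trans (add_le_add ((abs_add_le _ _).trans (add_le_add
          ((abs_add_le _ _).trans (add_le_add h1 ?_)) ?_)) ?_)
        · rw [abs_mul, abs_mul, abs_two]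
          exact mul_le_mul (by gcongr) h2 (abs_nonneg _) (by positivity)
        · rw [abs_mul]
          exact mul_le_mul h6 h3 (abs_nonneg _) (by positivity)
        · rw [abs_mul]
          exact mul_le_mul_of_nonneg_left h4 (abs_nonneg _)
    _ = _ := by ring

lemma abs_famScalarDeriv_le (hτ : D.len y τ = 1) :
    |famScalarDeriv D.ψ D.f y τ| ≤ Λ * (1 + a) := by
  have h1 := hb.ψ₁₀ τ
  have h2 := hb.ψ₀₁
  have h3 := hb.df τ
  rw [hτ] at h1 h3
  calc |famScalarDeriv D.ψ D.f y τ| ≤ Λ * 1 + a * 1 * Λ := by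
        refine (abs_add_le _ _).trans (add_le_add h1 ?_)
        rw [abs_mul]
        exact mul_le_mul h3 h2 (abs_nonneg _) ((abs_nonneg _).trans h3)
    _ = _ := by ring

lemma abs_famScalarDeriv₂_le (hτ : D.len y τ = 1) :
    |famScalarDeriv₂ D.Γ D.ψ D.f y τ|
      ≤ Λ * (1 + 2 * a + a ^ 2 + |nab1 D.Γ (fderiv ℝ D.f) y τ τ|) := by
  have h1 := hb.ψ₂₀ τ τ
  have h2 := hb.ψ₁₁ τ
  have h3 := hb.ψ₀₂
  have h4 := hb.ψ₀₁
  have h5 := hb.df τ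
  rw [hτ] at h1 h2 h5
  have ha : 0 ≤ a := by simpa using (abs_nonneg _).trans h5
  have h6 : |fderiv ℝ D.f y τ ^ 2| ≤ (a * 1) ^ 2 := by
    rw [abs_pow]; gcongr
  calc |famScalarDeriv₂ D.Γ D.ψ D.f y τ|
      ≤ Λ * (1 * 1) + 2 * (a * 1) * (Λ * 1) + (a * 1) ^ 2 * Λ
        + |nab1 D.Γ (fderiv ℝ D.f) y τ τ| * Λ := by
        refine (abs_add_le _ _).trans (add_le_add ((abs_add_le _ _).trans (add_le_add
          ((abs_add_le _ _).trans (add_le_add h1 ?_)) ?_)) ?_)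
        · rw [abs_mul, abs_mul, abs_two]
          exact mul_le_mul (by gcongr) h2 (abs_nonneg _) (by positivity)
        · rw [abs_mul]
          exact mul_le_mul h6 h3 (abs_nonneg _) (by positivity)
        · rw [abs_mul]
          exact mul_le_mul_of_nonneg_left h4 (abs_nonneg _)
    _ = _ := by ring

/-- Unitary frames diagonalizing the components `χ_{jk̄} + f_{jk̄}`. -/
lemma exists_frame [FiniteDimensional ℝ E] (hdim : Module.finrank ℝ E = 2 * n)
    (h : D.Solves n y) :
    ∃ (e : Fin n → E) (l : Fin n → ℝ),
      (∀ j k, herm (D.J y) (fun v w ↦ D.G y v w) (e j) (e k) = if j = k then 1 else 0) ∧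
      (∀ j k, herm (D.J y) (D.form y) (e j) (e k) = if j = k then (l j : ℂ) else 0) ∧
      ∀ v, v = ∑ k, ((D.G y v (e k) / 2) • e k + (D.G y v (D.J y (e k)) / 2) • D.J y (e k)) := by
  have hJ := h.chern.sq.self_of_nhds
  refine exists_unitary_frame (D.J y).toLinearMap
    (LinearMap.mk₂ ℝ (D.form y) ?_ ?_ ?_ ?_) hdim hJ
    (LinearMap.mk₂ ℝ (fun v w ↦ D.G y v w) (by simp) (by simp) (by simp) (by simp))
    hb.symm hb.pos hb.isometry
    (herm_form_conj hJ h.chern.torsion.self_of_nhds (h.contDiff_f.of_le (by norm_num))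
      h.alternating.self_of_nhds) <;> intros <;> simp only [form, map_add, map_smul,
        _root_.add_apply, _root_.smul_apply, smul_eq_mul] <;> ring

variable (hU : ∀ v w, |nab1 D.Γ (fderiv ℝ D.f) y v w| ≤ K * (D.len y v * D.len y w))
  (hK : 0 ≤ K) (ha : 0 ≤ a) (hκ : 0 ≤ κ)

omit hb in
include hU hK in
lemma abs_hess_le_of_le {v w : E} {r s : ℝ} (hv : D.len y v ≤ r) (hw : D.len y w ≤ s) :
    |nab1 D.Γ (fderiv ℝ D.f) y v w| ≤ K * (r * s) := by
  have h0 := len_nonneg (D := D) (y := y) v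
  have h1 := len_nonneg (D := D) (y := y) w
  refine (hU v w).trans ?_
  have := h0.trans hv
  gcongr

include hU hK ha hκ

/-- Each term is ∇²f or df applied to vectors built from T, R, ∇T, ∇R, with at most two such
factors. The constants are crude counts from |e| ≤ 2 and |τ| ≤ 1. -/
lemma abs_traceError_le (he : D.len y e ≤ 2) (hτ : D.len y τ ≤ 1) :
    |traceError D.Γ D.f y e τ|
      ≤ 64 * K * κ + 16 * a * κ + 64 * K * κ ^ 2 + 64 * a * κ ^ 2 := by
  have U := @abs_hess_le_of_le E _ _ D K y hU hK
  have ht := hb.len_tor_le hκ he hτ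
  have t1 := U (hb.len_nabTor_le hκ he he hτ) hτ
  have t2 := U he (hb.len_curv_le hκ he hτ hτ)
  have t3 := hb.df_le ha (hb.len_nabCurv_le hκ he he hτ hτ)
  have t4 := U (hb.len_curv_le hκ he hτ he) hτ
  have t5 := U he (hb.len_tor_le hκ ht hτ)
  have t6 := hb.df_le ha (hb.len_nabTor_le hκ he ht hτ)
  have t7 := U ht ht
  have t8 := hb.df_le ha (hb.len_curv_le hκ he hτ ht)
  have t9 := hb.df_le ha (hb.len_nabTor_le hκ ht he hτ)
  have t10 := U (hb.len_tor_le hκ ht hτ) he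
  have t11 := hb.df_le ha (hb.len_curv_le hκ ht hτ he)
  have p1 : 0 ≤ K * κ := by positivity
  have p2 : 0 ≤ a * κ := by positivity
  have p3 : 0 ≤ K * κ ^ 2 := by positivity
  have p4 : 0 ≤ a * κ ^ 2 := by positivity
  rw [abs_le] at *
  simp only [traceError]
  constructor <;> linarith [t1.1, t1.2, t2.1, t2.2, t3.1, t3.2, t4.1, t4.2, t5.1, t5.2, t6.1, t6.2,
    t7.1, t7.2, t8.1, t8.2, t9.1, t9.2, t10.1, t10.2, t11.1, t11.2]

/-- 4 Re `comp₁`(e, e) is ∇³f(τ,e,e) + ∇³f(τ,Je,Je) plus derivatives of χ, so after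
`trace_nab2_hess` no third derivative of f is left. -/
lemma abs_trace₃_sub_le (h : D.Solves n y) (he : D.len y e ≤ 2) (hτ : D.len y τ = 1)
    (hΛ : 0 ≤ Λ) :
    |(nab2 D.Γ (nab1 D.Γ (fderiv ℝ D.f)) y e e τ
        + nab2 D.Γ (nab1 D.Γ (fderiv ℝ D.f)) y (D.J y e) (D.J y e) τ)
      - 4 * (D.comp₁ y τ e e).re| ≤ 8 * (Λ * (1 + a)) + 32 * K * κ + 40 * a * κ := by
  rw [trace_nab2_hess h.chern (h.contDiff_f.of_le (by norm_num))]
  have U := @abs_hess_le_of_le E _ _ D K y hU hK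
  have he' : D.len y (D.J y e) ≤ 2 := by rwa [hb.len_J]
  have hτ1 := hτ.le
  have hτ' : D.len y (D.J y τ) ≤ 1 := by rw [hb.len_J, hτ]
  have ht := hb.len_tor_le hκ he hτ1
  have t1 := U ht he
  have t2 := U ((hb.len_J _).le.trans ht) he'
  have t3 := hb.df_le ha (hb.len_curv_le hκ he hτ1 he)
  have t4 := hb.df_le ha (hb.len_curv_le hκ he hτ' he')
  have t5 := hb.df_le ha (hb.len_curv_le hκ he' hτ1 he')
  have t6 := hb.df_le ha (hb.len_curv_le hκ he' hτ' he)
  have t7 := hb.df_le ha (hb.len_curv_le hκ he he' hτ')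
  have hll : D.len y e * D.len y e ≤ 2 * 2 := by
    have := len_nonneg (D := D) (y := y) e
    gcongr
  have hc : 0 ≤ Λ * (1 + a) := by positivity
  have t8 := (hb.abs_famDeriv_le hτ e (D.J y e)).trans (mul_le_mul_of_nonneg_left
    ((congrArg _ (hb.len_J e)).le.trans hll) hc)
  have t9 := (hb.abs_famDeriv_le hτ (D.J y e) e).trans (mul_le_mul_of_nonneg_left
    ((congrArg (· * _) (hb.len_J e)).le.trans hll) hc)
  have p1 : 0 ≤ K * κ := by positivity
  have p2 : 0 ≤ a * κ := by positivity
  have hre : 4 * (D.comp₁ y τ e e).re = famDeriv D.Γ D.χ D.f y τ e (D.J y e)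
      - famDeriv D.Γ D.χ D.f y τ (D.J y e) e + nab2 D.Γ (nab1 D.Γ (fderiv ℝ D.f)) y τ e e
      + nab2 D.Γ (nab1 D.Γ (fderiv ℝ D.f)) y τ (D.J y e) (D.J y e) := by
    rw [comp₁, hermComb_re]; ring
  rw [hre]
  simp only [curvTrace, map_add, map_sub]
  rw [abs_le] at *
  constructor <;> linarith [t1.1, t1.2, t2.1, t2.2, t3.1, t3.2, t4.1, t4.2, t5.1, t5.2, t6.1, t6.2,
    t7.1, t7.2, t8.1, t8.2, t9.1, t9.2]

/-- The mixed third derivatives left by `trace_hess_comm` have no a priori bound. They stay in the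
estimate and are absorbed in `sum_estimate`. -/
lemma abs_trace₄_sub_le (h : D.Solves n y) (he : D.len y e ≤ 2) (hτ : D.len y τ = 1)
    (hΛ : 0 ≤ Λ) :
    |(nab3 D.Γ (nab2 D.Γ (nab1 D.Γ (fderiv ℝ D.f))) y e e τ τ
        + nab3 D.Γ (nab2 D.Γ (nab1 D.Γ (fderiv ℝ D.f))) y (D.J y e) (D.J y e) τ τ)
      - 4 * (D.comp₂ y τ e e).re|
      ≤ 4 * |nab2 D.Γ (nab1 D.Γ (fderiv ℝ D.f)) y τ e (Chart.tor D.Γ y e τ)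
          + nab2 D.Γ (nab1 D.Γ (fderiv ℝ D.f)) y τ (D.J y e) (D.J y (Chart.tor D.Γ y e τ))|
        + (8 * (Λ * (1 + 2 * a + a ^ 2 + |nab1 D.Γ (fderiv ℝ D.f) y τ τ|)) + 272 * K * κ
          + 112 * a * κ + 128 * K * κ ^ 2 + 128 * a * κ ^ 2) := by
  rw [trace_hess_comm h.chern h.contDiff_f]
  have U := @abs_hess_le_of_le E _ _ D K y hU hK
  have he' : D.len y (D.J y e) ≤ 2 := by rwa [hb.len_J]
  have hτ1 := hτ.le
  have hτ' : D.len y (D.J y τ) ≤ 1 := by rw [hb.len_J, hτ]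
  have hn := hb.len_nabTor_le hκ hτ1 he hτ1
  have t1 := U hn he
  have t2 := U ((hb.len_J _).le.trans hn) he'
  have t3 := U hτ1 (hb.len_curv_le hκ he hτ1 he)
  have t4 := U hτ1 (hb.len_curv_le hκ he hτ' he')
  have t5 := U hτ1 (hb.len_curv_le hκ he' hτ1 he')
  have t6 := U hτ1 (hb.len_curv_le hκ he' hτ' he)
  have t7 := U hτ1 (hb.len_curv_le hκ he he' hτ')
  have s3 := hb.df_le ha (hb.len_nabCurv_le hκ hτ1 he hτ1 he)
  have s4 := hb.df_le ha (hb.len_nabCurv_le hκ hτ1 he hτ' he')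
  have s5 := hb.df_le ha (hb.len_nabCurv_le hκ hτ1 he' hτ1 he')
  have s6 := hb.df_le ha (hb.len_nabCurv_le hκ hτ1 he' hτ' he)
  have s7 := hb.df_le ha (hb.len_nabCurv_le hκ hτ1 he he' hτ')
  have e1 := hb.abs_traceError_le hU hK ha hκ he hτ1
  have e2 := hb.abs_traceError_le hU hK ha hκ he' hτ1
  have hll : D.len y e * D.len y e ≤ 2 * 2 := by
    have := len_nonneg (D := D) (y := y) e
    gcongr
  have hc : 0 ≤ Λ * (1 + 2 * a + a ^ 2 + |nab1 D.Γ (fderiv ℝ D.f) y τ τ|) := by positivity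
  have t8 := (hb.abs_famDeriv₂_le hτ e (D.J y e)).trans (mul_le_mul_of_nonneg_left
    ((congrArg _ (hb.len_J e)).le.trans hll) hc)
  have t9 := (hb.abs_famDeriv₂_le hτ (D.J y e) e).trans (mul_le_mul_of_nonneg_left
    ((congrArg (· * _) (hb.len_J e)).le.trans hll) hc)
  have p1 : 0 ≤ K * κ := by positivity
  have p2 : 0 ≤ a * κ := by positivity
  have hre : 4 * (D.comp₂ y τ e e).re = famDeriv₂ D.Γ D.χ D.f y τ e (D.J y e)
      - famDeriv₂ D.Γ D.χ D.f y τ (D.J y e) e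
      + nab3 D.Γ (nab2 D.Γ (nab1 D.Γ (fderiv ℝ D.f))) y τ τ e e
      + nab3 D.Γ (nab2 D.Γ (nab1 D.Γ (fderiv ℝ D.f))) y τ τ (D.J y e) (D.J y e) := by
    rw [comp₂, hermComb_re]; ring
  rw [hre]
  have t0 := abs_le.1 (le_refl |nab2 D.Γ (nab1 D.Γ (fderiv ℝ D.f)) y τ e (Chart.tor D.Γ y e τ)
    + nab2 D.Γ (nab1 D.Γ (fderiv ℝ D.f)) y τ (D.J y e) (D.J y (Chart.tor D.Γ y e τ))|)
  simp only [curvTrace, nabCurvTrace, map_add, map_sub]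
  rw [abs_le] at t1 t2 t3 t4 t5 t6 t7 t8 t9 s3 s4 s5 s6 s7 e1 e2 ⊢
  constructor <;> linarith [t0.1, t0.2, t1.1, t1.2, t2.1, t2.2, t3.1, t3.2, t4.1, t4.2, t5.1, t5.2,
    t6.1, t6.2, t7.1, t7.2, t8.1, t8.2, t9.1, t9.2, s3.1, s3.2, s4.1, s4.2, s5.1, s5.2, s6.1, s6.2,
    s7.1, s7.2, e1.1, e1.2, e2.1, e2.2]

end Bounded

end MAData

end

end Chart

/-! ### The estimate at an interior maximum -/

namespace Chart

noncomputable section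

variable {E : Type*} [NormedAddCommGroup E] [NormedSpace ℝ E]

/-- The bound on the largest eigenvalue of the Hessian at a maximum point of the test function. -/
def hessBound (n : ℕ) (a b δ κ Λ : ℝ) : ℝ :=
  -- Here b + 2nΛ bounds the eigenvalues and (b + 2nΛ)^(n-1)/δ their inverses. The second entry is
  -- the right side of `sum_estimate` with one factor u_ττ taken out; the entry 1 covers the case
  -- u_ττ ≤ 1.
  max 1 ((b + 2 * n * Λ) / 4 *
    (4 * (Λ * (2 + 2 * a + a ^ 2) / δ + (Λ * (1 + a) / δ) ^ 2)
      + n * ((b + 2 * n * Λ) ^ (n - 1) / δ) * (8 * (Λ * (2 + 2 * a + a ^ 2))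
        + 272 * (1 + a ^ 2 + 2 * Λ + a * κ) * κ + 112 * a * κ
        + 128 * (1 + a ^ 2 + 2 * Λ + a * κ) * κ ^ 2 + 128 * a * κ ^ 2)
      + 8 * a * (Λ * (1 + a) / δ)
      + 2 * a * n * ((b + 2 * n * Λ) ^ (n - 1) / δ) * (8 * (Λ * (1 + a))
        + 32 * (1 + a ^ 2 + 2 * Λ + a * κ) * κ + 40 * a * κ)
      + 32 * (2 * κ) * (2 * (Λ * (1 + a))) * n ^ 2 * ((b + 2 * n * Λ) ^ (n - 1) / δ)
      + 64 * (2 * κ) ^ 2 * n ^ 2 * (b + 2 * n * Λ) * ((b + 2 * n * Λ) ^ (n - 1) / δ)))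

namespace MAData

variable {D : MAData E} {n : ℕ} {a b δ κ Λ m : ℝ} {y τ : E}

/-- The second order condition at a maximum of `∇²f(τ, τ) + (τ f)²`, in the direction `v`. -/
lemma Solves.maximum_le (h : D.Solves n y)
    (hm : ∀ᶠ z in 𝓝 y, ∀ v, nab1 D.Γ (fderiv ℝ D.f) z v v + fderiv ℝ D.f z v ^ 2 ≤ m * D.G z v v)
    (heq : nab1 D.Γ (fderiv ℝ D.f) y τ τ + fderiv ℝ D.f y τ ^ 2 = m * D.G y τ τ) (v : E) :
    nab3 D.Γ (nab2 D.Γ (nab1 D.Γ (fderiv ℝ D.f))) y v v τ τ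
      + 2 * nab1 D.Γ (fderiv ℝ D.f) y v τ ^ 2
      + 2 * fderiv ℝ D.f y τ * nab2 D.Γ (nab1 D.Γ (fderiv ℝ D.f)) y v v τ ≤ 0 := by
  have hΓ2 : ContDiffAt ℝ 2 D.Γ y := h.chern.smooth.of_le (by norm_num)
  have hΓ1 : ContDiffAt ℝ 1 D.Γ y := hΓ2.of_le (by norm_num)
  have hf1 : ContDiffAt ℝ 3 (fderiv ℝ D.f) y := h.contDiff_f.fderiv_right (by norm_num)
  have hU : ContDiffAt ℝ 2 (nab1 D.Γ (fderiv ℝ D.f)) y := contDiffAt_nab1 (by norm_num) hΓ2 hf1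
  have hW := parallel2_parField (a := v) (hΓ1.differentiableAt (by simp)) τ
  have j1 := jet2_form1 (hf1.of_le (by norm_num)) hΓ1 hW
  have j2 := jet2_form2 hU hΓ1 hW hW
  have n2 : nab2 D.Γ D.G y = 0 := h.metric.self_of_nhds
  have n3 : nab3 D.Γ (nab2 D.Γ D.G) y v v τ τ = 0 := by
    have : fderiv ℝ (nab2 D.Γ D.G) y = 0 := by
      rw [Filter.EventuallyEq.fderiv_eq (f := fun _ ↦ 0) h.metric]; simp
    simp [nab3, this, n2]
  have j3 : Jet2 (fun t ↦ D.G (geod D.Γ y v t) (parField D.Γ y v τ t) (parField D.Γ y v τ t)) 0 0 :=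
    (jet2_form2 h.contDiff_G hΓ1 hW hW).congr_jet (by simp [n2]) (by simpa using n3)
  -- Along the curve, ∇²f(W,W) + (Wf)² - m G(W,W) is nonpositive and vanishes at 0. The term G(W,W)
  -- has zero derivatives up to second order.
  have J := (j2.add (j1.mul j1)).sub (j3.const_mul m)
  have hmax := J.nonpos_of_isLocalMax (by
    filter_upwards [eventually_geod (a := v) (Γ := D.Γ) hm] with t ht
    have := ht (parField D.Γ y v τ t)
    simp only [geod_zero, parField_zero]
    nlinarith)
  simp only [geod_zero, parField_zero, mul_zero, sub_zero] at hmax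
  nlinarith

namespace Bounded

/-- Expanding T(e_j, τ) in the unitary frame writes the pair (e_j, T), (J e_j, J T) through real and
imaginary parts of ∂_τ u_{kj̄}. These differ from the components of `comp₁` only by derivatives of
χ, and the coefficients are at most 2κ. -/
lemma abs_cross_le (hb : D.Bounded n a b δ κ Λ y) (hJ : ∀ v, D.J y (D.J y v) = -v) (hκ : 0 ≤ κ)
    (ha : 0 ≤ a) (hΛ : 0 ≤ Λ) {e : Fin n → E} (he : ∀ k, D.len y (e k) ≤ 2) (hτ : D.len y τ = 1)
    (hexp : ∀ v, v = ∑ k, ((D.G y v (e k) / 2) • e k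
      + (D.G y v (D.J y (e k)) / 2) • D.J y (e k))) (j : Fin n) :
    |nab2 D.Γ (nab1 D.Γ (fderiv ℝ D.f)) y τ (e j) (Chart.tor D.Γ y (e j) τ)
        + nab2 D.Γ (nab1 D.Γ (fderiv ℝ D.f)) y τ (D.J y (e j)) (D.J y (Chart.tor D.Γ y (e j) τ))|
      ≤ ∑ k, (2 * κ) * (8 * ‖D.comp₁ y τ (e k) (e j)‖ + 8 * (2 * (Λ * (1 + a)))) := by
  set t := Chart.tor D.Γ y (e j) τ with ht
  set U := nab2 D.Γ (nab1 D.Γ (fderiv ℝ D.f)) y τ with hU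
  have e1 : U (e j) t + U (D.J y (e j)) (D.J y t) = ∑ k,
      ((D.G y t (e k) / 2) * (U (e j) (e k) + U (D.J y (e j)) (D.J y (e k)))
        + (D.G y t (D.J y (e k)) / 2) * (U (e j) (D.J y (e k)) - U (D.J y (e j)) (e k))) := by
    conv_lhs => rw [hexp t]
    simp only [map_sum, map_add, map_smul, hJ, map_neg, smul_eq_mul, ← Finset.sum_add_distrib]
    exact Finset.sum_congr rfl fun k _ ↦ by ring
  rw [e1]
  refine (Finset.abs_sum_le_sum_abs _ _).trans (Finset.sum_le_sum fun k _ ↦ ?_)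
  have hL0 := fun v ↦ len_nonneg (D := D) (y := y) v
  have bt : ∀ z, D.len y z ≤ 2 → |D.G y t z / 2| ≤ 2 * κ := by
    intro z hz
    have h1 := hb.tor (e j) τ z
    rw [hτ] at h1
    have h2 : κ * (D.len y (e j) * 1 * D.len y z) ≤ κ * (2 * 1 * 2) := by
      have := he j
      have := hL0 z
      have := hL0 (e j)
      gcongr
    rw [abs_div, abs_two]
    linarith
  have bχ : ∀ v w, D.len y v ≤ 2 → D.len y w ≤ 2 →
      |famDeriv D.Γ D.χ D.f y τ v w| ≤ 4 * (Λ * (1 + a)) := by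
    intro v w hv hw
    refine (hb.abs_famDeriv_le hτ v w).trans ?_
    have h2 : Λ * (1 + a) * (D.len y v * D.len y w) ≤ Λ * (1 + a) * (2 * 2) := by
      have := hL0 v
      have := hL0 w
      gcongr
    linarith
  have hJe : ∀ k, D.len y (D.J y (e k)) ≤ 2 := fun k ↦ by rw [hb.len_J]; exact he k
  have c1 := bχ (e k) (D.J y (e j)) (he k) (hJe j)
  have c2 := bχ (D.J y (e k)) (e j) (hJe k) (he j)
  have c3 := bχ (e k) (e j) (he k) (he j)
  have c4 := bχ (D.J y (e k)) (D.J y (e j)) (hJe k) (hJe j)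
  have hr := Complex.abs_re_le_norm (D.comp₁ y τ (e k) (e j))
  have hi := Complex.abs_im_le_norm (D.comp₁ y τ (e k) (e j))
  rw [comp₁, hermComb_re, ← comp₁] at hr
  rw [comp₁, hermComb_im, ← comp₁] at hi
  have d1 : |U (e j) (e k) + U (D.J y (e j)) (D.J y (e k))|
      ≤ 4 * ‖D.comp₁ y τ (e k) (e j)‖ + 8 * (Λ * (1 + a)) := by
    rw [abs_le] at hr c1 c2 ⊢
    constructor <;> linarith [hr.1, hr.2, c1.1, c1.2, c2.1, c2.2]
  have d2 : |U (e j) (D.J y (e k)) - U (D.J y (e j)) (e k)|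
      ≤ 4 * ‖D.comp₁ y τ (e k) (e j)‖ + 8 * (Λ * (1 + a)) := by
    rw [abs_le] at hi c3 c4 ⊢
    constructor <;> linarith [hi.1, hi.2, c3.1, c3.2, c4.1, c4.2]
  calc _ ≤ 2 * κ * (4 * ‖D.comp₁ y τ (e k) (e j)‖ + 8 * (Λ * (1 + a)))
        + 2 * κ * (4 * ‖D.comp₁ y τ (e k) (e j)‖ + 8 * (Λ * (1 + a))) := by
        refine (abs_add_le _ _).trans (add_le_add ?_ ?_)
        · rw [abs_mul]
          exact mul_le_mul (bt _ (he k)) d1 (abs_nonneg _) (by positivity)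
        · rw [abs_mul]
          exact mul_le_mul (bt _ (hJe k)) d2 (abs_nonneg _) (by positivity)
    _ = _ := by ring

/-- The estimate at an interior maximum of the test function `∇²f(τ, τ) + (τ f)²` on the unit sphere
bundle. -/
theorem hess_le [FiniteDimensional ℝ E] (hb : D.Bounded n a b δ κ Λ y) (h : D.Solves n y)
    (hdim : Module.finrank ℝ E = 2 * n) (hn : 0 < n) (hδ : 0 < δ)
    (hm : ∀ᶠ z in 𝓝 y, ∀ v, nab1 D.Γ (fderiv ℝ D.f) z v v + fderiv ℝ D.f z v ^ 2 ≤ m * D.G z v v)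
    (hτ : D.G y τ τ = 1) (heq : nab1 D.Γ (fderiv ℝ D.f) y τ τ + fderiv ℝ D.f y τ ^ 2 = m) :
    nab1 D.Γ (fderiv ℝ D.f) y τ τ ≤ hessBound n a b δ κ Λ := by
  set X := nab1 D.Γ (fderiv ℝ D.f) y τ τ with hX
  -- For X > 1 constants may be replaced by multiples of X. The errors become linear in X, and X² ≤
  -- C·X can be divided by X at the end.
  rcases le_or_gt X 1 with hX1 | hX1
  · exact hX1.trans (le_max_left _ _)
  have hJ := h.chern.sq.self_of_nhds
  have hτ1 : D.len y τ = 1 := by rw [len, hτ, Real.sqrt_one]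
  have ha : 0 ≤ a := by simpa [hτ1] using (abs_nonneg _).trans (hb.df τ)
  have hκ : 0 ≤ κ := by simpa [hτ1] using (abs_nonneg _).trans (hb.tor τ τ τ)
  have hΛ : 0 ≤ Λ := by simpa [hτ1] using (abs_nonneg _).trans (hb.χ₀₀ τ τ)
  have hdu : fderiv ℝ D.f y τ ^ 2 ≤ a ^ 2 := by
    have := hb.df τ
    rw [hτ1, mul_one] at this
    exact sq_le_sq' (abs_le.1 this).1 (abs_le.1 this).2
  -- The maximum value satisfies m ≤ X + a², so for X > 1 the bound of `abs_hess_le` is at most this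
  -- multiple of X.
  set K := (1 + a ^ 2 + 2 * Λ + a * κ) * X with hKdef
  have hX0 : 0 < X := by linarith
  have hK : 0 ≤ K := by positivity
  have hU : ∀ v w, |nab1 D.Γ (fderiv ℝ D.f) y v w| ≤ K * (D.len y v * D.len y w) := by
    intro v w
    have h0 := hm.self_of_nhds
    refine (hb.abs_hess_le h ha hκ (m := m) (fun v ↦ ?_) hΛ v w).trans ?_
    · nlinarith [h0 v, sq_nonneg (fderiv ℝ D.f y v)]
    · have := mul_nonneg (len_nonneg (D := D) (y := y) v) (len_nonneg (D := D) (y := y) w)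
      refine mul_le_mul_of_nonneg_right ?_ this
      have q : 0 ≤ (a ^ 2 + 2 * Λ + a * κ) * (X - 1) := mul_nonneg (by positivity) (by linarith)
      rw [hKdef]
      nlinarith
  obtain ⟨e, l, heG, heF, hexp⟩ := hb.exists_frame hdim h
  have hGe : ∀ j, D.G y (e j) (e j) = 2 := by
    intro j
    have := congrArg Complex.re (heG j j)
    rw [herm_re, hb.isometry] at this
    simp at this
    linarith
  have hle : ∀ j, D.len y (e j) ≤ 2 := by
    intro j
    rw [len, hGe]
    exact Real.sqrt_le_iff.2 ⟨by norm_num, by norm_num⟩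
  have hJe : ∀ j, D.len y (D.J y (e j)) ≤ 2 := fun k ↦ by rw [hb.len_J]; exact hle k
  have hlF : ∀ j, l j = (herm (D.J y) (D.form y) (e j) (e j)).re := fun j ↦ by simp [heF]
  have hl : ∀ j, 0 < l j := by
    intro j
    rw [hlF]
    refine hb.admissible _ fun h0 ↦ ?_
    have := hGe j
    rw [h0] at this
    simp at this
  -- The sum of the eigenvalues is the Laplacian plus the trace of χ. Since |e_j| ≤ 2, each diagonal
  -- component of χ is at most 2Λ.
  set B := b + 2 * n * Λ with hB
  have hsum : ∑ j, l j ≤ B := by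
    have h1 := hb.laplacian e heG
    have h2 : ∑ j, l j ≤ ∑ j, ((herm (D.J y) (fun v w ↦ nab1 D.Γ (fderiv ℝ D.f) y w v)
        (e j) (e j)).re + 2 * Λ) := by
      refine Finset.sum_le_sum fun j _ ↦ ?_
      have hq : ∀ v w, D.len y v ≤ 2 → D.len y w ≤ 2 → |D.χ y (D.f y) v w| ≤ Λ * (2 * 2) := by
        intro v w hv hw
        refine (hb.χ₀₀ v w).trans ?_
        have := len_nonneg (D := D) (y := y) v
        have := len_nonneg (D := D) (y := y) w
        gcongr
      have q1 := (abs_le.1 (hq _ _ (hle j) (hJe j))).2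
      have q2 := (abs_le.1 (hq _ _ (hJe j) (hle j))).1
      rw [hlF, herm_re, herm_re]
      simp only [form, hJ, map_neg]
      linarith
    rw [Finset.sum_add_distrib] at h2
    simp only [Finset.sum_const, Finset.card_univ, Fintype.card_fin, nsmul_eq_mul] at h2
    rw [hB]
    linarith
  have hlB : ∀ j, l j ≤ B := fun j ↦
    (Finset.single_le_sum (fun k _ ↦ (hl k).le) (Finset.mem_univ j)).trans hsum
  have hB0 : 0 < B := (hl ⟨0, hn⟩).trans_le (hlB _)
  obtain ⟨hprod, hj1, hj2⟩ := h.equation_jet τ (fun j ↦ (hl j).ne') heG heF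
  have hψ : δ ≤ D.ψ y (D.f y) := hb.le_ψ
  have hψ0 : 0 < D.ψ y (D.f y) := hδ.trans_le hψ
  -- The eigenvalue l_j times the n - 1 others, each at most B, equals ψ ≥ δ.
  have hlμ : ∀ j, (l j)⁻¹ ≤ B ^ (n - 1) / δ := by
    intro j
    have h1 : ∏ i ∈ Finset.univ.erase j, l i ≤ B ^ (n - 1) := by
      have := Finset.prod_le_prod (s := Finset.univ.erase j) (fun i _ ↦ (hl i).le) fun i _ ↦ hlB i
      simpa [Finset.card_erase_of_mem] using this
    have h2 := Finset.mul_prod_erase Finset.univ l (Finset.mem_univ j)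
    rw [hprod] at h2
    rw [inv_eq_one_div, div_le_div_iff₀ (hl j) hδ, one_mul]
    calc δ ≤ D.ψ y (D.f y) := hψ
      _ = l j * ∏ i ∈ Finset.univ.erase j, l i := h2.symm
      _ ≤ l j * B ^ (n - 1) := by
        have := (hl j).le
        gcongr
      _ = _ := mul_comm _ _
  have hψ1 : |famScalarDeriv D.ψ D.f y τ / D.ψ y (D.f y)| ≤ Λ * (1 + a) / δ := by
    rw [abs_div, abs_of_pos hψ0]
    have := hb.abs_famScalarDeriv_le hτ1
    gcongr
  have hXabs : |nab1 D.Γ (fderiv ℝ D.f) y τ τ| = X := abs_of_pos hX0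
  have hL : Λ * (1 + 2 * a + a ^ 2 + X) ≤ Λ * (2 + 2 * a + a ^ 2) * X := by
    have q : 0 ≤ Λ * ((1 + 2 * a + a ^ 2) * (X - 1)) :=
      mul_nonneg hΛ (mul_nonneg (by positivity) (by linarith))
    nlinarith
  have hψ2 : |famScalarDeriv₂ D.Γ D.ψ D.f y τ / D.ψ y (D.f y)|
      ≤ Λ * (2 + 2 * a + a ^ 2) * X / δ := by
    rw [abs_div, abs_of_pos hψ0]
    have := hb.abs_famScalarDeriv₂_le hτ1
    rw [hXabs] at this
    have := this.trans hL
    gcongr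
  have up : ∀ {c : ℝ}, 0 ≤ c → c ≤ c * X := fun hc ↦ le_mul_of_one_le_right hc hX1.le
  have main := sum_estimate (l := l)
    (A := fun j ↦ nab3 D.Γ (nab2 D.Γ (nab1 D.Γ (fderiv ℝ D.f))) y (e j) (e j) τ τ
      + nab3 D.Γ (nab2 D.Γ (nab1 D.Γ (fderiv ℝ D.f))) y (D.J y (e j)) (D.J y (e j)) τ τ)
    (P := fun j ↦ nab1 D.Γ (fderiv ℝ D.f) y (e j) τ ^ 2
      + nab1 D.Γ (fderiv ℝ D.f) y (D.J y (e j)) τ ^ 2)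
    (F := fun j ↦ nab2 D.Γ (nab1 D.Γ (fderiv ℝ D.f)) y (e j) (e j) τ
      + nab2 D.Γ (nab1 D.Γ (fderiv ℝ D.f)) y (D.J y (e j)) (D.J y (e j)) τ)
    (Bq := fun j ↦ nab2 D.Γ (nab1 D.Γ (fderiv ℝ D.f)) y τ (e j) (Chart.tor D.Γ y (e j) τ)
      + nab2 D.Γ (nab1 D.Γ (fderiv ℝ D.f)) y τ (D.J y (e j)) (D.J y (Chart.tor D.Γ y (e j) τ)))
    (M₁ := fun j k ↦ D.comp₁ y τ (e j) (e k)) (M₂ := fun j k ↦ D.comp₂ y τ (e j) (e k))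
    (X := X) (u₁ := fderiv ℝ D.f y τ) (a := a) (κ := 2 * κ) (Λ' := 2 * (Λ * (1 + a)))
    (Z₁ := (8 * (Λ * (2 + 2 * a + a ^ 2)) + 272 * (1 + a ^ 2 + 2 * Λ + a * κ) * κ + 112 * a * κ
        + 128 * (1 + a ^ 2 + 2 * Λ + a * κ) * κ ^ 2 + 128 * a * κ ^ 2) * X)
    (Z₂ := (8 * (Λ * (1 + a)) + 32 * (1 + a ^ 2 + 2 * Λ + a * κ) * κ + 40 * a * κ) * X)
    (Z₃ := (Λ * (2 + 2 * a + a ^ 2) / δ + (Λ * (1 + a) / δ) ^ 2) * X)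
    (Z₄ := Λ * (1 + a) / δ) (B₁ := B) (μ := B ^ (n - 1) / δ)
    (by simpa [hτ1] using hb.df τ) (by positivity) (by positivity) hl hlB hlμ hB0 (by positivity)
    (by positivity)
    (fun j ↦ by
      have h1 := h.maximum_le hm (by rw [hτ, mul_one]; exact heq) (e j)
      have h2 := h.maximum_le hm (by rw [hτ, mul_one]; exact heq) (D.J y (e j))
      linarith)
    (fun j ↦ by
      refine (hb.abs_trace₄_sub_le hU hK ha hκ h (hle j) hτ1 hΛ).trans ?_
      rw [hXabs]
      have u1 := up (c := a * κ) (by positivity)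
      have u2 := up (c := a * κ ^ 2) (by positivity)
      rw [hKdef]
      linarith)
    (fun j ↦ by
      refine (hb.abs_trace₃_sub_le hU hK ha hκ h (hle j) hτ1 hΛ).trans ?_
      have u1 := up (c := a * κ) (by positivity)
      have u2 := up (c := Λ * (1 + a)) (by positivity)
      rw [hKdef]
      linarith)
    (fun j ↦ hb.abs_cross_le hJ hκ ha hΛ hle hτ1 hexp j)
    hj1 hψ1
    (by
      rw [hj2]
      have u1 := up (c := (Λ * (1 + a) / δ) ^ 2) (by positivity)
      have u2 := sq_le_sq' (abs_le.1 hψ1).1 (abs_le.1 hψ1).2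
      have u3 := (abs_le.1 hψ2).1
      have u4 : Λ * (2 + 2 * a + a ^ 2) * X / δ = Λ * (2 + 2 * a + a ^ 2) / δ * X := by ring
      linarith)
    (fun j ↦ add_nonneg (sq_nonneg _) (sq_nonneg _))
    (by
      set α : Fin n → ℝ := fun k ↦ D.G y τ (e k) / 2
      set β : Fin n → ℝ := fun k ↦ D.G y τ (D.J y (e k)) / 2
      have h1 : ∑ k, (α k ^ 2 + β k ^ 2) = 1 / 2 := by
        have : D.G y τ τ = ∑ k, (2 * α k ^ 2 + 2 * β k ^ 2) := by
          conv_lhs => enter [2]; rw [hexp τ]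
          simp only [map_sum, map_add, map_smul, smul_eq_mul]
          exact Finset.sum_congr rfl fun k _ ↦ by simp only [α, β]; ring
        rw [hτ] at this
        have h2 : ∑ k, (2 * α k ^ 2 + 2 * β k ^ 2) = 2 * ∑ k, (α k ^ 2 + β k ^ 2) := by
          rw [Finset.mul_sum]; exact Finset.sum_congr rfl fun k _ ↦ by ring
        linarith
      have h2 : X = ∑ k, (α k * nab1 D.Γ (fderiv ℝ D.f) y (e k) τ
          + β k * nab1 D.Γ (fderiv ℝ D.f) y (D.J y (e k)) τ) := by
        conv_lhs => rw [hX]; enter [1, 2]; rw [hexp τ]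
        simp only [map_sum, map_add, map_smul, _root_.sum_apply, _root_.add_apply,
          _root_.smul_apply, smul_eq_mul, α, β]
      -- This is Cauchy–Schwarz for X = ∑ (α p + β q) with ∑ (α² + β²) = 1/2: expanding the squares
      -- gives ∑ (p² + q²) - 2X² ≥ 0.
      have h3 : 0 ≤ ∑ k, ((nab1 D.Γ (fderiv ℝ D.f) y (e k) τ - 2 * X * α k) ^ 2
          + (nab1 D.Γ (fderiv ℝ D.f) y (D.J y (e k)) τ - 2 * X * β k) ^ 2) :=
        Finset.sum_nonneg fun k _ ↦ by positivity
      have h4 : ∑ k, ((nab1 D.Γ (fderiv ℝ D.f) y (e k) τ - 2 * X * α k) ^ 2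
          + (nab1 D.Γ (fderiv ℝ D.f) y (D.J y (e k)) τ - 2 * X * β k) ^ 2)
          = (∑ k, (nab1 D.Γ (fderiv ℝ D.f) y (e k) τ ^ 2
            + nab1 D.Γ (fderiv ℝ D.f) y (D.J y (e k)) τ ^ 2))
          - 4 * X * (∑ k, (α k * nab1 D.Γ (fderiv ℝ D.f) y (e k) τ
            + β k * nab1 D.Γ (fderiv ℝ D.f) y (D.J y (e k)) τ))
          + 4 * X ^ 2 * ∑ k, (α k ^ 2 + β k ^ 2) := by
        rw [Finset.mul_sum, Finset.mul_sum, ← Finset.sum_sub_distrib, ← Finset.sum_add_distrib]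
        exact Finset.sum_congr rfl fun k _ ↦ by ring
      rw [← h2, h1] at h4
      linarith)
  refine le_trans ?_ (le_max_right _ _)
  refine le_of_mul_le_mul_right ?_ hX0
  rw [← sq]
  refine main.trans ?_
  refine (mul_le_mul_of_nonneg_left ?_ (by positivity)).trans (mul_assoc _ _ _).ge
  have u1 := up (c := 8 * a * (Λ * (1 + a) / δ)) (by positivity)
  have u2 := up (c := 32 * (2 * κ) * (2 * (Λ * (1 + a))) * n ^ 2 * (B ^ (n - 1) / δ))
    (by positivity)
  have u3 := up (c := 64 * (2 * κ) ^ 2 * n ^ 2 * B * (B ^ (n - 1) / δ)) (by positivity)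
  linarith

end Bounded

end MAData

end

end Chart

/-! ### Coordinate frames of the tangent bundle -/

section Frame

variable {E : Type*} [NormedAddCommGroup E] [NormedSpace ℝ E]
  {H : Type*} [TopologicalSpace H] {I : ModelWithCorners ℝ E H}
  {M : Type*} [TopologicalSpace M] [ChartedSpace H M] [IsManifold I ∞ M]
  {F : Type*} [NormedAddCommGroup F] [NormedSpace ℝ F]

variable (I) in
/-- The coordinate frame of the tangent bundle given by the preferred chart at `x₀`. -/
noncomputable def frame (x₀ z : M) : E →L[ℝ] TangentSpace I z :=
  (trivializationAt E (TangentSpace I) x₀).symmL ℝ z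

variable (I) in
/-- The components of tangent vectors in the preferred chart at `x₀`. -/
noncomputable def coframe (x₀ z : M) : TangentSpace I z →L[ℝ] E :=
  (trivializationAt E (TangentSpace I) x₀).continuousLinearMapAt ℝ z

variable {x₀ z : M}

theorem mem_baseSet (hz : z ∈ (extChartAt I x₀).source) :
    z ∈ (trivializationAt E (TangentSpace I) x₀).baseSet := by
  rw [TangentBundle.trivializationAt_baseSet]
  simpa using hz

theorem coframe_frame (hz : z ∈ (extChartAt I x₀).source) (a : E) :
    coframe I x₀ z (frame I x₀ z a) = a :=
  (trivializationAt E (TangentSpace I) x₀).continuousLinearMapAt_symmL (mem_baseSet hz) a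

theorem frame_coframe (hz : z ∈ (extChartAt I x₀).source) (v : TangentSpace I z) :
    frame I x₀ z (coframe I x₀ z v) = v :=
  (trivializationAt E (TangentSpace I) x₀).symmL_continuousLinearMapAt (mem_baseSet hz) v

theorem coframe_apply (hz : z ∈ (extChartAt I x₀).source) (v : TangentSpace I z) :
    coframe I x₀ z v = (trivializationAt E (TangentSpace I) x₀ ⟨z, v⟩).2 :=
  Trivialization.continuousLinearMapAt_apply_of_mem ℝ _ (mem_baseSet hz) v

/-- The extension of a vector at x₀ is made in the trivialization centred at x₀, so it has constant
components in the chart at x₀. For vectors at other points the components of the extension may vary.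
-/
theorem extend_eq_frame (v : TangentSpace I x₀) (hz : z ∈ (extChartAt I x₀).source) :
    (FiberBundle.extend E v z : TangentSpace I z) = frame I x₀ z (coframe I x₀ x₀ v) := by
  rw [coframe_apply (mem_extChartAt_source x₀)]
  exact ((trivializationAt E (TangentSpace I) x₀).symmL_apply (mem_baseSet hz) _).symm

omit [IsManifold I ∞ M] in
theorem source_mem_nhds (hz : z ∈ (extChartAt I x₀).source) : (extChartAt I x₀).source ∈ 𝓝 z :=
  extChartAt_source_mem_nhds' hz

theorem contMDiffAt_section_iff {X : ∀ y : M, TangentSpace I y} {n : WithTop ℕ∞}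
    [IsManifold I (n + 1) M] [ContMDiffVectorBundle n E (TangentSpace I : M → Type _) I]
    (hz : z ∈ (extChartAt I x₀).source) :
    ContMDiffAt I (I.prod 𝓘(ℝ, E)) n (fun y ↦ (⟨y, X y⟩ : TangentBundle I M)) z ↔
      ContMDiffAt I 𝓘(ℝ, E) n (fun y ↦ coframe I x₀ y (X y)) z := by
  rw [(trivializationAt E (TangentSpace I) x₀).contMDiffAt_section_iff (mem_baseSet hz)]
  apply Filter.EventuallyEq.contMDiffAt_iff
  filter_upwards [source_mem_nhds hz] with y hy
  exact (coframe_apply hy _).symm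

theorem mdifferentiableAt_section_iff {X : ∀ y : M, TangentSpace I y}
    (hz : z ∈ (extChartAt I x₀).source) :
    MDifferentiableAt I (I.prod 𝓘(ℝ, E)) (fun y ↦ (⟨y, X y⟩ : TangentBundle I M)) z ↔
      MDifferentiableAt I 𝓘(ℝ, E) (fun y ↦ coframe I x₀ y (X y)) z := by
  rw [(trivializationAt E (TangentSpace I) x₀).mdifferentiableAt_section_iff I X (mem_baseSet hz)]
  apply Filter.EventuallyEq.mdifferentiableAt_iff
  filter_upwards [source_mem_nhds hz] with y hy
  exact (coframe_apply hy _).symm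

theorem contMDiffAt_frame (hz : z ∈ (extChartAt I x₀).source) (a : E) :
    ContMDiffAt I (I.prod 𝓘(ℝ, E)) ∞ (fun y ↦ (⟨y, frame I x₀ y a⟩ : TangentBundle I M)) z := by
  have : IsManifold I (∞ + 1) M := by simpa
  rw [contMDiffAt_section_iff hz]
  apply (contMDiffAt_const (c := a)).congr_of_eventuallyEq
  filter_upwards [source_mem_nhds hz] with y hy
  exact coframe_frame hy a

theorem mdifferentiableAt_frame (hz : z ∈ (extChartAt I x₀).source) (a : E) :
    MDifferentiableAt I (I.prod 𝓘(ℝ, E))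
      (fun y ↦ (⟨y, frame I x₀ y a⟩ : TangentBundle I M)) z :=
  (contMDiffAt_frame hz a).mdifferentiableAt (by simp)

theorem mdifferentiableAt_iff_chart {f : M → F} (hz : z ∈ (extChartAt I x₀).source) :
    MDifferentiableAt I 𝓘(ℝ, F) f z ↔
      DifferentiableWithinAt ℝ (f ∘ (extChartAt I x₀).symm) (range I) (extChartAt I x₀ z) := by
  have : IsManifold I 1 M := .of_le (n := ∞) (by simp)
  rw [mdifferentiableAt_iff_source_of_mem_source (by simpa using hz),
    mdifferentiableWithinAt_iff_differentiableWithinAt]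

theorem contMDiffAt_iff_chart {f : M → F} {n : WithTop ℕ∞} (hn : n ≤ ∞)
    (hz : z ∈ (extChartAt I x₀).source) :
    ContMDiffAt I 𝓘(ℝ, F) n f z ↔
      ContDiffWithinAt ℝ n (f ∘ (extChartAt I x₀).symm) (range I) (extChartAt I x₀ z) := by
  have : IsManifold I n M := .of_le (n := ∞) hn
  rw [contMDiffAt_iff_source_of_mem_source (by simpa using hz),
    contMDiffWithinAt_iff_contDiffWithinAt]

theorem mvfderiv_frame {f : M → F} (hz : z ∈ (extChartAt I x₀).source)
    (hf : MDifferentiableAt I 𝓘(ℝ, F) f z) (a : E) :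
    mvfderiv I f z (frame I x₀ z a)
      = fderivWithin ℝ (f ∘ (extChartAt I x₀).symm) (range I) (extChartAt I x₀ z) a := by
  have : IsManifold I 1 M := .of_le (n := ∞) (by simp)
  have hy := (extChartAt I x₀).map_source hz
  have hs := mdifferentiableWithinAt_extChartAt_symm (I := I) hy
  have hu : UniqueMDiffWithinAt 𝓘(ℝ, E) (range I) (extChartAt I x₀ z) :=
    (I.uniqueDiffOn.uniqueDiffWithinAt
      (extChartAt_target_subset_range (I := I) x₀ hy)).uniqueMDiffWithinAt
  have hinv := (extChartAt I x₀).left_inv hz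
  have key : mfderivWithin 𝓘(ℝ, E) 𝓘(ℝ, F) (f ∘ (extChartAt I x₀).symm) (range I)
      (extChartAt I x₀ z) = (mfderiv I 𝓘(ℝ, F) f ((extChartAt I x₀).symm (extChartAt I x₀ z))).comp
        (mfderivWithin 𝓘(ℝ, E) I (extChartAt I x₀).symm (range I) (extChartAt I x₀ z)) := by
    apply mfderiv_comp_mfderivWithin _ _ hs hu
    rwa [hinv]
  rw [← mfderivWithin_eq_fderivWithin, key, mvfderiv, frame,
    TangentBundle.symmL_trivializationAt (by simpa using hz)]
  simp only [ContinuousLinearMap.comp_apply]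
  rw [hinv]
  rfl

end Frame

/-! ### Christoffel symbols and their smoothness -/

section Christoffel

variable {E : Type*} [NormedAddCommGroup E] [NormedSpace ℝ E] [FiniteDimensional ℝ E]
  {H : Type*} [TopologicalSpace H] {I : ModelWithCorners ℝ E H}
  {M : Type*} [TopologicalSpace M] [ChartedSpace H M] [IsManifold I ∞ M]
  {F : Type*} [NormedAddCommGroup F] [NormedSpace ℝ F]

/-- The Christoffel symbols at `z` of a connection in the preferred chart at `x₀`. -/
noncomputable def christoffelAt (cov : CovariantDerivative I E (fun x : M ↦ TangentSpace I x))
    (x₀ z : M) : E →L[ℝ] E →L[ℝ] E :=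
  ∑ i, (ContinuousLinearMap.smulRightL ℝ E E
      ((Module.finBasis ℝ E).coord i).toContinuousLinearMap).comp
    ((coframe I x₀ z).comp
      ((cov (fun x ↦ frame I x₀ x (Module.finBasis ℝ E i)) z).comp (frame I x₀ z)))

/-- The Christoffel symbols of a connection in the preferred chart at `x₀`:
`∇_{∂_a} ∂_b = Γ(a, b)`. -/
noncomputable def christoffel (cov : CovariantDerivative I E (fun x : M ↦ TangentSpace I x))
    (x₀ : M) (y : E) : E →L[ℝ] E →L[ℝ] E :=
  christoffelAt cov x₀ ((extChartAt I x₀).symm y)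

variable {x₀ z : M} (cov : CovariantDerivative I E (fun x : M ↦ TangentSpace I x))

theorem christoffel_apply (hz : z ∈ (extChartAt I x₀).source) (a b : E) :
    christoffel cov x₀ (extChartAt I x₀ z) a b
      = coframe I x₀ z (cov (fun x ↦ frame I x₀ x b) z (frame I x₀ z a)) := by
  have hc := cov.isCovariantDerivativeOn (s := univ)
  let L : E →ₗ[ℝ] E :=
    { toFun := fun b ↦ coframe I x₀ z (cov (fun x ↦ frame I x₀ x b) z (frame I x₀ z a))
      map_add' := fun b c ↦ by
        have : (fun x ↦ frame I x₀ x (b + c))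
            = (fun x ↦ frame I x₀ x b) + fun x ↦ frame I x₀ x c := by
          funext x
          simp
        rw [this, hc.add (mdifferentiableAt_frame hz b) (mdifferentiableAt_frame hz c)]
        simp
      map_smul' := fun r b ↦ by
        have : (fun x ↦ frame I x₀ x (r • b)) = r • fun x ↦ frame I x₀ x b := by
          funext x
          simp
        rw [this, hc.smul_const r (mdifferentiableAt_frame hz b)]
        simp }
  have : (christoffel cov x₀ (extChartAt I x₀ z) a : E →ₗ[ℝ] E) = L := by
    apply (Module.finBasis ℝ E).ext
    intro i
    rw [christoffel, (extChartAt I x₀).left_inv hz]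
    simp [L, christoffelAt, Finsupp.single_apply]
  exact LinearMap.congr_fun this b

theorem cov_frame (hz : z ∈ (extChartAt I x₀).source) (a b : E) :
    cov (fun x ↦ frame I x₀ x b) z (frame I x₀ z a)
      = frame I x₀ z (christoffel cov x₀ (extChartAt I x₀ z) a b) := by
  rw [christoffel_apply cov hz, frame_coframe hz]

/-- The difference between ∇X and the derivative of the components of X is tensorial in X. It may
therefore be computed on the coordinate field with the same value at z, whose components are
constant. -/
theorem cov_apply_frame {X : ∀ y : M, TangentSpace I y} (hz : z ∈ (extChartAt I x₀).source)
    (hX : MDifferentiableAt I (I.prod 𝓘(ℝ, E)) (fun y ↦ (⟨y, X y⟩ : TangentBundle I M)) z)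
    (a : E) :
    cov X z (frame I x₀ z a) = frame I x₀ z
      (fderivWithin ℝ ((fun y ↦ coframe I x₀ y (X y)) ∘ (extChartAt I x₀).symm) (range I)
          (extChartAt I x₀ z) a
        + christoffel cov x₀ (extChartAt I x₀ z) a (coframe I x₀ z (X z))) := by
  have : IsManifold I 1 M := .of_le (n := ∞) (by simp)
  have hc := cov.isCovariantDerivativeOn (s := univ)
  have hu : UniqueDiffWithinAt ℝ (range I) (extChartAt I x₀ z) :=
    I.uniqueDiffOn.uniqueDiffWithinAt
      (extChartAt_target_subset_range (I := I) x₀ ((extChartAt I x₀).map_source hz))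
  have hT : TensorialAt I E (fun X : ∀ y : M, TangentSpace I y ↦ cov X z (frame I x₀ z a)
      - frame I x₀ z
        (mvfderiv I (fun y ↦ coframe I x₀ y (X y)) z (frame I x₀ z a))) z := by
    constructor
    · intro f σ hf hσ
      have h1 := (mdifferentiableAt_section_iff hz).1 hσ
      have h2 : (fun y ↦ coframe I x₀ y ((f • σ) y)) = fun y ↦ f y • coframe I x₀ y (σ y) := by
        funext y
        simp
      rw [h2, mvfderiv_fun_smul hf h1, hc.leibniz hσ hf]
      simp [frame_coframe hz]
      module
    · intro σ τ hσ hτ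
      have h1 := (mdifferentiableAt_section_iff hz).1 hσ
      have h1' := (mdifferentiableAt_section_iff hz).1 hτ
      have h2 : (fun y ↦ coframe I x₀ y ((σ + τ) y))
          = fun y ↦ coframe I x₀ y (σ y) + coframe I x₀ y (τ y) := by
        funext y
        simp
      rw [h2, mvfderiv_fun_add h1 h1', hc.add hσ hτ]
      simp
      module
  have h := hT.pointwise hX (mdifferentiableAt_frame hz (coframe I x₀ z (X z)))
    (frame_coframe hz (X z)).symm
  have h0 : mvfderiv I (fun y ↦ coframe I x₀ y (frame I x₀ y (coframe I x₀ z (X z)))) z = 0 := by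
    have : (fun y ↦ coframe I x₀ y (frame I x₀ y (coframe I x₀ z (X z))))
        =ᶠ[𝓝 z] fun _ ↦ coframe I x₀ z (X z) := by
      filter_upwards [source_mem_nhds hz] with y hy using coframe_frame hy _
    rw [mvfderiv, this.mfderiv_eq, mfderiv_const]
    exact ContinuousLinearMap.comp_zero _
  rw [h0, sub_eq_iff_eq_add, cov_frame cov hz,
    mvfderiv_frame hz ((mdifferentiableAt_section_iff hz).1 hX)] at h
  rw [h, map_add]
  simp [add_comm]

omit [FiniteDimensional ℝ E] in
theorem cov_congr {X Y : ∀ y : M, TangentSpace I y} 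
    (hX : MDifferentiableAt I (I.prod 𝓘(ℝ, E)) (fun y ↦ (⟨y, X y⟩ : TangentBundle I M)) z)
    (h : ∀ᶠ y in 𝓝 z, X y = Y y) : cov X z = cov Y z := by
  have hY : MDifferentiableAt I (I.prod 𝓘(ℝ, E)) (fun y ↦ (⟨y, Y y⟩ : TangentBundle I M)) z := by
    refine hX.congr_of_eventuallyEq ?_
    filter_upwards [h] with y hy
    rw [hy]
  exact (cov.isCovariantDerivativeOn (s := univ)).congr_of_eventuallyEq hX hY univ_mem h

variable [T2Space M]

/-- Smoothness of the connection is applied to a smooth global field: the frame field is multiplied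
by a bump function equal to 1 near x₀. Locality of ∇ then removes the cutoff. -/
theorem contMDiffAt_cov (hs : ContMDiffCovariantDerivativeOn E ∞ cov.toFun (univ : Set M))
    (b : E) :
    ContMDiffAt I (I.prod 𝓘(ℝ, E →L[ℝ] E)) ∞
      (fun y : M ↦ (TotalSpace.mk' (E →L[ℝ] E) y (cov (fun x ↦ frame I x₀ x b) y) :
      TotalSpace (E →L[ℝ] E) (fun x : M ↦ TangentSpace I x →L[ℝ] TangentSpace I x))) x₀ := by
  have : IsManifold I (∞ + 1) M := by simpa
  let f : SmoothBumpFunction I x₀ := Classical.arbitrary _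
  have h1 : ContMDiffOn I (I.prod 𝓘(ℝ, E)) ∞
      (fun y ↦ (⟨y, f y • frame I x₀ y b⟩ : TangentBundle I M)) univ := by
    intro z _
    apply ContMDiffAt.contMDiffWithinAt
    by_cases hz : z ∈ tsupport f
    · have hz' : z ∈ (extChartAt I x₀).source := by
        rw [extChartAt_source]
        exact f.tsupport_subset_chartAt_source hz
      exact (f.contMDiff z).smul_section (contMDiffAt_frame hz' b)
    · have h0 := contMDiffAt_zeroSection (IB := I) (n := ∞) ℝ (TangentSpace I : M → Type _)
        (F := E) (x := z)
      refine h0.congr_of_eventuallyEq ?_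
      filter_upwards [(isClosed_tsupport f).isOpen_compl.mem_nhds hz] with y hy
      simp [image_eq_zero_of_notMem_tsupport hy, zeroSection]
  have h2 := (hs.contMDiff (σ := fun y ↦ f y • frame I x₀ y b) (by simpa using h1)).contMDiffAt
    (x := x₀) univ_mem
  refine h2.congr_of_eventuallyEq ?_
  filter_upwards [f.eventuallyEq_one.eventually_nhds, source_mem_nhds (mem_extChartAt_source (I := I) x₀)]
    with y hy hy'
  congr 1
  apply cov_congr cov (mdifferentiableAt_frame hy' b)
  filter_upwards [hy] with w hw
  simp [hw]

theorem contMDiffAt_christoffelAt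
    (hs : ContMDiffCovariantDerivativeOn E ∞ cov.toFun (univ : Set M)) :
    ContMDiffAt I 𝓘(ℝ, E →L[ℝ] E →L[ℝ] E) ∞ (christoffelAt cov x₀) x₀ := by
  unfold christoffelAt
  apply ContMDiffAt.sum
  intro i _
  have h1 := ((contMDiffAt_hom_bundle _).1
    (contMDiffAt_cov cov hs (x₀ := x₀) (Module.finBasis ℝ E i))).2
  exact (contMDiffAt_const (c := ContinuousLinearMap.smulRightL ℝ E E
    ((Module.finBasis ℝ E).coord i).toContinuousLinearMap)).clm_comp h1

theorem contDiffAt_christoffel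
    (hs : ContMDiffCovariantDerivativeOn E ∞ cov.toFun (univ : Set M))
    (hx : range I ∈ 𝓝 (extChartAt I x₀ x₀)) :
    ContDiffAt ℝ ∞ (christoffel cov x₀) (extChartAt I x₀ x₀) :=
  ((contMDiffAt_iff_chart le_rfl (mem_extChartAt_source x₀)).1
    (contMDiffAt_christoffelAt cov hs)).contDiffAt hx

end Christoffel

open Chart

/-! ### The Hessian in coordinates, up to the boundary -/

section Within

variable {E : Type*} [NormedAddCommGroup E] [NormedSpace ℝ E] [FiniteDimensional ℝ E]
  {H : Type*} [TopologicalSpace H] {I : ModelWithCorners ℝ E H}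
  {M : Type*} [TopologicalSpace M] [ChartedSpace H M] [IsManifold I ∞ M]
  {x₀ z : M} (cov : CovariantDerivative I E (fun x : M ↦ TangentSpace I x))

omit [FiniteDimensional ℝ E] in
theorem covDeriv_scalarTensor (u : M → ℝ) (z : M) (v : Fin 1 → TangentSpace I z) :
    covDeriv cov (scalarTensor u) z v = mvfderiv I u z (v 0) := by
  simp [covDeriv, scalarTensor]

omit [FiniteDimensional ℝ E] in
theorem hess_eq (u : M → ℝ) (z : M) (v w : TangentSpace I z) :
    hess cov u z v w = mvfderiv I (fun y ↦ mvfderiv I u y (FiberBundle.extend E v y)) z w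
      - mvfderiv I u z (cov (FiberBundle.extend E v) z w) := by
  simp [hess, covDeriv, scalarTensor]

/-- Derivatives are taken within the range of the model, so boundary points are included. The test
function has to be continuous on all of M for its maximum to exist. -/
theorem hess_frame_within {u : M → ℝ} (hz : z ∈ (extChartAt I x₀).source)
    (hu : ContMDiff I 𝓘(ℝ, ℝ) 2 u) (a b : E) :
    hess cov u z (frame I x₀ z b) (frame I x₀ z a)
      = fderivWithin ℝ (fderivWithin ℝ (u ∘ (extChartAt I x₀).symm) (range I)) (range I)
          (extChartAt I x₀ z) a b
        - fderivWithin ℝ (u ∘ (extChartAt I x₀).symm) (range I) (extChartAt I x₀ z)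
          (christoffelAt cov x₀ z a b) := by
  have hrange := extChartAt_target_subset_range (I := I) x₀ ((extChartAt I x₀).map_source hz)
  have hu' := I.uniqueDiffOn.uniqueDiffWithinAt hrange
  have hf := (contMDiffAt_iff_chart ENat.LEInfty.out hz).1 (hu z)
  have hdf : DifferentiableWithinAt ℝ (fderivWithin ℝ (u ∘ (extChartAt I x₀).symm) (range I))
      (range I) (extChartAt I x₀ z) :=
    (hf.fderivWithin_right (m := 1) I.uniqueDiffOn (by norm_num) hrange).differentiableWithinAt
      (by simp)
  set X : ∀ y : M, TangentSpace I y := FiberBundle.extend E (frame I x₀ z b) with hX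
  have hXd : MDifferentiableAt I (I.prod 𝓘(ℝ, E)) (fun y ↦ (⟨y, X y⟩ : TangentBundle I M)) z :=
    FiberBundle.mdifferentiableAt_extend I E _
  have hXz : X z = frame I x₀ z b := FiberBundle.extend_apply_self E _
  have hW := (mdifferentiableAt_iff_chart hz).1 ((mdifferentiableAt_section_iff hz).1 hXd)
  set W := (fun y ↦ coframe I x₀ y (X y)) ∘ (extChartAt I x₀).symm with hWdef
  have hinv := (extChartAt I x₀).left_inv hz
  have hWz : W (extChartAt I x₀ z) = b := by
    simp only [hWdef, Function.comp_def]
    rw [hinv, hXz, coframe_frame hz]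
  have hev : (fun y ↦ mvfderiv I u y (X y)) =ᶠ[𝓝 z] fun y ↦
      fderivWithin ℝ (u ∘ (extChartAt I x₀).symm) (range I) (extChartAt I x₀ y)
        (coframe I x₀ y (X y)) := by
    filter_upwards [source_mem_nhds hz] with y hy
    rw [← mvfderiv_frame hy ((hu y).mdifferentiableAt (by simp)), frame_coframe hy]
  have hev' : ((fun y ↦ mvfderiv I u y (X y)) ∘ (extChartAt I x₀).symm)
      =ᶠ[𝓝[range I] (extChartAt I x₀ z)] fun w ↦
        fderivWithin ℝ (u ∘ (extChartAt I x₀).symm) (range I) w (W w) := by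
    have h1 : Tendsto (extChartAt I x₀).symm (𝓝[range I] (extChartAt I x₀ z)) (𝓝 z) := by
      have := (continuousAt_extChartAt_symm' (I := I) hz)
      rw [ContinuousAt, hinv] at this
      exact this.mono_left nhdsWithin_le_nhds
    filter_upwards [h1.eventually hev, extChartAt_target_mem_nhdsWithin' hz] with w hw hw'
    rw [hWdef, Function.comp_apply, Function.comp_apply, hw, (extChartAt I x₀).right_inv hw']
  have hcd : DifferentiableWithinAt ℝ (fun w ↦
      fderivWithin ℝ (u ∘ (extChartAt I x₀).symm) (range I) w (W w)) (range I)
      (extChartAt I x₀ z) := hdf.clm_apply hW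
  have hmd : MDifferentiableAt I 𝓘(ℝ, ℝ) (fun y ↦ mvfderiv I u y (X y)) z :=
    (mdifferentiableAt_iff_chart hz).2 (hcd.congr_of_eventuallyEq_of_mem hev' hrange)
  rw [hess_eq, ← hX, mvfderiv_frame hz hmd, hev'.fderivWithin_eq_of_mem hrange,
    cov_apply_frame cov hz hXd, mvfderiv_frame hz ((hu z).mdifferentiableAt (by simp)),
    fderivWithin_clm_apply hu' hdf hW, ← hWdef, hXz, coframe_frame hz, hWz, christoffel, hinv]
  simp

end Within

/-! ### Covariant derivatives in coordinates at interior points -/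

section Interior

variable {E : Type*} [NormedAddCommGroup E] [NormedSpace ℝ E]
  {H : Type*} [TopologicalSpace H] {I : ModelWithCorners ℝ E H}
  {M : Type*} [TopologicalSpace M] [ChartedSpace H M] [IsManifold I ∞ M]
  {F : Type*} [NormedAddCommGroup F] [NormedSpace ℝ F]
  {x₀ : M} {w : E} {n : WithTop ℕ∞}

variable (I) in
/-- The components of a vector field in the preferred chart at `x₀`. -/
noncomputable def rep (x₀ : M) (X : ∀ y : M, TangentSpace I y) (w : E) : E :=
  coframe I x₀ ((extChartAt I x₀).symm w) (X ((extChartAt I x₀).symm w))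

omit [IsManifold I ∞ M] in
theorem symm_mem_source (hw : w ∈ interior (extChartAt I x₀).target) :
    (extChartAt I x₀).symm w ∈ (extChartAt I x₀).source :=
  (extChartAt I x₀).map_target (interior_subset hw)

omit [IsManifold I ∞ M] in
theorem range_mem_nhds (hw : w ∈ interior (extChartAt I x₀).target) : range I ∈ 𝓝 w :=
  mem_of_superset (mem_interior_iff_mem_nhds.1 hw) (extChartAt_target_subset_range x₀)

omit [IsManifold I ∞ M] in
theorem eventually_mem_interior (hw : w ∈ interior (extChartAt I x₀).target) :
    ∀ᶠ w' in 𝓝 w, w' ∈ interior (extChartAt I x₀).target :=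
  isOpen_interior.mem_nhds hw

theorem frame_rep (X : ∀ y : M, TangentSpace I y) (hw : w ∈ interior (extChartAt I x₀).target) :
    frame I x₀ ((extChartAt I x₀).symm w) (rep I x₀ X w) = X ((extChartAt I x₀).symm w) :=
  frame_coframe (symm_mem_source hw) _

theorem contDiffAt_of_contMDiffAt {f : M → F} (hn : n ≤ ∞)
    (hw : w ∈ interior (extChartAt I x₀).target)
    (hf : ContMDiffAt I 𝓘(ℝ, F) n f ((extChartAt I x₀).symm w)) :
    ContDiffAt ℝ n (f ∘ (extChartAt I x₀).symm) w := by
  have := (contMDiffAt_iff_chart hn (symm_mem_source hw)).1 hf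
  rw [(extChartAt I x₀).right_inv (interior_subset hw)] at this
  exact this.contDiffAt (range_mem_nhds hw)

theorem mdifferentiableAt_chart_iff {f : M → F} (hw : w ∈ interior (extChartAt I x₀).target) :
    MDifferentiableAt I 𝓘(ℝ, F) f ((extChartAt I x₀).symm w) ↔
      DifferentiableAt ℝ (f ∘ (extChartAt I x₀).symm) w := by
  rw [mdifferentiableAt_iff_chart (symm_mem_source hw),
    (extChartAt I x₀).right_inv (interior_subset hw)]
  exact ⟨fun h ↦ h.differentiableAt (range_mem_nhds hw), fun h ↦ h.differentiableWithinAt⟩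

theorem mdifferentiableAt_iff_rep {X : ∀ y : M, TangentSpace I y}
    (hw : w ∈ interior (extChartAt I x₀).target) :
    MDifferentiableAt I (I.prod 𝓘(ℝ, E)) (fun y ↦ (⟨y, X y⟩ : TangentBundle I M))
      ((extChartAt I x₀).symm w) ↔ DifferentiableAt ℝ (rep I x₀ X) w := by
  rw [mdifferentiableAt_section_iff (symm_mem_source hw), mdifferentiableAt_chart_iff hw]
  rfl

theorem contDiffAt_rep {X : ∀ y : M, TangentSpace I y}
    (hw : w ∈ interior (extChartAt I x₀).target)
    (hX : ContMDiffAt I (I.prod 𝓘(ℝ, E)) ∞ (fun y ↦ (⟨y, X y⟩ : TangentBundle I M))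
      ((extChartAt I x₀).symm w)) : ContDiffAt ℝ ∞ (rep I x₀ X) w := by
  have : IsManifold I (∞ + 1) M := by simpa
  exact contDiffAt_of_contMDiffAt le_rfl hw
    ((contMDiffAt_section_iff (symm_mem_source hw)).1 hX)

theorem mvfderiv_chart {f : M → F} (hw : w ∈ interior (extChartAt I x₀).target)
    (hf : DifferentiableAt ℝ (f ∘ (extChartAt I x₀).symm) w) (a : E) :
    mvfderiv I f ((extChartAt I x₀).symm w) (frame I x₀ ((extChartAt I x₀).symm w) a)
      = fderiv ℝ (f ∘ (extChartAt I x₀).symm) w a := by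
  rw [mvfderiv_frame (symm_mem_source hw) ((mdifferentiableAt_chart_iff hw).2 hf),
    (extChartAt I x₀).right_inv (interior_subset hw),
    fderivWithin_of_mem_nhds (range_mem_nhds hw)]

variable [FiniteDimensional ℝ E] (cov : CovariantDerivative I E (fun x : M ↦ TangentSpace I x))

theorem cov_chart {X : ∀ y : M, TangentSpace I y} (hw : w ∈ interior (extChartAt I x₀).target)
    (hX : DifferentiableAt ℝ (rep I x₀ X) w) (a : E) :
    cov X ((extChartAt I x₀).symm w) (frame I x₀ ((extChartAt I x₀).symm w) a)
      = frame I x₀ ((extChartAt I x₀).symm w)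
        (fderiv ℝ (rep I x₀ X) w a + christoffel cov x₀ w a (rep I x₀ X w)) := by
  rw [cov_apply_frame cov (symm_mem_source hw) ((mdifferentiableAt_iff_rep hw).2 hX),
    (extChartAt I x₀).right_inv (interior_subset hw),
    fderivWithin_of_mem_nhds (range_mem_nhds hw)]
  rfl

omit [FiniteDimensional ℝ E] in
theorem differentiableAt_rep_extend (hw : w ∈ interior (extChartAt I x₀).target)
    (v : TangentSpace I ((extChartAt I x₀).symm w)) :
    DifferentiableAt ℝ (rep I x₀ (FiberBundle.extend E v)) w :=
  (mdifferentiableAt_iff_rep hw).1 (FiberBundle.mdifferentiableAt_extend I E _)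

omit [FiniteDimensional ℝ E] in
theorem rep_extend (hw : w ∈ interior (extChartAt I x₀).target) (a : E) :
    rep I x₀ (FiberBundle.extend E (frame I x₀ ((extChartAt I x₀).symm w) a)) w = a := by
  rw [rep, FiberBundle.extend_apply_self, coframe_frame (symm_mem_source hw)]

/-- The covariant derivative of a `1`-form in the chart. -/
theorem covDeriv_chart_one {A : CovTensor I M 1} {θ : E → E →L[ℝ] ℝ}
    (hw : w ∈ interior (extChartAt I x₀).target)
    (hA : ∀ᶠ w' in 𝓝 w, ∀ v : Fin 1 → E,
      A ((extChartAt I x₀).symm w') (fun i ↦ frame I x₀ _ (v i)) = θ w' (v 0))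
    (hθ : DifferentiableAt ℝ θ w) (v : Fin 2 → E) :
    covDeriv cov A ((extChartAt I x₀).symm w) (fun i ↦ frame I x₀ _ (v i))
      = nab1 (christoffel cov x₀) θ w (v 0) (v 1) := by
  set X : Fin 1 → ∀ y : M, TangentSpace I y := fun i ↦
    FiberBundle.extend E (frame I x₀ ((extChartAt I x₀).symm w) (v i.succ)) with hX
  have hXd : ∀ i, DifferentiableAt ℝ (rep I x₀ (X i)) w := fun i ↦
    differentiableAt_rep_extend hw _
  have hXw : ∀ i, rep I x₀ (X i) w = v i.succ := fun i ↦ rep_extend hw _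
  have hev : (fun y ↦ A y (fun i ↦ X i y)) ∘ (extChartAt I x₀).symm
      =ᶠ[𝓝 w] fun w' ↦ θ w' (rep I x₀ (X 0) w') := by
    filter_upwards [hA, eventually_mem_interior hw] with w' hw' hm
    have := hw' fun i ↦ rep I x₀ (X i) w'
    simp only [frame_rep _ hm] at this
    exact this
  have hd := hθ.hasFDerivAt.clm_apply (hXd 0).hasFDerivAt
  have hd' := hd.congr_of_eventuallyEq hev
  have hupd : ∀ (i : Fin 1) (c : E), A ((extChartAt I x₀).symm w) (Function.update
      (fun j : Fin 1 ↦ frame I x₀ ((extChartAt I x₀).symm w) (v j.succ)) i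
      (frame I x₀ ((extChartAt I x₀).symm w) c))
      = θ w (Function.update (fun j : Fin 1 ↦ v j.succ) i c 0) := by
    intro i c
    rw [← hA.self_of_nhds]
    congr 1
    funext j
    by_cases hj : j = i
    · subst hj
      simp
    · simp [hj]
  change mvfderiv I (fun y ↦ A y (fun i ↦ X i y)) ((extChartAt I x₀).symm w)
      (frame I x₀ ((extChartAt I x₀).symm w) (v 0))
    - ∑ i, A ((extChartAt I x₀).symm w) (Function.update
      (fun j : Fin 1 ↦ frame I x₀ ((extChartAt I x₀).symm w) (v j.succ)) i
      (cov (X i) ((extChartAt I x₀).symm w) (frame I x₀ ((extChartAt I x₀).symm w) (v 0)))) = _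
  rw [mvfderiv_chart hw hd'.differentiableAt, hd'.fderiv]
  simp only [cov_chart cov hw (hXd _), Fin.sum_univ_one, hupd, hXw, nab1_apply]
  simp

/-- The covariant derivative of a `2`-tensor in the chart. -/
theorem covDeriv_chart_two {A : CovTensor I M 2} {B : E → E →L[ℝ] E →L[ℝ] ℝ}
    (hw : w ∈ interior (extChartAt I x₀).target)
    (hA : ∀ᶠ w' in 𝓝 w, ∀ v : Fin 2 → E,
      A ((extChartAt I x₀).symm w') (fun i ↦ frame I x₀ _ (v i)) = B w' (v 0) (v 1))
    (hB : DifferentiableAt ℝ B w) (v : Fin 3 → E) :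
    covDeriv cov A ((extChartAt I x₀).symm w) (fun i ↦ frame I x₀ _ (v i))
      = nab2 (christoffel cov x₀) B w (v 0) (v 1) (v 2) := by
  set X : Fin 2 → ∀ y : M, TangentSpace I y := fun i ↦
    FiberBundle.extend E (frame I x₀ ((extChartAt I x₀).symm w) (v i.succ)) with hX
  have hXd : ∀ i, DifferentiableAt ℝ (rep I x₀ (X i)) w := fun i ↦
    differentiableAt_rep_extend hw _
  have hXw : ∀ i, rep I x₀ (X i) w = v i.succ := fun i ↦ rep_extend hw _
  have hev : (fun y ↦ A y (fun i ↦ X i y)) ∘ (extChartAt I x₀).symm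
      =ᶠ[𝓝 w] fun w' ↦ B w' (rep I x₀ (X 0) w') (rep I x₀ (X 1) w') := by
    filter_upwards [hA, eventually_mem_interior hw] with w' hw' hm
    have := hw' fun i ↦ rep I x₀ (X i) w'
    simp only [frame_rep _ hm] at this
    exact this
  have hd := (hB.hasFDerivAt.clm_apply (hXd 0).hasFDerivAt).clm_apply (hXd 1).hasFDerivAt
  have hd' := hd.congr_of_eventuallyEq hev
  have hupd : ∀ (i : Fin 2) (c : E), A ((extChartAt I x₀).symm w) (Function.update
      (fun j : Fin 2 ↦ frame I x₀ ((extChartAt I x₀).symm w) (v j.succ)) i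
      (frame I x₀ ((extChartAt I x₀).symm w) c))
      = B w (Function.update (fun j : Fin 2 ↦ v j.succ) i c 0)
        (Function.update (fun j : Fin 2 ↦ v j.succ) i c 1) := by
    intro i c
    rw [← hA.self_of_nhds]
    congr 1
    funext j
    by_cases hj : j = i
    · subst hj
      simp
    · simp [hj]
  change mvfderiv I (fun y ↦ A y (fun i ↦ X i y)) ((extChartAt I x₀).symm w)
      (frame I x₀ ((extChartAt I x₀).symm w) (v 0))
    - ∑ i, A ((extChartAt I x₀).symm w) (Function.update
      (fun j : Fin 2 ↦ frame I x₀ ((extChartAt I x₀).symm w) (v j.succ)) i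
      (cov (X i) ((extChartAt I x₀).symm w) (frame I x₀ ((extChartAt I x₀).symm w) (v 0)))) = _
  rw [mvfderiv_chart hw hd'.differentiableAt, hd'.fderiv]
  simp only [cov_chart cov hw (hXd _), Fin.sum_univ_two, hupd, hXw, nab2_apply]
  simp
  ring

/-- The covariant derivative of a tensor at the center of the chart. -/
theorem covDeriv_center {k : ℕ} {A : CovTensor I M k}
    (hx : extChartAt I x₀ x₀ ∈ interior (extChartAt I x₀).target) (v : Fin (k + 1) → E)
    (hd : DifferentiableAt ℝ (fun w ↦ A ((extChartAt I x₀).symm w)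
      (fun i ↦ frame I x₀ _ (v i.succ))) (extChartAt I x₀ x₀)) :
    covDeriv cov A x₀ (fun i ↦ frame I x₀ x₀ (v i))
      = fderiv ℝ (fun w ↦ A ((extChartAt I x₀).symm w) (fun i ↦ frame I x₀ _ (v i.succ)))
          (extChartAt I x₀ x₀) (v 0)
        - ∑ i, A x₀ (fun j ↦ frame I x₀ x₀ (Function.update (fun j ↦ v j.succ) i
          (christoffel cov x₀ (extChartAt I x₀ x₀) (v 0) (v i.succ)) j)) := by
  have hs := mem_extChartAt_source (I := I) x₀
  have hext : ∀ i : Fin k, ∀ᶠ y in 𝓝 x₀,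
      (FiberBundle.extend E (frame I x₀ x₀ (v i.succ)) : ∀ y : M, TangentSpace I y) y
        = frame I x₀ y (v i.succ) := by
    intro i
    filter_upwards [source_mem_nhds hs] with y hy
    rw [extend_eq_frame _ hy, coframe_frame hs]
  have hev : (fun y ↦ A y (fun i ↦ FiberBundle.extend E (frame I x₀ x₀ (v i.succ)) y))
      =ᶠ[𝓝 x₀] fun y ↦ A y (fun i ↦ frame I x₀ y (v i.succ)) := by
    filter_upwards [eventually_all.2 hext] with y hy
    simp only [hy]
  have hmd : MDifferentiableAt I 𝓘(ℝ, ℝ) (fun y ↦ A y (fun i ↦ frame I x₀ y (v i.succ))) x₀ :=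
    (mdifferentiableAt_iff_chart hs).2 hd.differentiableWithinAt
  have hcov : ∀ i : Fin k, cov (FiberBundle.extend E (frame I x₀ x₀ (v i.succ))) x₀
      (frame I x₀ x₀ (v 0))
      = frame I x₀ x₀ (christoffel cov x₀ (extChartAt I x₀ x₀) (v 0) (v i.succ)) := by
    intro i
    rw [cov_congr cov (FiberBundle.mdifferentiableAt_extend I E _) (hext i), cov_frame cov hs]
  have hupd : ∀ (i : Fin k) (c : E), Function.update
      (fun j : Fin k ↦ frame I x₀ x₀ (v j.succ)) i (frame I x₀ x₀ c)
      = fun j ↦ frame I x₀ x₀ (Function.update (fun j ↦ v j.succ) i c j) := by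
    intro i c
    funext j
    by_cases hj : j = i
    · subst hj
      simp
    · simp [hj]
  simp only [covDeriv, hcov, hupd]
  rw [mvfderiv, hev.mfderiv_eq]
  congr 1
  have := mvfderiv_frame hs hmd (v 0)
  rw [fderivWithin_of_mem_nhds (range_mem_nhds hx)] at this
  exact this

omit [FiniteDimensional ℝ E] in
theorem covDeriv_scalarTensor_chart {u : M → ℝ} (hw : w ∈ interior (extChartAt I x₀).target)
    (hu : DifferentiableAt ℝ (u ∘ (extChartAt I x₀).symm) w) (v : Fin 1 → E) :
    covDeriv cov (scalarTensor u) ((extChartAt I x₀).symm w) (fun i ↦ frame I x₀ _ (v i))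
      = fderiv ℝ (u ∘ (extChartAt I x₀).symm) w (v 0) := by
  rw [covDeriv_scalarTensor, mvfderiv_chart hw hu]

theorem covDeriv_covDeriv_scalarTensor_chart {u : M → ℝ}
    (hw : w ∈ interior (extChartAt I x₀).target)
    (hu : ContDiffAt ℝ 2 (u ∘ (extChartAt I x₀).symm) w) (v : Fin 2 → E) :
    covDeriv cov (covDeriv cov (scalarTensor u)) ((extChartAt I x₀).symm w)
        (fun i ↦ frame I x₀ _ (v i))
      = nab1 (christoffel cov x₀) (fderiv ℝ (u ∘ (extChartAt I x₀).symm)) w (v 0) (v 1) := by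
  apply covDeriv_chart_one cov hw
  · filter_upwards [hu.eventually (by simp), eventually_mem_interior hw] with w' hw' hm v
    exact covDeriv_scalarTensor_chart cov hm (hw'.differentiableAt (by simp)) v
  · exact (hu.fderiv_right (m := 1) (by norm_num)).differentiableAt (by simp)

theorem hess_chart {u : M → ℝ} (hw : w ∈ interior (extChartAt I x₀).target)
    (hu : ContDiffAt ℝ 2 (u ∘ (extChartAt I x₀).symm) w) (a b : E) :
    hess cov u ((extChartAt I x₀).symm w) (frame I x₀ _ b) (frame I x₀ _ a)
      = nab1 (christoffel cov x₀) (fderiv ℝ (u ∘ (extChartAt I x₀).symm)) w a b := by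
  have := covDeriv_covDeriv_scalarTensor_chart cov hw hu ![a, b]
  rw [hess]
  refine Eq.trans ?_ this
  congr 1
  funext i
  fin_cases i <;> rfl

end Interior

/-! ### Torsion and curvature in coordinates -/

section Curvature

variable {E : Type*} [NormedAddCommGroup E] [NormedSpace ℝ E] [FiniteDimensional ℝ E]
  {H : Type*} [TopologicalSpace H] {I : ModelWithCorners ℝ E H}
  {M : Type*} [TopologicalSpace M] [ChartedSpace H M] [IsManifold I ∞ M]
  {x₀ z : M} {w : E} (cov : CovariantDerivative I E (fun x : M ↦ TangentSpace I x))

/-- Near z the frame fields are pullbacks under the chart of constant fields on E, and pullback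
commutes with the bracket. -/
theorem mlieBracket_frame (hz : z ∈ (extChartAt I x₀).source) (a b : E) :
    VectorField.mlieBracket I (fun y ↦ frame I x₀ y a) (fun y ↦ frame I x₀ y b) z = 0 := by
  have : IsManifold I (minSmoothness ℝ 3) M := .of_le (n := ∞) (by simp; exact ENat.LEInfty.out)
  have : IsManifold I 1 M := .of_le (n := ∞) (by simp)
  let V : E → ∀ y : E, TangentSpace 𝓘(ℝ, E) y := fun a _ ↦ a
  have hpull : ∀ a : E, ∀ᶠ y in 𝓝 z, frame I x₀ y a =
      VectorField.mpullback I 𝓘(ℝ, E) (extChartAt I x₀) (V a) y := by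
    intro a
    filter_upwards [source_mem_nhds hz] with y hy
    have hy' : y ∈ (chartAt H x₀).source := by simpa using hy
    obtain ⟨L, hL⟩ := isInvertible_mfderiv_extChartAt hy
    have h2 := TangentBundle.continuousLinearMapAt_trivializationAt (I := I) hy'
    have h3 : coframe I x₀ y (frame I x₀ y a) = a := coframe_frame hy a
    rw [coframe, h2, ← hL] at h3
    have h4 : VectorField.mpullback I 𝓘(ℝ, E) (extChartAt I x₀) (V a) y = L.symm a := by
      rw [VectorField.mpullback_apply, ← hL, ContinuousLinearMap.inverse_equiv]
      rfl
    rw [h4]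
    exact (L.eq_symm_apply).2 h3
  have hd : ∀ a : E, MDifferentiableAt 𝓘(ℝ, E) (𝓘(ℝ, E).prod 𝓘(ℝ, E))
      (fun y : E ↦ (⟨y, V a y⟩ : TangentBundle 𝓘(ℝ, E) E)) (extChartAt I x₀ z) := fun a ↦
    (contMDiffAt_vectorSpace_iff_contDiffAt (n := 1).2 contDiffAt_const).mdifferentiableAt (by simp)
  rw [Filter.EventuallyEq.mlieBracket_vectorField_eq (hpull a) (hpull b),
    ← VectorField.mpullback_mlieBracket (n := ∞) (hd a) (hd b)
      (contMDiffAt_extChartAt' (by simpa using hz)) (by simp; exact ENat.LEInfty.out)]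
  have h0 : VectorField.mlieBracket 𝓘(ℝ, E) (V a) (V b) = 0 := by
    rw [← VectorField.mlieBracketWithin_univ, VectorField.mlieBracketWithin_eq_lieBracketWithin]
    funext y
    simp [VectorField.lieBracketWithin, V]
    rfl
  rw [h0, VectorField.mpullback_zero]
  rfl

theorem torsion_chart (hw : w ∈ interior (extChartAt I x₀).target) (a b : E) :
    cov.torsion ((extChartAt I x₀).symm w) (frame I x₀ _ a) (frame I x₀ _ b)
      = frame I x₀ _ (tor (christoffel cov x₀) w a b) := by
  have hz := symm_mem_source hw
  rw [cov.torsion_apply (mdifferentiableAt_frame hz a) (mdifferentiableAt_frame hz b),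
    mlieBracket_frame hz, cov_frame cov hz, cov_frame cov hz,
    (extChartAt I x₀).right_inv (interior_subset hw), sub_zero, ← map_sub]
  rfl

/-- Read off from [X, Y] = ∇_X Y - ∇_Y X - T(X, Y), where the right side is already known in
coordinates; the Christoffel terms cancel against the torsion. -/
theorem mlieBracket_chart (cov : CovariantDerivative I E (fun x : M ↦ TangentSpace I x))
    {X Y : ∀ y : M, TangentSpace I y}
    (hw : w ∈ interior (extChartAt I x₀).target)
    (hX : DifferentiableAt ℝ (rep I x₀ X) w) (hY : DifferentiableAt ℝ (rep I x₀ Y) w) :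
    VectorField.mlieBracket I X Y ((extChartAt I x₀).symm w) = frame I x₀ _
      (fderiv ℝ (rep I x₀ Y) w (rep I x₀ X w) - fderiv ℝ (rep I x₀ X) w (rep I x₀ Y w)) := by
  have h := cov.torsion_apply ((mdifferentiableAt_iff_rep hw).2 hX)
    ((mdifferentiableAt_iff_rep hw).2 hY)
  rw [← frame_rep X hw, ← frame_rep Y hw, torsion_chart cov hw, cov_chart cov hw hX,
    cov_chart cov hw hY, eq_sub_iff_add_eq, ← eq_sub_iff_add_eq'] at h
  rw [h, ← map_sub, ← map_sub]
  congr 1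
  simp [tor]
  abel

/-- The extensions X, Y, Z need not have constant components near w. Their derivatives enter the
computation and cancel, those of second order by the symmetry of the second derivative of Z. -/
theorem curvature_chart (hΓ : ContDiffAt ℝ 1 (christoffel cov x₀) w)
    (hw : w ∈ interior (extChartAt I x₀).target) (a b c : E) :
    curvature cov ((extChartAt I x₀).symm w) (frame I x₀ _ a) (frame I x₀ _ b) (frame I x₀ _ c)
      = frame I x₀ _ (curv (christoffel cov x₀) w a b c) := by
  have : IsManifold I (∞ + 1) M := by simpa
  have hsm : ∀ v : E, ContDiffAt ℝ ∞
      (rep I x₀ (FiberBundle.extend E (frame I x₀ ((extChartAt I x₀).symm w) v))) w := fun v ↦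
    contDiffAt_rep hw (FiberBundle.contMDiffAt_extend I E _)
  have hX := hsm a
  have hY := hsm b
  have hZ := hsm c
  have hXw := rep_extend hw a
  have hYw := rep_extend hw b
  have hZw := rep_extend hw c
  unfold curvature
  extract_lets X Y Z
  change ContDiffAt ℝ ∞ (rep I x₀ X) w at hX
  change ContDiffAt ℝ ∞ (rep I x₀ Y) w at hY
  change ContDiffAt ℝ ∞ (rep I x₀ Z) w at hZ
  change rep I x₀ X w = a at hXw
  change rep I x₀ Y w = b at hYw
  change rep I x₀ Z w = c at hZw
  have hXd := hX.differentiableAt (by simp)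
  have hYd := hY.differentiableAt (by simp)
  have hZd := hZ.differentiableAt (by simp)
  have hZ2 : ContDiffAt ℝ 1 (fderiv ℝ (rep I x₀ Z)) w :=
    hZ.fderiv_right (by norm_num; exact ENat.LEInfty.out)
  have hZ2d := hZ2.differentiableAt (by simp)
  have hΓd := hΓ.differentiableAt (by simp)
  have key : ∀ X : ∀ y : M, TangentSpace I y, rep I x₀ (fun y ↦ cov Z y (X y)) =ᶠ[𝓝 w]
      fun w ↦ fderiv ℝ (rep I x₀ Z) w (rep I x₀ X w)
        + christoffel cov x₀ w (rep I x₀ X w) (rep I x₀ Z w) := by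
    intro X
    filter_upwards [eventually_mem_interior hw,
      (hZ.of_le (m := 1) ENat.LEInfty.out).eventually (by simp)] with w' hw' hZ'
    rw [rep, ← frame_rep X hw', cov_chart cov hw' (hZ'.differentiableAt (by simp)),
      coframe_frame (symm_mem_source hw')]
  have hder : ∀ X : ∀ y : M, TangentSpace I y, DifferentiableAt ℝ (rep I x₀ X) w →
      HasFDerivAt (rep I x₀ (fun y ↦ cov Z y (X y))) _ w := fun X hXd ↦
    ((hZ2d.hasFDerivAt.clm_apply hXd.hasFDerivAt).add
      ((hΓd.hasFDerivAt.clm_apply hXd.hasFDerivAt).clm_apply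
        hZd.hasFDerivAt)).congr_of_eventuallyEq (key X)
  have hsymm := (hZ.of_le (m := 2) ENat.LEInfty.out).isSymmSndFDerivAt (by simp) a b
  rw [mlieBracket_chart cov hw hXd hYd, cov_chart cov hw hZd,
    cov_chart cov hw (hder Y hYd).differentiableAt, cov_chart cov hw (hder X hXd).differentiableAt,
    (hder X hXd).fderiv, (hder Y hYd).fderiv, (key X).self_of_nhds, (key Y).self_of_nhds, hXw, hYw,
    hZw, ← map_sub, ← map_sub]
  congr 1
  simp [curv, hsymm, hXw, hYw, hZw]
  abel

end Curvature

/-! ### Metric and complex structure in coordinates -/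

section Hermitian

variable {E : Type*} [NormedAddCommGroup E] [NormedSpace ℝ E] [FiniteDimensional ℝ E]
  {H : Type*} [TopologicalSpace H] {I : ModelWithCorners ℝ E H}
  {M : Type*} [TopologicalSpace M] [ChartedSpace H M] [IsManifold I ∞ M]
  [RiemannianBundle (fun x : M ↦ TangentSpace I x)]
  {x₀ z : M} {w : E} {J : ∀ x : M, TangentSpace I x →L[ℝ] TangentSpace I x}
  {cov : CovariantDerivative I E (fun x : M ↦ TangentSpace I x)}

/-- The complex structure in the preferred chart at `x₀`. -/
noncomputable def repJ (J : ∀ x : M, TangentSpace I x →L[ℝ] TangentSpace I x) (x₀ : M) (w : E) :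
    E →L[ℝ] E :=
  (coframe I x₀ ((extChartAt I x₀).symm w)).comp
    ((J ((extChartAt I x₀).symm w)).comp (frame I x₀ ((extChartAt I x₀).symm w)))

variable (I) in
/-- The metric in the preferred chart at `x₀`. -/
noncomputable def repG (x₀ : M) (w : E) : E →L[ℝ] E →L[ℝ] ℝ :=
  (innerSL ℝ (E := TangentSpace I ((extChartAt I x₀).symm w))).bilinearComp
    (frame I x₀ ((extChartAt I x₀).symm w)) (frame I x₀ ((extChartAt I x₀).symm w))

omit [FiniteDimensional ℝ E] in
theorem repG_apply (x₀ : M) (w : E) (a b : E) :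
    repG I x₀ w a b = inner ℝ (frame I x₀ ((extChartAt I x₀).symm w) a)
      (frame I x₀ ((extChartAt I x₀).symm w) b) := rfl

omit [FiniteDimensional ℝ E] [RiemannianBundle fun x : M ↦ TangentSpace I x] in
theorem frame_repJ (hw : w ∈ interior (extChartAt I x₀).target) (a : E) :
    frame I x₀ ((extChartAt I x₀).symm w) (repJ J x₀ w a)
      = J ((extChartAt I x₀).symm w) (frame I x₀ ((extChartAt I x₀).symm w) a) :=
  frame_coframe (symm_mem_source hw) _

end Hermitian

theorem contDiffAt_clm_of_apply {D E F : Type*} [NormedAddCommGroup D] [NormedSpace ℝ D]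
    [NormedAddCommGroup E] [NormedSpace ℝ E] [FiniteDimensional ℝ E]
    [NormedAddCommGroup F] [NormedSpace ℝ F] {f : D → E →L[ℝ] F} {x : D} {n : WithTop ℕ∞}
    (h : ∀ v, ContDiffAt ℝ n (fun y ↦ f y v) x) : ContDiffAt ℝ n f x := by
  have hd : Module.finrank ℝ E = Module.finrank ℝ (Fin (Module.finrank ℝ E) → ℝ) :=
    (Module.finrank_fin_fun ℝ).symm
  let e₁ := ContinuousLinearEquiv.ofFinrankEq hd
  let e₂ := (e₁.arrowCongr (1 : F ≃L[ℝ] F)).trans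
    (ContinuousLinearEquiv.piRing (Fin (Module.finrank ℝ E)))
  rw [← Function.id_comp f, ← e₂.symm_comp_self]
  exact e₂.symm.contDiff.contDiffAt.comp x (contDiffAt_pi.2 fun i ↦ h _)

/-! ### The equation in coordinates -/

section ChartData

variable {E : Type*} [NormedAddCommGroup E] [NormedSpace ℝ E] [FiniteDimensional ℝ E]
  {H : Type*} [TopologicalSpace H] {I : ModelWithCorners ℝ E H}
  {M : Type*} [TopologicalSpace M] [ChartedSpace H M] [IsManifold I ∞ M]
  {x₀ z : M} {w : E} {J : ∀ x : M, TangentSpace I x →L[ℝ] TangentSpace I x}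
  {cov : CovariantDerivative I E (fun x : M ↦ TangentSpace I x)}
  {χ : ∀ x : M, ℝ → TangentSpace I x →L[ℝ] TangentSpace I x →L[ℝ] ℝ} {ψ : M → ℝ → ℝ} {u : M → ℝ}

omit [FiniteDimensional ℝ E] in
theorem component_frame (hw : w ∈ interior (extChartAt I x₀).target)
    (h : TangentSpace I ((extChartAt I x₀).symm w) → TangentSpace I ((extChartAt I x₀).symm w) → ℝ)
    (a b : E) :
    component J ((extChartAt I x₀).symm w) h (frame I x₀ _ a) (frame I x₀ _ b)
      = herm (repJ J x₀ w) (fun a b ↦ h (frame I x₀ _ a) (frame I x₀ _ b)) a b := by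
  simp only [component, herm, frame_repJ hw]

omit [FiniteDimensional ℝ E] in
theorem contDiffAt_param {f : M → ℝ → ℝ} (hw : w ∈ interior (extChartAt I x₀).target) {t : ℝ}
    (hf : ContMDiffAt (I.prod 𝓘(ℝ, ℝ)) 𝓘(ℝ, ℝ) ∞ (fun q : M × ℝ ↦ f q.1 q.2)
      ((extChartAt I x₀).symm w, t)) :
    ContDiffAt ℝ ∞ (fun p : E × ℝ ↦ f ((extChartAt I x₀).symm p.1) p.2) (w, t) := by
  rw [← contMDiffAt_iff_contDiffAt]
  have h1 : ContMDiffAt 𝓘(ℝ, E) I ∞ (extChartAt I x₀).symm w :=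
    (contMDiffOn_extChartAt_symm x₀).contMDiffAt (mem_interior_iff_mem_nhds.1 hw)
  have h2 : ContMDiffAt 𝓘(ℝ, E × ℝ) (I.prod 𝓘(ℝ, ℝ)) ∞
      (fun p : E × ℝ ↦ ((extChartAt I x₀).symm p.1, p.2)) (w, t) :=
    (ContMDiffAt.comp (w, t) (f := fun p : E × ℝ ↦ p.1) h1 contDiffAt_fst.contMDiffAt).prodMk
      contDiffAt_snd.contMDiffAt
  exact ContMDiffAt.comp (w, t) (f := fun p : E × ℝ ↦ ((extChartAt I x₀).symm p.1, p.2)) hf h2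

/-- The family of forms in the preferred chart at `x₀`. -/
noncomputable def repForm
    (χ : ∀ x : M, ℝ → TangentSpace I x →L[ℝ] TangentSpace I x →L[ℝ] ℝ) (x₀ : M) (w : E) (t : ℝ) :
    E →L[ℝ] E →L[ℝ] ℝ :=
  (ContinuousLinearMap.precomp ℝ (frame I x₀ ((extChartAt I x₀).symm w))).comp
    ((χ ((extChartAt I x₀).symm w) t).comp (frame I x₀ ((extChartAt I x₀).symm w)))

omit [FiniteDimensional ℝ E] in
theorem repForm_apply (x₀ : M) (w : E) (t : ℝ) (a b : E) :
    repForm χ x₀ w t a b = χ ((extChartAt I x₀).symm w) t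
      (frame I x₀ ((extChartAt I x₀).symm w) a) (frame I x₀ ((extChartAt I x₀).symm w) b) := rfl

theorem contDiffAt_repForm (hχ : IsSmoothForm11 J χ)
    (hw : w ∈ interior (extChartAt I x₀).target) (t : ℝ) :
    ContDiffAt ℝ ∞ (fun p : E × ℝ ↦ repForm χ x₀ p.1 p.2) (w, t) := by
  refine contDiffAt_clm_of_apply fun a ↦ contDiffAt_clm_of_apply fun b ↦ ?_
  have hf : ∀ a : E, ContMDiffAt (I.prod 𝓘(ℝ, ℝ)) (I.prod 𝓘(ℝ, E)) ∞
      (fun q : M × ℝ ↦ (⟨q.1, frame I x₀ q.1 a⟩ : TangentBundle I M))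
      ((extChartAt I x₀).symm w, t) := fun a ↦
    ContMDiffAt.comp ((extChartAt I x₀).symm w, t) (f := fun q : M × ℝ ↦ q.1)
      (contMDiffAt_frame (symm_mem_source hw) a) contMDiffAt_fst
  have h : ContMDiffAt (I.prod 𝓘(ℝ, ℝ)) (I.prod 𝓘(ℝ)) ∞
      (fun q : M × ℝ ↦ TotalSpace.mk' ℝ (E := Bundle.Trivial M ℝ) q.1
        (χ q.1 q.2 (frame I x₀ q.1 a) (frame I x₀ q.1 b))) ((extChartAt I x₀).symm w, t) := by
    apply ContMDiffAt.clm_bundle_apply₂ (F₁ := E) (F₂ := E)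
    · exact hχ.contMDiff.contMDiffAt
    · exact hf a
    · exact hf b
  simp only [contMDiffAt_totalSpace] at h
  exact contDiffAt_param (f := fun z t ↦ χ z t (frame I x₀ z a) (frame I x₀ z b)) hw h.2

variable [RiemannianBundle (fun x : M ↦ TangentSpace I x)]

theorem contDiffAt_repG [IsContMDiffRiemannianBundle I ∞ E (fun x : M ↦ TangentSpace I x)]
    (hw : w ∈ interior (extChartAt I x₀).target) : ContDiffAt ℝ ∞ (repG I x₀) w := by
  refine contDiffAt_clm_of_apply fun a ↦ contDiffAt_clm_of_apply fun b ↦ ?_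
  have h : ContMDiffAt I 𝓘(ℝ, ℝ) ∞ (fun y ↦ inner ℝ (frame I x₀ y a) (frame I x₀ y b))
      ((extChartAt I x₀).symm w) :=
    ContMDiffAt.inner_bundle (E := fun x : M ↦ TangentSpace I x) (b := fun y ↦ y)
      (contMDiffAt_frame (symm_mem_source hw) a) (contMDiffAt_frame (symm_mem_source hw) b)
  exact contDiffAt_of_contMDiffAt le_rfl hw h

omit [FiniteDimensional ℝ E] in
theorem contMDiffAt_endo_frame (hJ : IsHermitian I J)
    (hw : w ∈ interior (extChartAt I x₀).target) (a : E) :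
    ContMDiffAt I (I.prod 𝓘(ℝ, E)) ∞
      (fun y ↦ (⟨y, J y (frame I x₀ y a)⟩ : TangentBundle I M)) ((extChartAt I x₀).symm w) :=
  hJ.contMDiff.contMDiffAt.clm_bundle_apply (contMDiffAt_frame (symm_mem_source hw) a)

theorem contDiffAt_repJ (hJ : IsHermitian I J)
    (hw : w ∈ interior (extChartAt I x₀).target) : ContDiffAt ℝ ∞ (repJ J x₀) w :=
  contDiffAt_clm_of_apply fun a ↦ contDiffAt_rep hw (contMDiffAt_endo_frame hJ hw a)

theorem fderiv_repJ (hJ : IsHermitian I J) (hc : IsChern J cov)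
    (hw : w ∈ interior (extChartAt I x₀).target) (a b : E) :
    fderiv ℝ (repJ J x₀) w a b = repJ J x₀ w (christoffel cov x₀ w a b)
      - christoffel cov x₀ w a (repJ J x₀ w b) := by
  have hz := symm_mem_source hw
  have hd := (contDiffAt_repJ hJ hw).differentiableAt (by simp)
  have h := hc.parallel _ _ (mdifferentiableAt_frame hz b) (frame I x₀ _ a)
  have hrep : rep I x₀ (fun y ↦ J y (frame I x₀ y b)) = fun w ↦ repJ J x₀ w b := rfl
  rw [cov_chart cov hw (by rw [hrep]; exact hd.clm_apply (differentiableAt_const b)),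
    cov_frame cov hz, hrep, (extChartAt I x₀).right_inv (interior_subset hw), ← frame_repJ hw] at h
  have h' := congrArg (coframe I x₀ ((extChartAt I x₀).symm w)) h
  rw [coframe_frame hz, coframe_frame hz, fderiv_clm_apply hd (differentiableAt_const b)] at h'
  rw [← h']
  simp

theorem nab2_repG [IsContMDiffRiemannianBundle I ∞ E (fun x : M ↦ TangentSpace I x)]
    (hc : IsChern J cov) (hw : w ∈ interior (extChartAt I x₀).target) :
    nab2 (christoffel cov x₀) (repG I x₀) w = 0 := by
  have hz := symm_mem_source hw
  have hd := (contDiffAt_repG (I := I) hw).differentiableAt (by simp)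
  ext a b c
  have h := hc.metric _ _ _ (mdifferentiableAt_frame hz b) (mdifferentiableAt_frame hz c)
    (frame I x₀ _ a)
  have hrep : (fun y ↦ inner ℝ (frame I x₀ y b) (frame I x₀ y c)) ∘ (extChartAt I x₀).symm
      = fun w ↦ repG I x₀ w b c := rfl
  have hd' : DifferentiableAt ℝ (fun w ↦ repG I x₀ w b c) w :=
    (hd.clm_apply (differentiableAt_const b)).clm_apply (differentiableAt_const c)
  rw [mvfderiv_chart hw (by rw [hrep]; exact hd'), hrep, cov_frame cov hz, cov_frame cov hz,
    ← repG_apply, ← repG_apply, (extChartAt I x₀).right_inv (interior_subset hw),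
    fderiv_clm_apply (hd.clm_apply (differentiableAt_const b)) (differentiableAt_const c),
    fderiv_clm_apply hd (differentiableAt_const b)] at h
  rw [nab2_apply]
  simp at h ⊢
  rw [h]
  ring

/-- The data of the equation in the preferred chart at `x₀`. -/
noncomputable def chartData (J : ∀ x : M, TangentSpace I x →L[ℝ] TangentSpace I x)
    (cov : CovariantDerivative I E (fun x : M ↦ TangentSpace I x))
    (χ : ∀ x : M, ℝ → TangentSpace I x →L[ℝ] TangentSpace I x →L[ℝ] ℝ) (ψ : M → ℝ → ℝ) (u : M → ℝ)
    (x₀ : M) : MAData E where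
  Γ := christoffel cov x₀
  J := repJ J x₀
  G := repG I x₀
  χ := repForm χ x₀
  ψ := fun w ↦ ψ ((extChartAt I x₀).symm w)
  f := u ∘ (extChartAt I x₀).symm

theorem herm_form_chartData (hu : ContMDiff I 𝓘(ℝ, ℝ) 4 u)
    (hw : w ∈ interior (extChartAt I x₀).target) (a b : E) :
    herm (repJ J x₀ w) ((chartData J cov χ ψ u x₀).form w) a b
      = formComp J ((extChartAt I x₀).symm w)
          (χ ((extChartAt I x₀).symm w) (u ((extChartAt I x₀).symm w)))
          (frame I x₀ ((extChartAt I x₀).symm w) a) (frame I x₀ ((extChartAt I x₀).symm w) b)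
        + hessComp J cov u ((extChartAt I x₀).symm w)
          (frame I x₀ ((extChartAt I x₀).symm w) a)
          (frame I x₀ ((extChartAt I x₀).symm w) b) := by
  have hu2 : ContDiffAt ℝ 2 (u ∘ (extChartAt I x₀).symm) w :=
    (contDiffAt_of_contMDiffAt ENat.LEInfty.out hw hu.contMDiffAt).of_le (by norm_num)
  rw [formComp, hessComp, component_frame hw, component_frame hw]
  simp only [herm, MAData.form, chartData, hess_chart cov hw hu2, ← frame_repJ hw,
    ← repForm_apply, Function.comp_apply]
  push_cast
  ring

theorem solves_chartData [IsContMDiffRiemannianBundle I ∞ E (fun x : M ↦ TangentSpace I x)]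
    [T2Space M] {n : ℕ} (hx : extChartAt I x₀ x₀ ∈ interior (extChartAt I x₀).target)
    (hJ : IsHermitian I J) (hc : IsChern J cov) (hχ : IsSmoothForm11 J χ)
    (hψ : ContMDiff (I.prod 𝓘(ℝ, ℝ)) 𝓘(ℝ, ℝ) ∞ (fun q : M × ℝ ↦ ψ q.1 q.2))
    (hu : ContMDiff I 𝓘(ℝ, ℝ) 4 u) (hs : SolvesMA n J cov χ ψ u) :
    (chartData J cov χ ψ u x₀).Solves n (extChartAt I x₀ x₀) where
  chern :=
    { smooth := (contDiffAt_christoffel cov hc.smooth (range_mem_nhds hx)).of_le ENat.LEInfty.out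
      diff := by
        filter_upwards [eventually_mem_interior hx] with w hw
        exact (contDiffAt_repJ hJ hw).differentiableAt (by simp)
      parallel := by
        filter_upwards [eventually_mem_interior hx] with w hw a b
        exact fderiv_repJ hJ hc hw a b
      sq := by
        filter_upwards [eventually_mem_interior hx] with w hw a
        have h := congrArg (coframe I x₀ ((extChartAt I x₀).symm w))
          (hJ.sq _ (frame I x₀ ((extChartAt I x₀).symm w) a))
        rw [← frame_repJ hw, ← frame_repJ hw, coframe_frame (symm_mem_source hw), map_neg,
          coframe_frame (symm_mem_source hw)] at h
        exact h
      torsion := by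
        filter_upwards [eventually_mem_interior hx] with w hw a b
        have h := congrArg (coframe I x₀ ((extChartAt I x₀).symm w))
          (hc.torsion _ (frame I x₀ ((extChartAt I x₀).symm w) a) (frame I x₀ _ b))
        rw [← frame_repJ hw, torsion_chart cov hw, torsion_chart cov hw, ← frame_repJ hw,
          coframe_frame (symm_mem_source hw), coframe_frame (symm_mem_source hw)] at h
        exact h }
  contDiff_f := contDiffAt_of_contMDiffAt ENat.LEInfty.out hx hu.contMDiffAt
  contDiff_χ := (contDiffAt_repForm hχ hx _).of_le ENat.LEInfty.out
  contDiff_ψ := (contDiffAt_param hx hψ.contMDiffAt).of_le ENat.LEInfty.out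
  contDiff_G := (contDiffAt_repG hx).of_le ENat.LEInfty.out
  metric := by
    filter_upwards [eventually_mem_interior hx] with w hw
    exact nab2_repG hc hw
  alternating := Eventually.of_forall fun w a b ↦ hχ.alternating _ _ _ _
  equation := by
    filter_upwards [eventually_mem_interior hx] with w hw e
    have h := hs ((extChartAt I x₀).symm w) fun j ↦ frame I x₀ _ (e j)
    have h1 : ∀ a b, herm ((chartData J cov χ ψ u x₀).J w) ((chartData J cov χ ψ u x₀).form w) a b
        = _ := herm_form_chartData hu hw
    have h2 : ∀ a b, herm ((chartData J cov χ ψ u x₀).J w)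
        (fun v w' ↦ (chartData J cov χ ψ u x₀).G w v w') a b
        = metricComp J ((extChartAt I x₀).symm w) (frame I x₀ _ a) (frame I x₀ _ b) := fun a b ↦
      (component_frame hw (fun a b ↦ inner ℝ a b) a b).symm
    simp only [h1, h2]
    exact h

end ChartData

/-- `C2Bound` differentiates the values χ(v, w) in t, whereas the chart data differentiate χ as a
curve of bilinear maps. -/
theorem iteratedDeriv_clm_apply₂ {E : Type*} [NormedAddCommGroup E] [NormedSpace ℝ E]
    {B : ℝ → E →L[ℝ] E →L[ℝ] ℝ} (hB : ContDiff ℝ ∞ B) (l : ℕ) (t : ℝ) (a b : E) :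
    iteratedDeriv l (fun s ↦ B s a b) t = iteratedDeriv l B t a b := by
  induction l generalizing t with
  | zero => simp
  | succ l ih =>
    have h : iteratedDeriv l (fun s ↦ B s a b) = fun t ↦ iteratedDeriv l B t a b := funext ih
    have hd : HasDerivAt (iteratedDeriv l B) (deriv (iteratedDeriv l B) t) t :=
      ((hB.differentiable_iteratedDeriv l (by exact_mod_cast WithTop.coe_lt_top _)) t).hasDerivAt
    rw [iteratedDeriv_succ, iteratedDeriv_succ, h]
    have := ((hd.clm_apply (hasDerivAt_const t a)).clm_apply (hasDerivAt_const t b)).deriv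
    simpa using this

/-! ### Transfer of the bounds to the chart -/

section ChartBounds

variable {E : Type*} [NormedAddCommGroup E] [NormedSpace ℝ E] [FiniteDimensional ℝ E]
  {H : Type*} [TopologicalSpace H] {I : ModelWithCorners ℝ E H}
  {M : Type*} [TopologicalSpace M] [ChartedSpace H M] [IsManifold I ∞ M]
  {x₀ z : M} {w : E} {J : ∀ x : M, TangentSpace I x →L[ℝ] TangentSpace I x}
  {cov : CovariantDerivative I E (fun x : M ↦ TangentSpace I x)}
  {χ : ∀ x : M, ℝ → TangentSpace I x →L[ℝ] TangentSpace I x →L[ℝ] ℝ} {ψ : M → ℝ → ℝ} {u : M → ℝ}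

/-- The covariant derivative of a tensor with components `Θ`, at the center of the chart. -/
theorem covDeriv_center_components {k : ℕ} {A : CovTensor I M k} {Θ : E → (Fin k → E) → ℝ}
    (hx : extChartAt I x₀ x₀ ∈ interior (extChartAt I x₀).target)
    (hA : ∀ᶠ w in 𝓝 (extChartAt I x₀ x₀), ∀ v : Fin k → E,
      A ((extChartAt I x₀).symm w) (fun i ↦ frame I x₀ _ (v i)) = Θ w v)
    (v : Fin (k + 1) → E) {Θ' : E →L[ℝ] ℝ}
    (hd : HasFDerivAt (fun w ↦ Θ w (fun i ↦ v i.succ)) Θ' (extChartAt I x₀ x₀)) :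
    covDeriv cov A ((extChartAt I x₀).symm (extChartAt I x₀ x₀)) (fun i ↦ frame I x₀ _ (v i))
      = Θ' (v 0) - ∑ i, Θ (extChartAt I x₀ x₀) (Function.update (fun j ↦ v j.succ) i
          (christoffel cov x₀ (extChartAt I x₀ x₀) (v 0) (v i.succ))) := by
  have hev : (fun w ↦ A ((extChartAt I x₀).symm w) (fun i ↦ frame I x₀ _ (v i.succ)))
      =ᶠ[𝓝 (extChartAt I x₀ x₀)] fun w ↦ Θ w (fun i ↦ v i.succ) := hA.mono fun w h ↦ h _
  have hd' := hd.congr_of_eventuallyEq hev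
  have h := covDeriv_center cov hx v hd'.differentiableAt
  rw [hd'.fderiv] at h
  simp only [← hA.self_of_nhds]
  -- The image of x₀ under the chart and back is only propositionally x₀, and the tangent space
  -- depends on it. Generalizing the base point permits the substitution.
  have aux : ∀ z, z = x₀ → covDeriv cov A z (fun i ↦ frame I x₀ z (v i))
      = Θ' (v 0) - ∑ i, A z (fun j ↦ frame I x₀ z (Function.update (fun j ↦ v j.succ) i
          (christoffel cov x₀ (extChartAt I x₀ x₀) (v 0) (v i.succ)) j)) := by
    rintro _ rfl
    exact h
  exact aux _ ((extChartAt I x₀).left_inv (mem_extChartAt_source x₀))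

/-- The covariant derivative of a `3`-tensor at the center of the chart. -/
theorem covDeriv_chart_three {A : CovTensor I M 3} {B : E → E →L[ℝ] E →L[ℝ] E →L[ℝ] ℝ}
    (hx : extChartAt I x₀ x₀ ∈ interior (extChartAt I x₀).target)
    (hA : ∀ᶠ w in 𝓝 (extChartAt I x₀ x₀), ∀ v : Fin 3 → E,
      A ((extChartAt I x₀).symm w) (fun i ↦ frame I x₀ _ (v i)) = B w (v 0) (v 1) (v 2))
    (hB : DifferentiableAt ℝ B (extChartAt I x₀ x₀)) (v : Fin 4 → E) :
    covDeriv cov A ((extChartAt I x₀).symm (extChartAt I x₀ x₀)) (fun i ↦ frame I x₀ _ (v i))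
      = nab3 (christoffel cov x₀) B (extChartAt I x₀ x₀) (v 0) (v 1) (v 2) (v 3) := by
  rw [covDeriv_center_components hx hA v
    (((hB.hasFDerivAt.clm_apply (hasFDerivAt_const _ _)).clm_apply
      (hasFDerivAt_const _ _)).clm_apply (hasFDerivAt_const _ _))]
  simp [Fin.sum_univ_three, nab3, Function.update_apply]
  ring

omit [FiniteDimensional ℝ E] in
theorem frame_ne_zero (hw : w ∈ interior (extChartAt I x₀).target) {a : E} (ha : a ≠ 0) :
    frame I x₀ ((extChartAt I x₀).symm w) a ≠ 0 := by
  intro h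
  apply ha
  rw [← coframe_frame (symm_mem_source hw) a, h, map_zero]

variable [RiemannianBundle (fun x : M ↦ TangentSpace I x)] {n : ℕ} {a b δ κ Λ K : ℝ}

theorem len_chartData (w v : E) : (chartData J cov χ ψ u x₀).len w v
    = ‖frame I x₀ ((extChartAt I x₀).symm w) v‖ := by
  rw [norm_eq_sqrt_real_inner]
  rfl

theorem TensorBound.frame_le {k : ℕ} {A : CovTensor I M k} (h : TensorBound A K) (w : E)
    (v : Fin k → E) :
    |A ((extChartAt I x₀).symm w) (fun i ↦ frame I x₀ _ (v i))|
      ≤ K * ∏ i, (chartData J cov χ ψ u x₀).len w (v i) := by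
  simp only [len_chartData]
  exact h _ _

variable [IsContMDiffRiemannianBundle I ∞ E (fun x : M ↦ TangentSpace I x)]

theorem fderiv_repG (hc : IsChern J cov) (hw : w ∈ interior (extChartAt I x₀).target) (p a b : E) :
    fderiv ℝ (repG I x₀) w p a b = repG I x₀ w (christoffel cov x₀ w p a) b
      + repG I x₀ w a (christoffel cov x₀ w p b) := by
  have h := congr($(nab2_repG hc hw) p a b)
  rw [nab2_apply] at h
  simp only [_root_.zero_apply] at h
  linarith

theorem covDeriv_torsionTensor_chart [T2Space M] (hc : IsChern J cov)
    (hx : extChartAt I x₀ x₀ ∈ interior (extChartAt I x₀).target) (v : Fin 4 → E) :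
    covDeriv cov (torsionTensor cov) ((extChartAt I x₀).symm (extChartAt I x₀ x₀))
        (fun i ↦ frame I x₀ _ (v i))
      = repG I x₀ (extChartAt I x₀ x₀)
        (nabTor (christoffel cov x₀) (extChartAt I x₀ x₀) (v 0) (v 1) (v 2)) (v 3) := by
  have hΓ := contDiffAt_christoffel cov hc.smooth (range_mem_nhds hx)
  have hT := (contDiffAt_tor hΓ).differentiableAt (by simp)
  have hG := (contDiffAt_repG (I := I) hx).differentiableAt (by simp)
  have hA : ∀ᶠ w in 𝓝 (extChartAt I x₀ x₀), ∀ v : Fin 3 → E,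
      torsionTensor cov ((extChartAt I x₀).symm w) (fun i ↦ frame I x₀ _ (v i))
        = repG I x₀ w (tor (christoffel cov x₀) w (v 0) (v 1)) (v 2) := by
    filter_upwards [eventually_mem_interior hx] with w hw v
    rw [torsionTensor, torsion_chart cov hw, repG_apply]
  rw [covDeriv_center_components hx hA v
    ((hG.hasFDerivAt.clm_apply ((hT.hasFDerivAt.clm_apply (hasFDerivAt_const _ _)).clm_apply
      (hasFDerivAt_const _ _))).clm_apply (hasFDerivAt_const _ _))]
  have hG' := fderiv_repG hc hx
  generalize extChartAt I x₀ x₀ = y at hG' ⊢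
  simp [Fin.sum_univ_three, nabTor, Function.update_apply, hG']
  ring

theorem covDeriv_curvatureTensor_chart [T2Space M] (hc : IsChern J cov)
    (hx : extChartAt I x₀ x₀ ∈ interior (extChartAt I x₀).target) (v : Fin 5 → E) :
    covDeriv cov (curvatureTensor cov) ((extChartAt I x₀).symm (extChartAt I x₀ x₀))
        (fun i ↦ frame I x₀ _ (v i))
      = repG I x₀ (extChartAt I x₀ x₀)
        (nabCurv (christoffel cov x₀) (extChartAt I x₀ x₀) (v 0) (v 1) (v 2) (v 3)) (v 4) := by
  have hΓ := contDiffAt_christoffel cov hc.smooth (range_mem_nhds hx)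
  have hR := (contDiffAt_curv (m := 1) (n := 2) (by norm_num)
    (hΓ.of_le ENat.LEInfty.out)).differentiableAt (by simp)
  have hG := (contDiffAt_repG (I := I) hx).differentiableAt (by simp)
  have hA : ∀ᶠ w in 𝓝 (extChartAt I x₀ x₀), ∀ v : Fin 4 → E,
      curvatureTensor cov ((extChartAt I x₀).symm w) (fun i ↦ frame I x₀ _ (v i))
        = repG I x₀ w (curv (christoffel cov x₀) w (v 0) (v 1) (v 2)) (v 3) := by
    filter_upwards [eventually_mem_interior hx,
      (hΓ.of_le (m := 1) ENat.LEInfty.out).eventually (by simp)] with w hw hw' v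
    rw [curvatureTensor, curvature_chart cov hw' hw, repG_apply]
  rw [covDeriv_center_components hx hA v
    ((hG.hasFDerivAt.clm_apply (((hR.hasFDerivAt.clm_apply (hasFDerivAt_const _ _)).clm_apply
      (hasFDerivAt_const _ _)).clm_apply (hasFDerivAt_const _ _))).clm_apply
      (hasFDerivAt_const _ _))]
  have hG' := fderiv_repG hc hx
  generalize extChartAt I x₀ x₀ = y at hG' ⊢
  simp [Fin.sum_univ_four, nabCurv, Function.update_apply, hG']
  ring

omit [IsContMDiffRiemannianBundle I ∞ E (fun x : M ↦ TangentSpace I x)] in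
/-- The covariant derivatives of the `t`-derivatives of a family of forms at the center of the
chart. -/
theorem covDerivIter_formTensor_chart [T2Space M] (hc : IsChern J cov) (hχ : IsSmoothForm11 J χ)
    (hx : extChartAt I x₀ x₀ ∈ interior (extChartAt I x₀).target) (t : ℝ) (l : ℕ)
    {B : E → E →L[ℝ] E →L[ℝ] ℝ} (hB : ∀ w, B w = iteratedDeriv l (repForm χ x₀ w) t)
    (hBd : ContDiffAt ℝ 2 B (extChartAt I x₀ x₀)) :
    (∀ v : Fin 2 → E, covDerivIter cov (fun x v ↦ iteratedDeriv l (fun s ↦ formTensor χ s x v) t) 0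
      ((extChartAt I x₀).symm (extChartAt I x₀ x₀)) (fun i ↦ frame I x₀ _ (v i))
        = B (extChartAt I x₀ x₀) (v 0) (v 1)) ∧
    (∀ v : Fin 3 → E, covDerivIter cov (fun x v ↦ iteratedDeriv l (fun s ↦ formTensor χ s x v) t) 1
      ((extChartAt I x₀).symm (extChartAt I x₀ x₀)) (fun i ↦ frame I x₀ _ (v i))
        = nab2 (christoffel cov x₀) B (extChartAt I x₀ x₀) (v 0) (v 1) (v 2)) ∧
    (∀ v : Fin 4 → E, covDerivIter cov (fun x v ↦ iteratedDeriv l (fun s ↦ formTensor χ s x v) t) 2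
      ((extChartAt I x₀).symm (extChartAt I x₀ x₀)) (fun i ↦ frame I x₀ _ (v i))
        = nab3 (christoffel cov x₀) (nab2 (christoffel cov x₀) B) (extChartAt I x₀ x₀)
          (v 0) (v 1) (v 2) (v 3)) := by
  have hΓ := contDiffAt_christoffel cov hc.smooth (range_mem_nhds hx)
  have h0 : ∀ w ∈ interior (extChartAt I x₀).target, ∀ v : Fin 2 → E,
      iteratedDeriv l (fun s ↦ formTensor χ s ((extChartAt I x₀).symm w)
        (fun i ↦ frame I x₀ _ (v i))) t = B w (v 0) (v 1) := by
    intro w hw v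
    rw [hB, ← iteratedDeriv_clm_apply₂]
    · rfl
    · rw [contDiff_iff_contDiffAt]
      intro s
      exact (contDiffAt_repForm hχ hw s).comp s (f := fun s ↦ (w, s))
        (contDiffAt_const.prodMk contDiffAt_id)
  have h1 : ∀ᶠ w in 𝓝 (extChartAt I x₀ x₀), ∀ v : Fin 3 → E,
      covDeriv cov (fun x v ↦ iteratedDeriv l (fun s ↦ formTensor χ s x v) t)
        ((extChartAt I x₀).symm w) (fun i ↦ frame I x₀ _ (v i))
        = nab2 (christoffel cov x₀) B w (v 0) (v 1) (v 2) := by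
    filter_upwards [eventually_mem_interior hx, hBd.eventually (by simp)] with w hw hBw v
    exact covDeriv_chart_two cov hw ((eventually_mem_interior hw).mono h0)
      (hBw.differentiableAt (by simp)) v
  refine ⟨h0 _ hx, h1.self_of_nhds, fun v ↦ ?_⟩
  exact covDeriv_chart_three hx h1 ((contDiffAt_nab2 (m := 1) (by norm_num)
    (hΓ.of_le ENat.LEInfty.out) hBd).differentiableAt (by simp)) v

/-- At the center of the chart every component is the tensor evaluated on frame vectors, and `len`
is the norm of these, so each bound on M is inherited with the same constant. -/
theorem bounded_chartData [T2Space M]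
    (hx : extChartAt I x₀ x₀ ∈ interior (extChartAt I x₀).target)
    (hJ : IsHermitian I J) (hc : IsChern J cov) (hg : GeometryBound cov κ)
    (hχ : IsSmoothForm11 J χ) (hχb : C2Bound cov (formTensor χ) a Λ)
    (hψ : ContMDiff (I.prod 𝓘(ℝ, ℝ)) 𝓘(ℝ, ℝ) ∞ (fun q : M × ℝ ↦ ψ q.1 q.2))
    (hψb : C2Bound (I := I) cov (fun t ↦ scalarTensor (fun x ↦ ψ x t)) a Λ)
    (hδ : ∀ x, δ ≤ ψ x (u x)) (hu : ContMDiff I 𝓘(ℝ, ℝ) 4 u) (hadm : IsAdmissible J cov χ u)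
    (hub : C1Bound cov u a) (hlap : LaplacianBound n J cov u b) :
    (chartData J cov χ ψ u x₀).Bounded n a b δ κ Λ (extChartAt I x₀ x₀) := by
  set y := extChartAt I x₀ x₀ with hy
  set D := chartData J cov χ ψ u x₀ with hD
  have hu2 : ContDiffAt ℝ 2 (u ∘ (extChartAt I x₀).symm) y :=
    (contDiffAt_of_contMDiffAt ENat.LEInfty.out hx hu.contMDiffAt).of_le (by norm_num)
  -- The parameter value f(y) lies in [-a, a], where the bounds on χ and ψ are available.
  have hup : |D.f y| ≤ a := by
    have := hub 0 (by norm_num) ((extChartAt I x₀).symm y) ![]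
    rw [Fin.prod_univ_zero, mul_one] at this
    exact this
  have hB0 : ContDiffAt ℝ ∞ (fun w ↦ repForm χ x₀ w (D.f y)) y :=
    contDiffAt_slice (contDiffAt_repForm hχ hx _)
  have hB1 : ContDiffAt ℝ 3 (fun p : E × ℝ ↦ deriv (repForm χ x₀ p.1) p.2) (y, D.f y) :=
    contDiffAt_deriv_param (m := 3) (n := 4) (by norm_num)
      ((contDiffAt_repForm hχ hx _).of_le ENat.LEInfty.out)
  have hB2 : ContDiffAt ℝ 2 (fun w ↦ iteratedDeriv 2 (repForm χ x₀ w) (D.f y)) y := by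
    simp only [iteratedDeriv_succ, iteratedDeriv_zero]
    exact contDiffAt_slice (contDiffAt_deriv_param (c := fun w ↦ deriv (repForm χ x₀ w)) (m := 2)
      (n := 3) (by norm_num) hB1)
  have hψ0 : ContDiffAt ℝ 4 (fun p : E × ℝ ↦ ψ ((extChartAt I x₀).symm p.1) p.2) (y, D.f y) :=
    (contDiffAt_param hx hψ.contMDiffAt).of_le ENat.LEInfty.out
  have hψ1 : ContDiffAt ℝ 3 (fun p : E × ℝ ↦ deriv (ψ ((extChartAt I x₀).symm p.1)) p.2)
      (y, D.f y) :=
    contDiffAt_deriv_param (c := fun w ↦ ψ ((extChartAt I x₀).symm w)) (m := 3) (by norm_num) hψ0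
  have hψ0' : ContDiffAt ℝ 2 ((fun x ↦ ψ x (D.f y)) ∘ (extChartAt I x₀).symm) y :=
    (contDiffAt_slice hψ0).of_le (by norm_num)
  have hψ1' : ContDiffAt ℝ 2 ((fun x ↦ deriv (ψ x) (D.f y)) ∘ (extChartAt I x₀).symm) y :=
    (contDiffAt_slice (c := fun w t ↦ deriv (ψ ((extChartAt I x₀).symm w)) t) hψ1).of_le
      (by norm_num)
  have c0 := covDerivIter_formTensor_chart hc hχ hx (D.f y) 0 (fun w ↦ by rw [iteratedDeriv_zero])
    (hB0.of_le ENat.LEInfty.out)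
  have c1 := covDerivIter_formTensor_chart hc hχ hx (D.f y) 1 (fun w ↦ by rw [iteratedDeriv_one])
    ((contDiffAt_slice hB1).of_le (by norm_num))
  have c2 := covDerivIter_formTensor_chart hc hχ hx (D.f y) 2 (fun w ↦ rfl) hB2
  have key : ∀ {k : ℕ} {A : CovTensor I M k} {K : ℝ}, TensorBound A K → ∀ v : Fin k → E,
      |A ((extChartAt I x₀).symm y) (fun i ↦ frame I x₀ _ (v i))| ≤ K * ∏ i, D.len y (v i) :=
    fun h v ↦ h.frame_le y v
  have key' : ∀ {k : ℕ} {A : CovTensor I M k} {K : ℝ}, TensorBound A K → ∀ (v : Fin k → E) {r : ℝ},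
      A ((extChartAt I x₀).symm y) (fun i ↦ frame I x₀ _ (v i)) = r →
      |r| ≤ K * ∏ i, D.len y (v i) := fun h v r hr ↦ hr ▸ key h v
  exact
  { symm := fun v w ↦ real_inner_comm (frame I x₀ ((extChartAt I x₀).symm y) w) _
    pos := fun v hv ↦ real_inner_self_pos.2 (frame_ne_zero hx hv)
    isometry := fun v w ↦ by
      have := hJ.compatible _ (frame I x₀ ((extChartAt I x₀).symm y) v) (frame I x₀ _ w)
      rw [← frame_repJ hx, ← frame_repJ hx] at this
      exact this
    df := fun v ↦ by
      refine LE.le.trans_eq (key' (hub 1 le_rfl) ![v]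
        (covDeriv_scalarTensor_chart cov hx (hu2.differentiableAt (by simp)) ![v])) ?_
      simp
    tor := fun v w z ↦ by
      refine LE.le.trans_eq (key' (hg 0 (by norm_num)).1 ![v, w, z] (r := D.G y (tor D.Γ y v w) z)
        (congrArg (fun t ↦ inner ℝ t (frame I x₀ ((extChartAt I x₀).symm y) z))
          (torsion_chart cov hx v w))) ?_
      simp [Fin.prod_univ_succ, mul_assoc]
    nabTor := fun u v w z ↦ by
      refine LE.le.trans_eq (key' (hg 1 le_rfl).1 ![u, v, w, z] (covDeriv_torsionTensor_chart hc hx ![u, v, w, z])) ?_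
      simp [Fin.prod_univ_succ, mul_assoc]
    curv := fun u v w z ↦ by
      refine LE.le.trans_eq (key' (hg 0 (by norm_num)).2 ![u, v, w, z] (r := D.G y (curv D.Γ y u v w) z)
        (congrArg (fun t ↦ inner ℝ t (frame I x₀ ((extChartAt I x₀).symm y) z))
          (curvature_chart cov ((contDiffAt_christoffel cov hc.smooth
            (range_mem_nhds hx)).of_le ENat.LEInfty.out) hx u v w))) ?_
      simp [Fin.prod_univ_succ, mul_assoc]
    nabCurv := fun p u v w z ↦ by
      refine LE.le.trans_eq (key' (hg 1 le_rfl).2 ![p, u, v, w, z]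
        (covDeriv_curvatureTensor_chart hc hx ![p, u, v, w, z])) ?_
      simp [Fin.prod_univ_succ, mul_assoc]
    χ₀₀ := fun v w ↦ by
      refine LE.le.trans_eq (key' (hχb 0 0 (by norm_num) _ hup) ![v, w] (c0.1 _)) ?_
      simp [Fin.prod_univ_succ]
    χ₁₀ := fun u v w ↦ by
      refine LE.le.trans_eq (key' (hχb 1 0 (by norm_num) _ hup) ![u, v, w] (c0.2.1 _)) ?_
      simp [Fin.prod_univ_succ, mul_assoc]
    χ₂₀ := fun p u v w ↦ by
      refine LE.le.trans_eq (key' (hχb 2 0 (by norm_num) _ hup) ![p, u, v, w] (c0.2.2 _)) ?_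
      simp [Fin.prod_univ_succ, mul_assoc]
    χ₀₁ := fun v w ↦ by
      refine LE.le.trans_eq (key' (hχb 0 1 (by norm_num) _ hup) ![v, w] (c1.1 _)) ?_
      simp [Fin.prod_univ_succ]
    χ₁₁ := fun u v w ↦ by
      refine LE.le.trans_eq (key' (hχb 1 1 (by norm_num) _ hup) ![u, v, w] (c1.2.1 _)) ?_
      simp [Fin.prod_univ_succ, mul_assoc]
    χ₀₂ := fun v w ↦ by
      refine LE.le.trans_eq (key' (hχb 0 2 (by norm_num) _ hup) ![v, w] (c2.1 _)) ?_
      simp [Fin.prod_univ_succ]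
    ψ₁₀ := fun v ↦ by
      have := hψb 1 0 (by norm_num) _ hup
      simp only [iteratedDeriv_zero] at this
      refine LE.le.trans_eq (key' this ![v]
        (covDeriv_scalarTensor_chart cov hx (hψ0'.differentiableAt (by simp)) ![v])) ?_
      simp
    ψ₂₀ := fun v w ↦ by
      have := hψb 2 0 (by norm_num) _ hup
      simp only [iteratedDeriv_zero] at this
      refine LE.le.trans_eq (key' this ![v, w] (covDeriv_covDeriv_scalarTensor_chart cov hx hψ0' ![v, w])) ?_
      simp [Fin.prod_univ_succ]
    ψ₀₁ := by
      have := key' (hψb 0 1 (by norm_num) _ hup) ![] rfl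
      rw [Fin.prod_univ_zero, mul_one] at this
      rw [← iteratedDeriv_one]
      exact this
    ψ₁₁ := fun v ↦ by
      have := hψb 1 1 (by norm_num) _ hup
      simp only [iteratedDeriv_one] at this
      refine LE.le.trans_eq (key' this ![v]
        (covDeriv_scalarTensor_chart cov hx (hψ1'.differentiableAt (by simp)) ![v])) ?_
      simp
    ψ₀₂ := by
      have := key' (hψb 0 2 (by norm_num) _ hup) ![] rfl
      rw [Fin.prod_univ_zero, mul_one] at this
      exact this
    le_ψ := hδ _
    admissible := fun v hv ↦ by
      have := hadm _ _ (frame_ne_zero hx hv)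
      rw [← herm_form_chartData hu hx (ψ := ψ)] at this
      exact this
    laplacian := fun e he ↦ by
      have := hlap ((extChartAt I x₀).symm y) (fun j ↦ frame I x₀ _ (e j)) fun j k ↦ by
        rw [metricComp, component_frame hx]
        exact he j k
      simp only [hessComp, component_frame hx, hess_chart cov hx hu2] at this
      exact this }

end ChartBounds

/-! ### The maximum of the test function and the conclusion -/

theorem exists_forall_le_of_ultrafilter {S : Type*} [Nonempty S] {f : S → ℝ}
    (h : ∀ 𝒰 : Ultrafilter S, ∃ s, Tendsto f 𝒰 (𝓝 (f s))) : ∃ s, ∀ t, f t ≤ f s := by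
  -- In the topology induced by f, convergence means convergence of the values of f. The hypothesis
  -- thus makes S compact, and f is continuous by construction.
  let _ : TopologicalSpace S := TopologicalSpace.induced f inferInstance
  have hcomp : IsCompact (univ : Set S) := by
    rw [isCompact_iff_ultrafilter_le_nhds]
    intro 𝒰 _
    obtain ⟨s, hs⟩ := h 𝒰
    refine ⟨s, mem_univ s, ?_⟩
    rw [nhds_induced]
    exact tendsto_iff_comap.1 hs
  obtain ⟨s, -, hs⟩ := hcomp.exists_isMaxOn univ_nonempty
    (f := f) continuous_induced_dom.continuousOn
  exact ⟨s, fun t ↦ hs (mem_univ t)⟩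

theorem tendsto_clm_apply {E F S : Type*} [NormedAddCommGroup E] [NormedSpace ℝ E]
    [NormedAddCommGroup F] [NormedSpace ℝ F] {l : Filter S} {f : S → E →L[ℝ] F} {c : S → E}
    {f₀ : E →L[ℝ] F} {c₀ : E} (hf : Tendsto f l (𝓝 f₀)) (hc : Tendsto c l (𝓝 c₀)) :
    Tendsto (fun s ↦ f s (c s)) l (𝓝 (f₀ c₀)) :=
  ((isBoundedBilinearMap_apply (𝕜 := ℝ) (E := E) (F := F)).continuous.tendsto (f₀, c₀)).comp
    (hf.prodMk_nhds hc)

section Maximum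

variable {E : Type*} [NormedAddCommGroup E] [NormedSpace ℝ E] [FiniteDimensional ℝ E]
  {H : Type*} [TopologicalSpace H] {I : ModelWithCorners ℝ E H}
  {M : Type*} [TopologicalSpace M] [ChartedSpace H M] [IsManifold I ∞ M]
  {x₀ z : M} {w : E} {J : ∀ x : M, TangentSpace I x →L[ℝ] TangentSpace I x}
  {cov : CovariantDerivative I E (fun x : M ↦ TangentSpace I x)}
  {χ : ∀ x : M, ℝ → TangentSpace I x →L[ℝ] TangentSpace I x →L[ℝ] ℝ} {ψ : M → ℝ → ℝ} {u : M → ℝ}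

omit [FiniteDimensional ℝ E] [IsManifold I ∞ M] in
theorem mem_interior_target_of_isInteriorPoint (h : I.IsInteriorPoint x₀) :
    extChartAt I x₀ x₀ ∈ interior (extChartAt I x₀).target := by
  have h1 : range I ∈ 𝓝 (extChartAt I x₀ x₀) := mem_interior_iff_mem_nhds.1 h
  rw [mem_interior_iff_mem_nhds, ← nhdsWithin_eq_nhds.2 h1]
  exact extChartAt_target_mem_nhdsWithin x₀

/-- The quantity `u_{vv} + (v u)²`. -/
noncomputable def hessAddSq (cov : CovariantDerivative I E (fun x : M ↦ TangentSpace I x))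
    (u : M → ℝ) (z : M) (v : TangentSpace I z) : ℝ :=
  hess cov u z v v + mvfderiv I u z v ^ 2

/-- `u_{vv} + (v u)²` is continuous on the tangent bundle, in terms of components. -/
theorem tendsto_hessAddSq [T2Space M]
    (hs : ContMDiffCovariantDerivativeOn E ∞ cov.toFun (univ : Set M))
    (hu : ContMDiff I 𝓘(ℝ, ℝ) 2 u) {S : Type*} {l : Filter S} {p : S → M} {c : S → E} {c₀ : E}
    (hp : Tendsto p l (𝓝 x₀)) (hc : Tendsto c l (𝓝 c₀)) :
    Tendsto (fun s ↦ hessAddSq cov u (p s) (frame I x₀ (p s) (c s))) l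
      (𝓝 (hessAddSq cov u x₀ (frame I x₀ x₀ c₀))) := by
  have hx := mem_extChartAt_source (I := I) x₀
  have hrange := extChartAt_target_subset_range (I := I) x₀ ((extChartAt I x₀).map_source hx)
  have hφ : Tendsto (fun s ↦ extChartAt I x₀ (p s)) l (𝓝[range I] (extChartAt I x₀ x₀)) := by
    refine tendsto_nhdsWithin_iff.2 ⟨(continuousAt_extChartAt x₀).tendsto.comp hp, ?_⟩
    filter_upwards [hp.eventually (source_mem_nhds hx)] with s h
    exact extChartAt_target_subset_range x₀ ((extChartAt I x₀).map_source h)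
  have hd : ContDiffWithinAt ℝ 1 (fderivWithin ℝ (u ∘ (extChartAt I x₀).symm) (range I)) (range I)
      (extChartAt I x₀ x₀) :=
    ((contMDiffAt_iff_chart ENat.LEInfty.out hx).1 (hu x₀)).fderivWithin_right (m := 1)
      I.uniqueDiffOn (by norm_num) hrange
  have hdd := hd.fderivWithin_right (m := 0) I.uniqueDiffOn (by norm_num) hrange
  have h1 := hd.continuousWithinAt.tendsto.comp hφ
  have h2 := hdd.continuousWithinAt.tendsto.comp hφ
  have h3 := (contMDiffAt_christoffelAt cov hs).continuousAt.tendsto.comp hp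
  have h := ((tendsto_clm_apply (tendsto_clm_apply h2 hc) hc).sub
    (tendsto_clm_apply h1 (tendsto_clm_apply (tendsto_clm_apply h3 hc) hc))).add
    ((tendsto_clm_apply h1 hc).pow 2)
  have key : ∀ z ∈ (extChartAt I x₀).source, ∀ a, hessAddSq cov u z (frame I x₀ z a) = _ :=
    fun z hz a ↦ by
      rw [hessAddSq, hess_frame_within cov hz hu, mvfderiv_frame hz ((hu z).mdifferentiableAt (by simp))]
  rw [key _ hx]
  refine h.congr' ?_
  filter_upwards [hp.eventually (source_mem_nhds hx)] with s h
  rw [key _ h]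
  rfl

variable [RiemannianBundle (fun x : M ↦ TangentSpace I x)]

omit [FiniteDimensional ℝ E] in
theorem tendsto_norm_frame [IsContinuousRiemannianBundle E (fun x : M ↦ TangentSpace I x)]
    {S : Type*} {l : Filter S} {p : S → M} {c : S → E} {c₀ : E}
    (hp : Tendsto p l (𝓝 x₀)) (hc : Tendsto c l (𝓝 c₀)) :
    Tendsto (fun s ↦ ‖frame I x₀ (p s) (c s)‖) l (𝓝 ‖frame I x₀ x₀ c₀‖) := by
  have hx := mem_extChartAt_source (I := I) x₀
  have h1 : ContinuousAt (fun q : M × E ↦ (⟨q.1, frame I x₀ q.1 q.2⟩ : TangentBundle I M))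
      (x₀, c₀) := by
    rw [FiberBundle.continuousAt_totalSpace]
    refine ⟨continuousAt_fst, continuousAt_snd.congr ?_⟩
    filter_upwards [continuousAt_fst.eventually (source_mem_nhds hx)] with q hq
    rw [← coframe_apply hq, coframe_frame hq]
  have h2 : ContinuousAt (fun q : M × E ↦ inner ℝ (frame I x₀ q.1 q.2) (frame I x₀ q.1 q.2))
      (x₀, c₀) := h1.inner_bundle h1
  simp only [real_inner_self_eq_norm_sq] at h2
  have h3 := (Real.continuous_sqrt.continuousAt.comp h2).tendsto.comp (hp.prodMk_nhds hc)
  simpa [Function.comp_def] using h3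

/-- Along an ultrafilter of unit vectors the base points converge, since M is compact. In the
trivialization at the limit the components stay in a closed ball, so they converge too, and the
limit is a unit vector because the norm is continuous. -/
theorem exists_isMax_hessAddSq [T2Space M] [CompactSpace M]
    [IsContinuousRiemannianBundle E (fun x : M ↦ TangentSpace I x)]
    (hs : ContMDiffCovariantDerivativeOn E ∞ cov.toFun (univ : Set M))
    (hu : ContMDiff I 𝓘(ℝ, ℝ) 2 u) {x : M} {τ : TangentSpace I x} (hτ : ‖τ‖ = 1) :
    ∃ (z : M) (v : TangentSpace I z), ‖v‖ = 1 ∧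
      ∀ (y : M) (w : TangentSpace I y), ‖w‖ = 1 → hessAddSq cov u y w ≤ hessAddSq cov u z v := by
  let S := {q : TangentBundle I M // ‖q.2‖ = 1}
  have : Nonempty S := ⟨⟨⟨x, τ⟩, hτ⟩⟩
  suffices h : ∀ 𝒰 : Ultrafilter S, ∃ s : S, Tendsto (fun s : S ↦ hessAddSq cov u s.1.1 s.1.2) 𝒰
      (𝓝 (hessAddSq cov u s.1.1 s.1.2)) by
    obtain ⟨s, hs⟩ := exists_forall_le_of_ultrafilter h
    exact ⟨s.1.1, s.1.2, s.2, fun y w hw ↦ hs ⟨⟨y, w⟩, hw⟩⟩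
  intro 𝒰
  obtain ⟨x₀, -, h₀⟩ := isCompact_univ.ultrafilter_le_nhds (𝒰.map fun s : S ↦ s.1.1) (by simp)
  have hp : Tendsto (fun s : S ↦ s.1.1) 𝒰 (𝓝 x₀) := h₀
  have hsrc := hp.eventually (source_mem_nhds (mem_extChartAt_source (I := I) x₀))
  obtain ⟨C, -, hC⟩ := eventually_norm_trivializationAt_lt E (fun x : M ↦ TangentSpace I x) x₀
  let c : S → E := fun s ↦ coframe I x₀ s.1.1 s.1.2
  have hball : ∀ᶠ s in (𝒰 : Filter S), c s ∈ Metric.closedBall (0 : E) C := by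
    filter_upwards [hp.eventually hC] with s h
    rw [mem_closedBall_zero_iff]
    have := (coframe I x₀ s.1.1).le_opNorm s.1.2
    rw [s.2, mul_one] at this
    exact this.trans h.le
  have : ProperSpace E := FiniteDimensional.proper ℝ E
  obtain ⟨c₀, -, hc₀⟩ := (isCompact_closedBall (0 : E) C).ultrafilter_le_nhds (𝒰.map c)
    (le_principal_iff.2 hball)
  have hc : Tendsto c 𝒰 (𝓝 c₀) := hc₀
  have hnorm : ‖frame I x₀ x₀ c₀‖ = 1 := by
    refine tendsto_nhds_unique (tendsto_norm_frame hp hc) (tendsto_const_nhds.congr' ?_)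
    filter_upwards [hsrc] with s h
    rw [frame_coframe h, s.2]
  refine ⟨⟨⟨x₀, frame I x₀ x₀ c₀⟩, hnorm⟩, (tendsto_hessAddSq hs hu hp hc).congr' ?_⟩
  filter_upwards [hsrc] with s h
  rw [frame_coframe h]

variable [IsContMDiffRiemannianBundle I ∞ E (fun x : M ↦ TangentSpace I x)]
  {n : ℕ} {a b δ κ Λ : ℝ}

theorem hess_le_of_isMax [T2Space M] (hdim : Module.finrank ℝ E = 2 * n) (hn : 0 < n) (hδ : 0 < δ)
    (hx : extChartAt I x₀ x₀ ∈ interior (extChartAt I x₀).target)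
    (hJ : IsHermitian I J) (hc : IsChern J cov) (hg : GeometryBound cov κ)
    (hχ : IsSmoothForm11 J χ) (hχb : C2Bound cov (formTensor χ) a Λ)
    (hψ : ContMDiff (I.prod 𝓘(ℝ, ℝ)) 𝓘(ℝ, ℝ) ∞ (fun q : M × ℝ ↦ ψ q.1 q.2))
    (hψb : C2Bound (I := I) cov (fun t ↦ scalarTensor (fun x ↦ ψ x t)) a Λ)
    (hδψ : ∀ x, δ ≤ ψ x (u x)) (hu : ContMDiff I 𝓘(ℝ, ℝ) 4 u) (hadm : IsAdmissible J cov χ u)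
    (hs : SolvesMA n J cov χ ψ u)
    (hub : C1Bound cov u a) (hlap : LaplacianBound n J cov u b) {τ : TangentSpace I x₀}
    (hτ : ‖τ‖ = 1)
    (hmax : ∀ (y : M) (w : TangentSpace I y), ‖w‖ = 1 →
      hessAddSq cov u y w ≤ hessAddSq cov u x₀ τ) :
    hess cov u x₀ τ τ ≤ hessBound n a b δ κ Λ := by
  set y := extChartAt I x₀ x₀ with hy
  set D := chartData J cov χ ψ u x₀ with hD
  have hb : D.Bounded n a b δ κ Λ y :=
    bounded_chartData hx hJ hc hg hχ hχb hψ hψb hδψ hu hadm hub hlap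
  have hsol : D.Solves n y := solves_chartData hx hJ hc hχ hψ hu hs
  have hf : ContDiffAt ℝ 4 D.f y := hsol.contDiff_f
  have hval : ∀ w ∈ interior (extChartAt I x₀).target, ContDiffAt ℝ 2 D.f w → ∀ v,
      hessAddSq cov u ((extChartAt I x₀).symm w) (frame I x₀ _ v)
        = nab1 D.Γ (fderiv ℝ D.f) w v v + fderiv ℝ D.f w v ^ 2 := by
    intro w hw hfw v
    rw [hessAddSq, hess_chart cov hw hfw, mvfderiv_chart hw (hfw.differentiableAt (by simp))]
    rfl
  -- The maximum is over unit vectors. Both sides are homogeneous of degree 2 in v, so the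
  -- inequality extends to all v.
  have hm : ∀ᶠ w in 𝓝 y, ∀ v, nab1 D.Γ (fderiv ℝ D.f) w v v + fderiv ℝ D.f w v ^ 2
      ≤ hessAddSq cov u x₀ τ * D.G w v v := by
    filter_upwards [eventually_mem_interior hx, (hf.of_le (m := 2) (by norm_num)).eventually
      (by simp)] with w hw hfw v
    have hG : D.G w v v = ‖frame I x₀ ((extChartAt I x₀).symm w) v‖ ^ 2 :=
      real_inner_self_eq_norm_sq (frame I x₀ ((extChartAt I x₀).symm w) v)
    by_cases hv : v = 0
    · simp [hv]
    · have hr := norm_pos_iff.2 (frame_ne_zero hw hv)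
      set r := ‖frame I x₀ ((extChartAt I x₀).symm w) v‖
      have h := hmax _ (frame I x₀ ((extChartAt I x₀).symm w) (r⁻¹ • v)) (by
        rw [map_smul, norm_smul, norm_inv, Real.norm_of_nonneg hr.le]
        exact inv_mul_cancel₀ hr.ne')
      rw [hval w hw hfw] at h
      simp only [map_smul, _root_.smul_apply, smul_eq_mul] at h
      rw [hG]
      calc _ = r ^ 2 * (r⁻¹ * (r⁻¹ * nab1 D.Γ (fderiv ℝ D.f) w v v)
            + (r⁻¹ * fderiv ℝ D.f w v) ^ 2) := by
            field_simp
        _ ≤ r ^ 2 * hessAddSq cov u x₀ τ := by gcongr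
        _ = _ := mul_comm _ _
  have aux : ∀ z, z = (extChartAt I x₀).symm y → ∀ v : TangentSpace I z, ‖v‖ = 1 →
      hessAddSq cov u z v = hessAddSq cov u x₀ τ →
      hess cov u z v v ≤ hessBound n a b δ κ Λ := by
    rintro _ rfl v hv heq
    have hf2 := hf.of_le (m := 2) (by norm_num)
    rw [← frame_coframe (symm_mem_source hx) v] at hv heq ⊢
    rw [hval y hx hf2] at heq
    rw [hess_chart cov hx hf2]
    refine hb.hess_le hsol hdim hn hδ hm ?_ heq
    have : D.G y _ _ = _ := real_inner_self_eq_norm_sq (frame I x₀ ((extChartAt I x₀).symm y)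
      (coframe I x₀ _ v))
    rw [this, hv, one_pow]
  exact aux x₀ ((extChartAt I x₀).left_inv (mem_extChartAt_source x₀)).symm τ hτ rfl

/-- The Hessian bound with an explicit constant. -/
theorem hess_le_add_boundary [T2Space M] [CompactSpace M]
    (hdim : Module.finrank ℝ E = 2 * n) (hn : 0 < n) (hδ : 0 < δ)
    (hJ : IsHermitian I J) (hc : IsChern J cov) (hg : GeometryBound cov κ)
    (hχ : IsSmoothForm11 J χ) (hχb : C2Bound cov (formTensor χ) a Λ)
    (hψ : ContMDiff (I.prod 𝓘(ℝ, ℝ)) 𝓘(ℝ, ℝ) ∞ (fun q : M × ℝ ↦ ψ q.1 q.2))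
    (hψb : C2Bound (I := I) cov (fun t ↦ scalarTensor (fun x ↦ ψ x t)) a Λ)
    (hδψ : ∀ x, δ ≤ ψ x (u x)) (hu : ContMDiff I 𝓘(ℝ, ℝ) 4 u) (hadm : IsAdmissible J cov χ u)
    (hs : SolvesMA n J cov χ ψ u)
    (hub : C1Bound cov u a) (hlap : LaplacianBound n J cov u b) {B : ℝ} (hB : 0 ≤ B)
    (hbd : ∀ x ∈ I.boundary M, ∀ σ : TangentSpace I x, ‖σ‖ = 1 → hess cov u x σ σ ≤ B)
    {x : M} {τ : TangentSpace I x} (hτ : ‖τ‖ = 1) :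
    hess cov u x τ τ ≤ hessBound n a b δ κ Λ + a ^ 2 + B := by
  have : IsContinuousRiemannianBundle E (fun x : M ↦ TangentSpace I x) := by
    obtain ⟨g, hg, hg'⟩ := IsContMDiffRiemannianBundle.exists_contMDiff (IB := I) (n := ∞) (F := E)
      (E := fun x : M ↦ TangentSpace I x)
    exact ⟨g, hg.continuous, hg'⟩
  obtain ⟨z, v, hv, hmax⟩ := exists_isMax_hessAddSq hc.smooth (hu.of_le (by norm_num)) hτ
  have hdu : mvfderiv I u z v ^ 2 ≤ a ^ 2 := by
    have := hub 1 le_rfl z ![v]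
    change |covDeriv cov (scalarTensor u) z ![v]| ≤ _ at this
    rw [covDeriv_scalarTensor] at this
    simp only [Nat.reduceAdd, Fin.prod_univ_one, Matrix.cons_val_fin_one, hv, mul_one] at this
    exact sq_le_sq' (abs_le.1 this).1 (abs_le.1 this).2
  have h1 : hess cov u x τ τ ≤ hess cov u z v v + mvfderiv I u z v ^ 2 :=
    le_trans (le_add_of_nonneg_right (sq_nonneg _)) (hmax x τ hτ)
  have hone : 1 ≤ hessBound n a b δ κ Λ := le_max_left _ _
  -- Over an interior point the estimate at a maximum applies, over a boundary point the hypothesis.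
  -- Both `hessBound` and B are nonnegative, so their sum covers either case, and the gradient term
  -- costs a².
  rcases I.isInteriorPoint_or_isBoundaryPoint z with hz | hz
  · have := hess_le_of_isMax hdim hn hδ (mem_interior_target_of_isInteriorPoint hz) hJ hc hg hχ hχb hψ
      hψb hδψ hu hadm hs hub hlap hv hmax
    linarith
  · have := hbd z hz v hv
    linarith

end Maximum

end HermitianMA

end

theorem proposition5p1 (n : ℕ) (hn : 2 ≤ n) (a b δ κ Λ : ℝ) (hδ : 0 < δ) :
    ∃ C : ℝ, 0 < C ∧
      ∀ (H : Type*) [TopologicalSpace H]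
        (I : ModelWithCorners ℝ (EuclideanSpace ℝ (Fin (2 * n))) H)
        (M : Type*) [TopologicalSpace M] [T2Space M] [CompactSpace M] [ChartedSpace H M]
        [IsManifold I ∞ M] [RiemannianBundle (fun x : M ↦ TangentSpace I x)]
        [IsContMDiffRiemannianBundle I ∞ (EuclideanSpace ℝ (Fin (2 * n)))
          (fun x : M ↦ TangentSpace I x)]
        (J : ∀ x : M, TangentSpace I x →L[ℝ] TangentSpace I x)
        (cov : CovariantDerivative I (EuclideanSpace ℝ (Fin (2 * n)))
          (fun x : M ↦ TangentSpace I x))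
        (χ : ∀ x : M, ℝ → TangentSpace I x →L[ℝ] TangentSpace I x →L[ℝ] ℝ)
        (ψ : M → ℝ → ℝ) (u : M → ℝ),
        -- `M` is Hermitian with Chern connection `cov`, with torsion and curvature bounded by `κ`
        HermitianMA.IsHermitian I J → HermitianMA.IsChern J cov →
        HermitianMA.GeometryBound cov κ →
        -- the data `χ` and `ψ` are smooth, with `C²` norms bounded by `Λ`
        HermitianMA.IsSmoothForm11 J χ →
        HermitianMA.C2Bound cov (HermitianMA.formTensor χ) a Λ →
        ContMDiff (I.prod 𝓘(ℝ, ℝ)) 𝓘(ℝ, ℝ) ∞ (fun q : M × ℝ ↦ ψ q.1 q.2) →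
        HermitianMA.C2Bound cov (fun t ↦ HermitianMA.scalarTensor (fun x ↦ ψ x t)) a Λ →
        (∀ x, δ ≤ ψ x (u x)) →
        -- `u` is an admissible `C⁴` solution with `|u|_{C¹} ≤ a` and `Δu ≤ b`
        ContMDiff I 𝓘(ℝ, ℝ) 4 u → HermitianMA.IsAdmissible J cov χ u →
        HermitianMA.SolvesMA n J cov χ ψ u →
        HermitianMA.C1Bound cov u a → HermitianMA.LaplacianBound n J cov u b →
        -- the bound, up to the values on the boundary (take `B = 0` if the boundary is empty)
        ∀ B : ℝ, 0 ≤ B →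
          (∀ x ∈ I.boundary M, ∀ σ : TangentSpace I x, ‖σ‖ = 1 → HermitianMA.hess cov u x σ σ ≤ B) →
          ∀ (x : M) (τ : TangentSpace I x), ‖τ‖ = 1 → HermitianMA.hess cov u x τ τ ≤ C + B := by
  refine ⟨HermitianMA.Chart.hessBound n a b δ κ Λ + a ^ 2, ?_, ?_⟩
  · have : 1 ≤ HermitianMA.Chart.hessBound n a b δ κ Λ := le_max_left _ _
    linarith [sq_nonneg a]
  · intro H _ I M _ _ _ _ _ _ _ J cov χ ψ u hJ hc hg hχ hχb hψ hψb hδψ hu hadm hs hub hlap B hB hbd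
      x τ hτ
    exact HermitianMA.hess_le_add_boundary (by simp) (by omega) hδ hJ hc hg hχ hχb hψ hψb hδψ hu
      hadm hs hub hlap hB hbd hτ
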